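/- Let $p$ be a prime, $e\ge 2$, $r\ge 1$, $1\le t\le k$ and $N\ge 1$ integers. Let $GR(p^e,r)=\mathbb Z_{p^e}[x]/\langle h(x)\rangle$ be the Galois ring, where $h$ is monic of degree $r$ and irreducible modulo $p$. Let $$\mathcal R_e=GR(p^e,r)[y]/\langle g(y),\,p^{e-1}y^t\rangle,\qquad g(y)=y^k+p(g_{k-1}y^{k-1}+\cdots+g_1y+g_0)\in GR(p^e,r)[y],$$ with $g_0$ a unit of $GR(p^e,r)$. Each $a\in\mathcal R_e$ is uniquely $$a=\sum_{i=0}^{k-1}\sum_{s=0}^{r-1}a_{i,s}x^sy^i,\qquad a_{i,s}\in\mathbb Z_{p^e}\ (i<t),\quad a_{i,s}\in\mathbb Z_{p^{e-1}}\ (i\ge t),$$ where elements of $\mathbb Z_{p^{e-1}}$ are represented by integers. Fix a primitive $p^e$-th root of unity $\xi\in\mathbb C$ and put $$\chi_a(b)=\xi^{\sum_{s=0}^{r-1}\left(\sum_{i=0}^{t-1}a_{i,s}b_{i,s}+p\sum_{j=t}^{k-1}a_{j,s}b_{j,s}\right)}\quad(a,b\in\mathcal R_e),\qquad \chi_{\mathbf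 u}(\mathbf v)=\prod_{l}\chi_{u_l}(v_l)\quad(\mathbf u,\mathbf v\in\mathcal R_e^N).$$ An additive code of length $N$ over $\mathcal R_e$ is an additive subgroup $\mathcal C$ of $\mathcal R_e^N$. Its dual is $\mathcal C^{\perp_\chi}=\{\mathbf d\in\mathcal R_e^N:\chi_{\mathbf d}(\mathbf c)=1\text{ for all }\mathbf c\in\mathcal C\}$, and $\mathcal C$ is an ACD code if $\mathcal C\cap\mathcal C^{\perp_\chi}=\{0\}$. Let $L_p(n,s)$ be the number of $s$-dimensional subspaces $D$ of $\mathbb F_p^n$ with $D\cap D^{\perp}=\{0\}$ for the standard dot product (Euclidean LCD codes of length $n$ and dimension $s$ over $\mathbb F_p$). Then the number of ACD codes of length $N$ over $\mathcal R_e$ (the zero code included) is $$\sum_{i=0}^{Nrt}\ \sum_{j=0}^{Nr(k-t)}L_p(Nrt,i)\,L_p\bigl(Nr(k-t),j\bigr)\,p^{(Nrt-i)(e-1)(i+j)+(Nr(k-t)-j)\left((e-1)i+(e-2)j\right)},$$ where for $n\in\{Nrt,\,Nr(k-t)\}$ the numbers $L_p(n,s)$, $0\le s\le n$, are given as follows.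 Write $\binom{m}{l}_q=\prod_{i=0}^{l-1}\frac{q^m-q^i}{q^l-q^i}$ for Gaussian binomial coefficients. First, $L_p(n,0)=L_p(n,n)=1$. Now let $1\le s\le n-1$. (a) If $p=2$, then $$L_2(n,s)=\begin{cases}2^{\frac{(n-s)(s+1)}2}\binom{(n-1)/2}{(s-1)/2}_4 & n,s\text{ odd},\\[2pt] 2^{\frac{ns-s^2+n-1}2}\binom{(n-2)/2}{(s-1)/2}_4 & n\text{ even},\ s\text{ odd},\\[2pt] 2^{\frac{s(n-s+1)}2}\binom{(n-1)/2}{s/2}_4 & n\text{ odd},\ s\text{ even},\\[2pt] 2^{\frac{ns-s^2-2}2}\Bigl((2^s+1)\binom{(n-2)/2}{s/2}_4+(2^{n-s+1}-2^{n-s}+1)\binom{(n-2)/2}{(s-2)/2}_4\Bigr) & n,s\text{ even}.\end{cases}$$ (b) If $p$ is odd, then $$L_p(n,s)=\begin{cases}p^{\frac{(n-s)(s+1)}2}\binom{(n-1)/2}{(s-1)/2}_{p^2} & n,s\text{ odd},\\[2pt] p^{\frac{ns-s^2-1}2}(p^{n/2}-1)\binom{(n-2)/2}{(s-1)/2}_{p^2}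 & s\text{ odd},\ n\text{ even, and } p\equiv1\ (\mathrm{mod}\ 4)\text{ or }n\equiv0\ (\mathrm{mod}\ 4),\\[2pt] p^{\frac{ns-s^2-1}2}(p^{n/2}+1)\binom{(n-2)/2}{(s-1)/2}_{p^2} & s\text{ odd},\ p\equiv3\ (\mathrm{mod}\ 4),\ n\equiv2\ (\mathrm{mod}\ 4),\\[2pt] p^{\frac{s(n-s+1)}2}\binom{(n-1)/2}{s/2}_{p^2} & s\text{ even},\ n\text{ odd},\\[2pt] p^{\frac{s(n-s)}2}\binom{n/2}{s/2}_{p^2} & n,s\text{ even}.\end{cases}$$ -/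

import Mathlib

open Polynomial

noncomputable section

/-- The data presenting a chain ring `GR(p^e, r)[y] / ⟨g(y), p^(e-1) y^t⟩` with invariants
`p, e, r, k, t` where `2 ≤ e` and `1 ≤ t ≤ k`. The Galois ring `GR(p^e, r)` is
`(ZMod (p^e))[x] / ⟨h(x)⟩` for a monic basic irreducible polynomial `h` of degree `r`
(basic irreducible: the reduction of `h` modulo `p` is irreducible), and
`g(y) = y^k + p (g_(k-1) y^(k-1) + ⋯ + g_1 y + g_0)` where `g_0` is a unit. -/
structure EisensteinData (p e r k t : ℕ) where
  two_le_e : 2 ≤ e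
  one_le_t : 1 ≤ t
  t_le_k : t ≤ k
  h : (ZMod (p ^ e))[X]
  h_monic : h.Monic
  h_natDegree : h.natDegree = r
  h_basicIrreducible : Irreducible
    (h.map (ZMod.castHom (dvd_pow_self p (show e ≠ 0 by omega)) (ZMod p)))
  gcoeff : Fin k → AdjoinRoot h
  isUnit_gcoeff_zero : IsUnit (gcoeff ⟨0, by omega⟩)

namespace EisensteinData

variable {p e r k t : ℕ} (E : EisensteinData p e r k t)

/-- The Galois ring `GR(p^e, r)`. -/
abbrev GR : Type := AdjoinRoot E.h

/-- The Eisenstein polynomial `g`. -/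
def g : (E.GR)[X] := X ^ k + C (p : E.GR) * ∑ i : Fin k, C (E.gcoeff i) * X ^ (i : ℕ)

/-- The ideal `⟨g(y), p^(e-1) y^t⟩`. -/
def relIdeal : Ideal (E.GR)[X] := Ideal.span {E.g, C ((p : E.GR) ^ (e - 1)) * X ^ t}

/-- The chain ring `GR(p^e, r)[y] / ⟨g(y), p^(e-1) y^t⟩`. -/
abbrev ChainRing : Type := (E.GR)[X] ⧸ E.relIdeal

end EisensteinData

/-- The group `(ℤ/p^e)^(rt) ⊕ (ℤ/p^(e-1))^(r(k-t))`. A coordinate of the first block is indexed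
by `(i, s)` with `0 ≤ i < t`, `0 ≤ s < r`; the entry `(j, s)` of the second block belongs to
the monomial `x^s y^(t+j)`, `0 ≤ j < k - t`. -/
abbrev MixedCoords (p e r k t : ℕ) : Type :=
  (Fin t → Fin r → ZMod (p ^ e)) × (Fin (k - t) → Fin r → ZMod (p ^ (e - 1)))

namespace EisensteinData

variable {p e r k t : ℕ} (E : EisensteinData p e r k t)

/-- The polynomial `∑_(i<t) ∑_s a_(i,s) x^s y^i + ∑_(t≤j<k) ∑_s a_(j,s) x^s y^j`, where
`a_(j,s) ∈ ℤ/p^(e-1)` is represented by an integer in `[0, p^(e-1))`. -/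
def polyOfCoords (v : MixedCoords p e r k t) : (E.GR)[X] :=
  (∑ i : Fin t, C (∑ s : Fin r, AdjoinRoot.of E.h (v.1 i s) * AdjoinRoot.root E.h ^ (s : ℕ))
      * X ^ (i : ℕ))
  + ∑ j : Fin (k - t),
      C (∑ s : Fin r, AdjoinRoot.of E.h ((v.2 j s).val : ZMod (p ^ e))
        * AdjoinRoot.root E.h ^ (s : ℕ)) * X ^ (t + (j : ℕ))

/-- The class of `polyOfCoords v` in the chain ring. -/
def ofCoords (v : MixedCoords p e r k t) : E.ChainRing :=
  Ideal.Quotient.mk E.relIdeal (E.polyOfCoords v)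

section Coordinates

theorem dvd_of_castHom_eq_zero [Fact p.Prime] (x : ZMod (p ^ e))
    (hx : ZMod.castHom (pow_dvd_pow p (Nat.sub_le e 1)) (ZMod (p ^ (e - 1))) x = 0) :
    (p : ZMod (p ^ e)) ^ (e - 1) ∣ x := by
  have : NeZero (p ^ e) := ⟨pow_ne_zero _ (Fact.out : p.Prime).ne_zero⟩
  rw [← ZMod.natCast_zmod_val x, map_natCast, ZMod.natCast_eq_zero_iff] at hx
  rw [← ZMod.natCast_zmod_val x]
  exact_mod_cast Nat.cast_dvd_cast (α := ZMod (p ^ e)) hx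

theorem castHom_eq_zero_of_dvd (x : ZMod (p ^ e)) (hx : (p : ZMod (p ^ e)) ^ (e - 1) ∣ x) :
    ZMod.castHom (pow_dvd_pow p (Nat.sub_le e 1)) (ZMod (p ^ (e - 1))) x = 0 := by
  obtain ⟨y, rfl⟩ := hx
  have : (p : ZMod (p ^ (e - 1))) ^ (e - 1) = 0 := by
    exact_mod_cast ZMod.natCast_self (p ^ (e - 1))
  rw [map_mul, map_pow, map_natCast, this, zero_mul]

/-- The element `∑_s a_s x^s` of the Galois ring. -/
def grOfCoords (a : Fin r → ZMod (p ^ e)) : E.GR :=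
  ∑ s : Fin r, AdjoinRoot.of E.h (a s) * AdjoinRoot.root E.h ^ (s : ℕ)

theorem grOfCoords_sub (a b : Fin r → ZMod (p ^ e)) :
    E.grOfCoords (a - b) = E.grOfCoords a - E.grOfCoords b := by
  simp [grOfCoords, sub_mul, Finset.sum_sub_distrib]

theorem grOfCoords_mul (z : ZMod (p ^ e)) (a : Fin r → ZMod (p ^ e)) :
    E.grOfCoords (fun s => z * a s) = AdjoinRoot.of E.h z * E.grOfCoords a := by
  simp [grOfCoords, Finset.mul_sum, mul_assoc]

theorem grOfCoords_bijective : Function.Bijective E.grOfCoords := by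
  have hd : (AdjoinRoot.powerBasis' E.h_monic).dim = r := by
    rw [AdjoinRoot.powerBasis'_dim, E.h_natDegree]
  let b := (AdjoinRoot.powerBasis' E.h_monic).basis.reindex (finCongr hd)
  have : E.grOfCoords = b.equivFun.symm := by
    funext a
    rw [Module.Basis.equivFun_symm_apply]
    refine Finset.sum_congr rfl fun s _ => ?_
    simp [b, Algebra.smul_def]
  rw [this]
  exact b.equivFun.symm.bijective

theorem dvd_coords_of_dvd (a : Fin r → ZMod (p ^ e))
    (h : (p : E.GR) ^ (e - 1) ∣ E.grOfCoords a) (s : Fin r) :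
    (p : ZMod (p ^ e)) ^ (e - 1) ∣ a s := by
  obtain ⟨y, hy⟩ := h
  obtain ⟨b, rfl⟩ := E.grOfCoords_bijective.2 y
  have h2 : E.grOfCoords a = E.grOfCoords (fun s => (p : ZMod (p ^ e)) ^ (e - 1) * b s) := by
    rw [hy, grOfCoords_mul, map_pow, map_natCast]
  rw [E.grOfCoords_bijective.1 h2]
  exact dvd_mul_right _ _

theorem dvd_grOfCoords (a : Fin r → ZMod (p ^ e))
    (h : ∀ s, (p : ZMod (p ^ e)) ^ (e - 1) ∣ a s) :
    (p : E.GR) ^ (e - 1) ∣ E.grOfCoords a := by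
  refine Finset.dvd_sum fun s _ => Dvd.dvd.mul_right ?_ _
  have := map_dvd (AdjoinRoot.of E.h) (h s)
  rwa [map_pow, map_natCast] at this

theorem nontrivial_GR [Fact p.Prime] : Nontrivial E.GR := by
  have h0 : 0 < E.h.natDegree := by
    have h1 := (Polynomial.natDegree_pos_iff_degree_pos.2
      (Polynomial.degree_pos_of_irreducible E.h_basicIrreducible))
    exact h1.trans_le (Polynomial.natDegree_map_le)
  have : Fact (1 < p ^ e) :=
    ⟨Nat.one_lt_pow (by have := E.two_le_e; omega) (Fact.out : p.Prime).one_lt⟩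
  refine Ideal.Quotient.nontrivial_iff.2 ?_
  rw [Ne, Ideal.span_singleton_eq_top]
  intro hu
  have := E.h_monic.eq_one_of_isUnit hu
  rw [this] at h0
  simp at h0

theorem degree_gtail_lt :
    (C (p : E.GR) * ∑ i : Fin k, C (E.gcoeff i) * X ^ (i : ℕ)).degree < (k : ℕ) := by
  rw [← Polynomial.mem_degreeLT, ← Polynomial.smul_eq_C_mul]
  refine Submodule.smul_mem _ _ (Submodule.sum_mem _ fun i _ => ?_)
  rw [Polynomial.mem_degreeLT]
  exact (Polynomial.degree_C_mul_X_pow_le _ _).trans_lt (by exact_mod_cast i.2)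

theorem g_monic : E.g.Monic :=
  Polynomial.monic_X_pow_add E.degree_gtail_lt

theorem degree_g [Fact p.Prime] : E.g.degree = k := by
  have := E.nontrivial_GR
  rw [g, Polynomial.degree_add_eq_left_of_degree_lt, Polynomial.degree_X_pow]
  rw [Polynomial.degree_X_pow]
  exact E.degree_gtail_lt

theorem pow_mul_X_pow : C ((p : E.GR) ^ (e - 1)) * X ^ k = C ((p : E.GR) ^ (e - 1)) * E.g := by
  have he := E.two_le_e
  have h0 : (p : E.GR) ^ (e - 1) * (p : E.GR) = 0 := by
    rw [← pow_succ, show e - 1 + 1 = e by omega]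
    have h1 : AdjoinRoot.of E.h ((p ^ e : ℕ) : ZMod (p ^ e)) = 0 := by
      rw [ZMod.natCast_self, map_zero]
    rwa [map_natCast, Nat.cast_pow] at h1
  rw [g, mul_add, ← mul_assoc, ← C_mul, h0]
  simp

theorem coeff_of_mem [Fact p.Prime] (q : (E.GR)[X]) (hq : q ∈ E.relIdeal) (hd : q.degree < (k : ℕ)) (n : ℕ) :
    (n < t → q.coeff n = 0) ∧ (p : E.GR) ^ (e - 1) ∣ q.coeff n := by
  have := E.nontrivial_GR
  obtain ⟨a, b, hab⟩ := Ideal.mem_span_pair.1 hq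
  set m := b * X ^ t with hm
  have hsplit := Polynomial.modByMonic_add_div m (X ^ k)
  set m1 := m %ₘ X ^ k
  set m2 := m /ₘ X ^ k
  have hd1 : m1.degree < (k : ℕ) := by
    have := Polynomial.degree_modByMonic_lt m (Polynomial.monic_X_pow k (R := E.GR))
    rwa [Polynomial.degree_X_pow] at this
  have hq1 : q - C ((p : E.GR) ^ (e - 1)) * m1 = 0 := by
    by_contra hne
    refine E.g_monic.not_dvd_of_degree_lt hne ?_ ?_
    · rw [E.degree_g]
      refine (Polynomial.degree_sub_le _ _).trans_lt (max_lt hd ?_)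
      rw [← Polynomial.mem_degreeLT] at hd1 ⊢
      rw [← Polynomial.smul_eq_C_mul]
      exact Submodule.smul_mem _ _ hd1
    · refine ⟨a + C ((p : E.GR) ^ (e - 1)) * m2, ?_⟩
      have h3 : b * (C ((p : E.GR) ^ (e - 1)) * X ^ t)
          = C ((p : E.GR) ^ (e - 1)) * (m1 + X ^ k * m2) := by
        rw [hsplit, hm]; ring
      rw [← hab, h3]
      linear_combination m2 * E.pow_mul_X_pow
  rw [sub_eq_zero] at hq1
  rw [hq1, Polynomial.coeff_C_mul]
  refine ⟨fun hn => ?_, dvd_mul_right _ _⟩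
  have hm1 : m1.coeff n = m.coeff n := by
    rw [← hsplit, Polynomial.coeff_add, Polynomial.coeff_X_pow_mul',
      if_neg (by have := E.t_le_k; omega), add_zero]
  rw [hm1, hm, Polynomial.coeff_mul_X_pow', if_neg (by omega), mul_zero]

theorem polyOfCoords_eq (v : MixedCoords p e r k t) :
    E.polyOfCoords v = (∑ i : Fin t, C (E.grOfCoords (v.1 i)) * X ^ (i : ℕ))
      + ∑ j : Fin (k - t),
        C (E.grOfCoords fun s => ((v.2 j s).val : ZMod (p ^ e))) * X ^ (t + (j : ℕ)) := rfl

theorem degree_polyOfCoords (v : MixedCoords p e r k t) :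
    (E.polyOfCoords v).degree < (k : ℕ) := by
  have := E.t_le_k
  rw [← Polynomial.mem_degreeLT, polyOfCoords_eq]
  refine Submodule.add_mem _ (Submodule.sum_mem _ fun i _ => ?_)
    (Submodule.sum_mem _ fun j _ => ?_)
  · rw [Polynomial.mem_degreeLT]
    exact (Polynomial.degree_C_mul_X_pow_le _ _).trans_lt (by exact_mod_cast i.2.trans_le this)
  · rw [Polynomial.mem_degreeLT]
    exact (Polynomial.degree_C_mul_X_pow_le _ _).trans_lt
      (by exact_mod_cast (by omega : t + (j : ℕ) < k))

theorem coeff_polyOfCoords_left (v : MixedCoords p e r k t) (i : Fin t) :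
    (E.polyOfCoords v).coeff i = E.grOfCoords (v.1 i) := by
  rw [polyOfCoords_eq, Polynomial.coeff_add, Polynomial.finsetSum_coeff,
    Polynomial.finsetSum_coeff, Finset.sum_eq_single i, Finset.sum_eq_zero]
  · simp
  · intro j _
    rw [Polynomial.coeff_C_mul_X_pow, if_neg (by omega)]
  · intro j _ hj
    rw [Polynomial.coeff_C_mul_X_pow, if_neg (fun h => hj (Fin.ext h.symm))]
  · simp

theorem coeff_polyOfCoords_right (v : MixedCoords p e r k t) (j : Fin (k - t)) :
    (E.polyOfCoords v).coeff (t + j)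
      = E.grOfCoords fun s => ((v.2 j s).val : ZMod (p ^ e)) := by
  rw [polyOfCoords_eq, Polynomial.coeff_add, Polynomial.finsetSum_coeff,
    Polynomial.finsetSum_coeff, Finset.sum_eq_zero, Finset.sum_eq_single j]
  · simp
  · intro i _ hi
    rw [Polynomial.coeff_C_mul_X_pow, if_neg (fun h => hi (Fin.ext (by omega)))]
  · simp
  · intro i _
    rw [Polynomial.coeff_C_mul_X_pow, if_neg (by omega)]

theorem castHom_val [Fact p.Prime] (b : ZMod (p ^ (e - 1))) :
    ZMod.castHom (pow_dvd_pow p (Nat.sub_le e 1)) (ZMod (p ^ (e - 1)))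
      ((b.val : ℕ) : ZMod (p ^ e)) = b := by
  have : NeZero (p ^ (e - 1)) := ⟨pow_ne_zero _ (Fact.out : p.Prime).ne_zero⟩
  rw [map_natCast, ZMod.natCast_zmod_val]

/-- Every element of the chain ring has a unique coordinate family. -/
theorem ofCoords_bijective [Fact p.Prime] : Function.Bijective E.ofCoords := by
  have htk := E.t_le_k
  constructor
  · intro v w hvw
    have hmem : E.polyOfCoords v - E.polyOfCoords w ∈ E.relIdeal := Ideal.Quotient.eq.1 hvw
    have hc := E.coeff_of_mem _ hmem ((Polynomial.degree_sub_le _ _).trans_lt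
      (max_lt (E.degree_polyOfCoords v) (E.degree_polyOfCoords w)))
    refine Prod.ext (funext fun i => ?_) (funext fun j => funext fun s => ?_)
    · have := (hc i).1 i.2
      rw [Polynomial.coeff_sub, coeff_polyOfCoords_left, coeff_polyOfCoords_left,
        sub_eq_zero] at this
      exact E.grOfCoords_bijective.1 this
    · have := (hc (t + j)).2
      rw [Polynomial.coeff_sub, coeff_polyOfCoords_right, coeff_polyOfCoords_right,
        ← grOfCoords_sub] at this
      have h2 := castHom_eq_zero_of_dvd _ (E.dvd_coords_of_dvd _ this s)
      rw [Pi.sub_apply, map_sub, castHom_val, castHom_val, sub_eq_zero] at h2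
      exact h2
  · intro a
    obtain ⟨f, rfl⟩ := Ideal.Quotient.mk_surjective a
    choose u hu using fun n => E.grOfCoords_bijective.2 ((f %ₘ E.g).coeff n)
    let w : MixedCoords p e r k t := (fun i => u i, fun j s =>
      ZMod.castHom (pow_dvd_pow p (Nat.sub_le e 1)) (ZMod (p ^ (e - 1))) (u (t + j) s))
    refine ⟨w, ?_⟩
    have hmod : Ideal.Quotient.mk E.relIdeal f = Ideal.Quotient.mk E.relIdeal (f %ₘ E.g) := by
      refine Ideal.Quotient.eq.2 ?_
      rw [show f - f %ₘ E.g = (f /ₘ E.g) * E.g by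
        linear_combination -(Polynomial.modByMonic_add_div f E.g)]
      exact Ideal.mul_mem_left _ _ (Ideal.subset_span (by simp))
    rw [hmod, ofCoords]
    refine Ideal.Quotient.eq.2 ?_
    have := E.nontrivial_GR
    have hdeg : (f %ₘ E.g).degree < (k : ℕ) := by
      have := Polynomial.degree_modByMonic_lt f E.g_monic
      rwa [E.degree_g] at this
    have hdiff : E.polyOfCoords w - f %ₘ E.g ∈ Polynomial.degreeLT E.GR k :=
      Submodule.sub_mem _ (Polynomial.mem_degreeLT.2 (E.degree_polyOfCoords w))
        (Polynomial.mem_degreeLT.2 hdeg)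
    rw [Polynomial.as_sum_support_C_mul_X_pow (E.polyOfCoords w - f %ₘ E.g)]
    refine Ideal.sum_mem _ fun n _ => ?_
    by_cases hnk : k ≤ n
    · rw [Polynomial.coeff_eq_zero_of_degree_lt
        ((Polynomial.mem_degreeLT.1 hdiff).trans_le (by exact_mod_cast hnk))]
      simp
    by_cases hnt : n < t
    · have : (E.polyOfCoords w - f %ₘ E.g).coeff n = 0 := by
        rw [Polynomial.coeff_sub, E.coeff_polyOfCoords_left w ⟨n, hnt⟩, ← hu n, sub_self]
      rw [this]
      simp
    obtain ⟨j, rfl⟩ := Nat.exists_eq_add_of_le (not_lt.1 hnt)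
    have hdvd : (p : E.GR) ^ (e - 1) ∣ (E.polyOfCoords w - f %ₘ E.g).coeff (t + j) := by
      rw [Polynomial.coeff_sub, E.coeff_polyOfCoords_right w ⟨j, by omega⟩, ← hu (t + j),
        ← grOfCoords_sub]
      refine E.dvd_grOfCoords _ fun s => dvd_of_castHom_eq_zero _ ?_
      rw [Pi.sub_apply, map_sub, castHom_val, sub_self]
    obtain ⟨z, hz⟩ := hdvd
    rw [hz, show C ((p : E.GR) ^ (e - 1) * z) * X ^ (t + j)
      = (C z * X ^ j) * (C ((p : E.GR) ^ (e - 1)) * X ^ t) by rw [C_mul, pow_add]; ring]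
    exact Ideal.mul_mem_left _ _ (Ideal.subset_span (by simp))

end Coordinates

/-- The coordinate map `Ψ`: every `a` in the chain ring is uniquely
`∑ a_(i,s) x^s y^i`, and `Ψ a` is the family of the coefficients `a_(i,s)`. -/
def Psi [Fact p.Prime] : E.ChainRing ≃ MixedCoords p e r k t :=
  (Equiv.ofBijective E.ofCoords E.ofCoords_bijective).symm

/-- The character `χ_a` of the additive group of the chain ring, evaluated at `b`, where `ξ` is
a primitive `p^e`-th root of unity:
`∏_s (∏_(i<t) ξ^(a_(i,s) b_(i,s))) (∏_(t≤j<k) ξ^(p a_(j,s) b_(j,s)))`. -/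
def chi [Fact p.Prime] (ξ : ℂ) (a b : E.ChainRing) : ℂ :=
  ∏ s : Fin r,
    ((∏ i : Fin t, ξ ^ ((E.Psi a).1 i s * (E.Psi b).1 i s).val) *
      ∏ j : Fin (k - t), ξ ^ (p * ((E.Psi a).2 j s * (E.Psi b).2 j s).val))

/-- The character `χ_u` of the additive group of `N`-tuples, evaluated at `v`. -/
def chiVec [Fact p.Prime] {N : ℕ} (ξ : ℂ) (u v : Fin N → E.ChainRing) : ℂ :=
  ∏ l : Fin N, E.chi ξ (u l) (v l)

/-- The `χ`-dual of an additive code. -/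
def chiDual [Fact p.Prime] {N : ℕ} (ξ : ℂ) (D : AddSubgroup (Fin N → E.ChainRing)) :
    Set (Fin N → E.ChainRing) :=
  {d | ∀ c ∈ D, E.chiVec ξ d c = 1}

/-- Additive codes with complementary dual. -/
def IsACD [Fact p.Prime] {N : ℕ} (ξ : ℂ) (D : AddSubgroup (Fin N → E.ChainRing)) : Prop :=
  (D : Set (Fin N → E.ChainRing)) ∩ E.chiDual ξ D = {0}

end EisensteinData

/-- Euclidean LCD codes over `ℤ/p`: the code meets its Euclidean dual only in `0`. -/
def IsEuclideanLCD {p n : ℕ} (D : Submodule (ZMod p) (Fin n → ZMod p)) : Prop :=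
  (D : Set (Fin n → ZMod p)) ∩ {d | ∀ c ∈ D, ∑ i, d i * c i = 0} = {0}

/-- `L_p(n, s)`: the number of Euclidean LCD codes of length `n` and dimension `s` over
`ℤ/p`. -/
def numLCD (p n s : ℕ) : ℕ :=
  Nat.card {D : Submodule (ZMod p) (Fin n → ZMod p) //
    Module.finrank (ZMod p) D = s ∧ IsEuclideanLCD D}

/-- The Gaussian binomial coefficient (used for `s ≤ n` and `q ≥ 2`). -/
def gaussBinom (n s q : ℕ) : ℚ :=
  (∏ i ∈ Finset.range s, ((q : ℚ) ^ n - (q : ℚ) ^ i)) /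
    ∏ i ∈ Finset.range s, ((q : ℚ) ^ s - (q : ℚ) ^ i)

/-- The closed form for `L_2(n, s)`, `1 ≤ s ≤ n - 1`. All divisions by `2` in the exponents and
in the Gaussian binomials are exact. -/
def lcdFormulaTwo (n s : ℕ) : ℚ :=
  if Odd n then
    if Odd s then
      2 ^ ((n - s) * (s + 1) / 2) * gaussBinom ((n - 1) / 2) ((s - 1) / 2) 4
    else
      2 ^ (s * (n - s + 1) / 2) * gaussBinom ((n - 1) / 2) (s / 2) 4
  else
    if Odd s then
      2 ^ ((n * s - s ^ 2 + n - 1) / 2) * gaussBinom ((n - 2) / 2) ((s - 1) / 2) 4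
    else
      2 ^ ((n * s - s ^ 2 - 2) / 2) *
        ((2 ^ s + 1) * gaussBinom ((n - 2) / 2) (s / 2) 4 +
          (2 ^ (n - s + 1) - 2 ^ (n - s) + 1) * gaussBinom ((n - 2) / 2) ((s - 2) / 2) 4)

/-- The closed form for `L_p(n, s)`, `1 ≤ s ≤ n - 1`, when `p` is an odd prime. -/
def lcdFormulaOdd (p n s : ℕ) : ℚ :=
  if Odd n then
    if Odd s then
      (p : ℚ) ^ ((n - s) * (s + 1) / 2) * gaussBinom ((n - 1) / 2) ((s - 1) / 2) (p ^ 2)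
    else
      (p : ℚ) ^ (s * (n - s + 1) / 2) * gaussBinom ((n - 1) / 2) (s / 2) (p ^ 2)
  else
    if Odd s then
      if p % 4 = 1 ∨ n % 4 = 0 then
        (p : ℚ) ^ ((n * s - s ^ 2 - 1) / 2) * ((p : ℚ) ^ (n / 2) - 1) *
          gaussBinom ((n - 2) / 2) ((s - 1) / 2) (p ^ 2)
      else
        (p : ℚ) ^ ((n * s - s ^ 2 - 1) / 2) * ((p : ℚ) ^ (n / 2) + 1) *
          gaussBinom ((n - 2) / 2) ((s - 1) / 2) (p ^ 2)
    else
      (p : ℚ) ^ (s * (n - s) / 2) * gaussBinom (n / 2) (s / 2) (p ^ 2)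

/-- The closed form for `L_p(n, s)`, `0 ≤ s ≤ n`. -/
def lcdFormula (p n s : ℕ) : ℚ :=
  if s = 0 ∨ s = n then 1 else if p = 2 then lcdFormulaTwo n s else lcdFormulaOdd p n s

end

/-! Write e = c + 1. In coordinates the ambient group is G = (ℤ/p^(c+1))^m ⊕ (ℤ/p^c)^n with m = Nrt
and n = Nr(k-t), and the character is ξ raised to the nondegenerate symmetric pairing β(x, y) =
x₁·y₁ + p x₂·y₂. A code is ACD exactly when β restricted to it has trivial radical (`isACD_iff`).
Such a subgroup D represents all its own characters through β, so there is an orthogonal projection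
onto D; hence ACD codes correspond to self-adjoint idempotents of End(G)
(`card_anisotropic_eq_card_idempotent`).

Taking the two diagonal blocks modulo p gives a surjective ring homomorphism from End(G) to M_m(𝔽_p)
× M_n(𝔽_p). Its kernel is nil and it turns adjoints into transposes. Every pair of symmetric
idempotents lifts to a self-adjoint idempotent P, and the other lifts are projections onto graphs
over P, parametrised by the kernel elements f with f P = f and P f = 0 (`card_idempotent_fiber`).
Their number depends only on the conjugacy class of the residues, so it can be computed for a
coordinate projection (`card_corner`); this produces the power of p in the formula. Symmetric
idempotents of rank s over 𝔽_p are in turn the orthogonal projections onto LCD codes of dimension s,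
which gives the double sum.

It remains to count nondegenerate subspaces of 𝔽_p^n. Pairs (v, W) with v anisotropic in W are
counted twice, and passing to the complement of v lowers all dimensions by one
(`card_anisotropic_mul`). The recursion needs an invariant that survives this step. For p = 2 it is
whether W and its complement are alternating, controlled by the characteristic vector w with B(w, x)
= B(x, x). For odd p it is the class of the discriminant, read off from quadratic exponential sums,
which also give the number of vectors of each norm. The solutions are quotients of orders of
isometry groups (`card_nonalternating`, `card_nondegOn_hasSign`), and rational identities convert
these into the stated closed forms. -/

/-! ### Self-adjoint idempotents over a nil kernel -/

section SelfAdjointIdempotents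

variable {R S : Type*} [Ring R] [Ring S]

theorem isUnit_of_map_eq_one {π : R →+* S} (hnil : ∀ x, π x = 0 → IsNilpotent x) {x : R}
    (hx : π x = 1) : IsUnit x := by
  have := (hnil (x - 1) (by simp [hx])).isUnit_one_add
  simpa using this

theorem isUnit_of_isUnit_map {π : R →+* S} (hπ : Function.Surjective π)
    (hnil : ∀ x, π x = 0 → IsNilpotent x) {x : R} (hx : IsUnit (π x)) : IsUnit x := by
  obtain ⟨u, hu⟩ := hx
  obtain ⟨y, hy⟩ := hπ (↑u⁻¹)
  have h1 : IsUnit (x * y) := isUnit_of_map_eq_one hnil (by rw [map_mul, hy, ← hu, Units.mul_inv])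
  have h2 : IsUnit (y * x) := isUnit_of_map_eq_one hnil (by rw [map_mul, hy, ← hu, Units.inv_mul])
  obtain ⟨a, ha⟩ := h1
  obtain ⟨b, hb⟩ := h2
  have hr : x * (y * ↑a⁻¹) = 1 := by rw [← mul_assoc, ← ha, Units.mul_inv]
  have hl : (↑b⁻¹ * y) * x = 1 := by rw [mul_assoc, ← hb, Units.inv_mul]
  have := left_inv_eq_right_inv hl hr
  exact ⟨⟨x, y * ↑a⁻¹, hr, this ▸ hl⟩, rfl⟩

/-- Additive anti-automorphisms of order two. -/
structure IsAntiInvolution (σ : R → R) : Prop where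
  add : ∀ x y, σ (x + y) = σ x + σ y
  mul : ∀ x y, σ (x * y) = σ y * σ x
  invol : ∀ x, σ (σ x) = x

namespace IsAntiInvolution

variable {σ : R → R} (hσ : IsAntiInvolution σ)
include hσ

theorem one : σ 1 = 1 := by
  have := hσ.mul (σ 1) 1
  rw [mul_one, hσ.invol, mul_one] at this
  exact this.symm

theorem zero : σ 0 = 0 := by
  have := hσ.add 0 0
  simpa using this

theorem neg (x : R) : σ (-x) = -σ x := by
  have := hσ.add x (-x)
  rw [add_neg_cancel, hσ.zero] at this
  exact (neg_eq_of_add_eq_zero_right this.symm).symm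

theorem sub (x y : R) : σ (x - y) = σ x - σ y := by
  rw [sub_eq_add_neg, hσ.add, hσ.neg, ← sub_eq_add_neg]

theorem unit_inv (u : Rˣ) (hu : σ u = u) : σ (↑u⁻¹ : R) = ↑u⁻¹ := by
  have := hσ.mul u (↑u⁻¹ : R)
  rw [Units.mul_inv, hσ.one, hu] at this
  exact (left_inv_eq_right_inv this.symm (Units.mul_inv u))

/-- A self-adjoint element that is idempotent up to a nilpotent can be corrected to a
self-adjoint idempotent with the same image. -/
theorem exists_idempotent_of_pow (π : R →+* S) (n : ℕ) : ∀ x : R, σ x = x →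
    IsIdempotentElem (π x) → (x ^ 2 - x) ^ n = 0 →
    ∃ P : R, σ P = P ∧ IsIdempotentElem P ∧ π P = π x := by
  induction n with
  | zero =>
    intro x h1 _ h3
    rw [pow_zero] at h3
    have hall : ∀ y : R, y = 0 := fun y => by rw [← mul_one y, h3, mul_zero]
    exact ⟨x, h1, (hall _).trans (hall _).symm, rfl⟩
  | succ n ih =>
    intro x h1 h2 h3
    -- Exponent one is separate: the squaring of the error used below gives 2n ≥ n + 1 only for n ≥
    -- 1.
    rcases Nat.eq_zero_or_pos n with rfl | hn
    · refine ⟨x, h1, ?_, rfl⟩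
      rw [zero_add, pow_one, sub_eq_zero, sq] at h3
      exact h3
    -- The polynomial 3X² - 2X³ fixes 0 and 1 and has derivative zero at both, so it makes the
    -- defect x² - x divisible by its own square. Its coefficients are integers, so self-adjointness
    -- is kept and 2 need not be invertible.
    have hπ : π (3 * x ^ 2 - 2 * x ^ 3) = π x := by
      have h2' : π x * π x = π x := h2
      have h2'' : π x ^ 3 = π x := by rw [pow_succ, sq, h2', h2']
      rw [map_sub, map_mul, map_mul, map_pow, map_pow, sq, h2', h2'', map_ofNat, map_ofNat]
      noncomm_ring
    have hσx : σ (3 * x ^ 2 - 2 * x ^ 3) = 3 * x ^ 2 - 2 * x ^ 3 := by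
      have e1 : (3 : R) * x ^ 2 - 2 * x ^ 3
          = x * x + x * x + x * x - (x * x * x + x * x * x) := by
        noncomm_ring
      rw [e1]
      simp only [hσ.sub, hσ.add, hσ.mul, h1, mul_assoc]
    have hpow : ((3 * x ^ 2 - 2 * x ^ 3) ^ 2 - (3 * x ^ 2 - 2 * x ^ 3)) ^ n = 0 := by
      have e1 : (3 * x ^ 2 - 2 * x ^ 3) ^ 2 - (3 * x ^ 2 - 2 * x ^ 3)
          = (x ^ 2 - x) ^ 2 * (4 * x ^ 2 - 4 * x - 3) := by noncomm_ring
      have hc : Commute ((x ^ 2 - x) ^ 2) (4 * x ^ 2 - 4 * x - 3) := by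
        have hx : Commute (x ^ 2 - x) x := by
          show _ * _ = _ * _
          noncomm_ring
        have h4 : Commute ((x ^ 2 - x) ^ 2) x := hx.pow_left 2
        exact (((Nat.cast_commute 4 _).symm.mul_right (h4.pow_right 2)).sub_right
          ((Nat.cast_commute 4 _).symm.mul_right h4)).sub_right (Nat.cast_commute 3 _).symm
      rw [e1, hc.mul_pow, ← pow_mul, show 2 * n = (n + 1) + (n - 1) by omega, pow_add, h3,
        zero_mul, zero_mul]
    obtain ⟨P, hP⟩ := ih _ hσx (hπ.symm ▸ h2) hpow
    exact ⟨P, hP.1, hP.2.1, hP.2.2.trans hπ⟩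

variable {π : R →+* S} (hnil : ∀ x, π x = 0 → IsNilpotent x)
include hnil

theorem exists_idempotent_lift {x : R} (hx : σ x = x) (hi : IsIdempotentElem (π x)) :
    ∃ P : R, σ P = P ∧ IsIdempotentElem P ∧ π P = π x := by
  obtain ⟨n, hn⟩ := hnil (x ^ 2 - x) (by
    have h2 : π x * π x = π x := hi
    rw [map_sub, map_pow, sq, h2, sub_self])
  exact hσ.exists_idempotent_of_pow π n x hx hi hn

/-- The self-adjoint idempotents `Q` congruent to a given one `P` are parametrised by the
elements `f` of the kernel with `f P = f` and `P f = 0`. -/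
theorem card_idempotent_fiber (hker : ∀ x, π x = 0 → π (σ x) = 0) {P : R}
    (hP : IsIdempotentElem P) (hPσ : σ P = P) :
    Nat.card {Q : R // (σ Q = Q ∧ IsIdempotentElem Q) ∧ π Q = π P} =
      Nat.card {f : R // π f = 0 ∧ f * P = f ∧ P * f = 0} := by
  have hPP : P * P = P := hP
  -- Think of P + f as the inclusion of the graph of f over the range of P. Its Gram operator is (1
  -- + σ(f) f) P, so the self-adjoint projection onto the graph is (P + f)(1 + σ(f) f)⁻¹(P + σ f).
  have hu : ∀ f : R, π f = 0 → ∃ u : Rˣ, (u : R) = 1 + σ f * f := fun f hf => by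
    obtain ⟨u, hu⟩ := isUnit_of_map_eq_one hnil (x := 1 + σ f * f) (by simp [hf])
    exact ⟨u, hu⟩
  -- Conversely the range of Q projects isomorphically onto that of P. Inverting the corner P Q P,
  -- completed by 1 - P to a unit of the whole ring, recovers f as the slope of the graph.
  have hw : ∀ Q : R, π Q = π P → ∃ w : Rˣ, (w : R) = P * Q * P + (1 - P) := fun Q hQ => by
    obtain ⟨u, hu⟩ := isUnit_of_map_eq_one hnil (x := P * Q * P + (1 - P)) (by
      rw [map_add, map_sub, map_mul, map_mul, hQ, ← map_mul, ← map_mul, hPP, hPP, map_one]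
      abel)
    exact ⟨u, hu⟩
  choose! u hu using hu
  choose! w hw using hw
  have fwd : ∀ f : R, π f = 0 → f * P = f → P * f = 0 →
      P * (↑(u f)⁻¹ : R) = (↑(u f)⁻¹ : R) * P ∧ σ (↑(u f)⁻¹ : R) = (↑(u f)⁻¹ : R) ∧
      (P + σ f) * (P + f) = u f * P ∧ P * σ f = σ f ∧ σ f * P = 0 ∧
      π (↑(u f)⁻¹ : R) = 1 := by
    intro f h1 h2 h3
    have h4 : P * σ f = σ f := by
      have := congrArg σ h2
      rwa [hσ.mul, hPσ] at this
    have h5 : σ f * P = 0 := by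
      have := congrArg σ h3
      rwa [hσ.mul, hPσ, hσ.zero] at this
    have hc : Commute P (u f : R) := by
      show P * _ = _ * P
      rw [hu f h1, mul_add, add_mul, ← mul_assoc, h4, mul_assoc, h2, mul_one, one_mul]
    refine ⟨hc.units_inv_right, hσ.unit_inv _ ?_, ?_, h4, h5, ?_⟩
    · rw [hu f h1, hσ.add, hσ.one, hσ.mul, hσ.invol]
    · rw [hu f h1, add_mul, mul_add, mul_add, add_mul, hPP, h3, h5, mul_assoc, h2, one_mul]
      abel
    · have h6 : π (u f : R) = 1 := by rw [hu f h1, map_add, map_mul, h1, mul_zero, map_one, add_zero]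
      have h7 := congrArg π (Units.mul_inv (u f))
      rwa [map_mul, h6, one_mul, map_one] at h7
  refine Nat.card_congr
    { toFun := fun Q => ⟨(1 - P) * Q * P * (↑(w Q.1)⁻¹ : R), ?_, ?_, ?_⟩
      invFun := fun f => ⟨(P + f) * (↑(u f.1)⁻¹ : R) * (P + σ f), ⟨?_, ?_⟩, ?_⟩
      left_inv := ?_
      right_inv := ?_ }
  · obtain ⟨Q, ⟨hQσ, hQ⟩, hQP⟩ := Q
    simp only
    rw [map_mul, map_mul, map_mul, hQP, mul_assoc (π _) (π P), ← map_mul π P P, hPP, ← map_mul,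
      sub_mul, one_mul, hPP, sub_self, map_zero, zero_mul]
  · obtain ⟨Q, ⟨hQσ, hQ⟩, hQP⟩ := Q
    simp only
    have hc : Commute P (w Q : R) := by
      show _ * _ = _ * _
      rw [hw Q hQP, mul_add, add_mul, mul_assoc (P * Q) P P, hPP, ← mul_assoc, ← mul_assoc, hPP]
      noncomm_ring
    have h := (hc.units_inv_right).eq
    rw [mul_assoc, ← h, ← mul_assoc, mul_assoc _ P P, hPP]
  · rw [← mul_assoc, ← mul_assoc, ← mul_assoc, mul_sub, hPP, mul_one, sub_self, zero_mul,
      zero_mul, zero_mul]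
  · obtain ⟨f, h1, h2, h3⟩ := f
    obtain ⟨a1, a2, a3, a4, a5, a6⟩ := fwd f h1 h2 h3
    simp only
    rw [hσ.mul, hσ.mul, hσ.add, hσ.add, hσ.invol, hPσ, a2, mul_assoc]
  · obtain ⟨f, h1, h2, h3⟩ := f
    obtain ⟨a1, a2, a3, a4, a5, a6⟩ := fwd f h1 h2 h3
    show _ * _ = _
    simp only
    have : P * (P + σ f) = P + σ f := by rw [mul_add, hPP, a4]
    calc (P + f) * ↑(u f)⁻¹ * (P + σ f) * ((P + f) * ↑(u f)⁻¹ * (P + σ f))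
        = (P + f) * ↑(u f)⁻¹ * ((P + σ f) * (P + f)) * ↑(u f)⁻¹ * (P + σ f) := by noncomm_ring
      _ = (P + f) * (↑(u f)⁻¹ * u f) * (P * ↑(u f)⁻¹) * (P + σ f) := by
        rw [a3]; simp only [mul_assoc]
      _ = (P + f) * ↑(u f)⁻¹ * (P * (P + σ f)) := by
        rw [Units.inv_mul, mul_one, a1]; simp only [mul_assoc]
      _ = _ := by rw [this]
  · obtain ⟨f, h1, h2, h3⟩ := f
    obtain ⟨a1, a2, a3, a4, a5, a6⟩ := fwd f h1 h2 h3
    simp only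
    rw [map_mul, map_mul, map_add, map_add, h1, hker f h1, a6, add_zero, mul_one, ← map_mul, hPP]
  · rintro ⟨Q, ⟨hQσ, hQ⟩, hQP⟩
    have hQQ : Q * Q = Q := hQ
    set v : R := ↑(w Q)⁻¹ with hv
    set f : R := (1 - P) * Q * P * v with hf
    have hc : Commute P (w Q : R) := by
      show _ * _ = _ * _
      rw [hw Q hQP, mul_add, add_mul, mul_assoc (P * Q) P P, hPP, ← mul_assoc, ← mul_assoc, hPP]
      noncomm_ring
    have hcv : P * v = v * P := hc.units_inv_right
    have hPw : P * (w Q : R) = P * Q * P := by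
      rw [hw Q hQP, mul_add, ← mul_assoc, ← mul_assoc, hPP, mul_sub, mul_one, hPP, sub_self,
        add_zero]
    have hPQPv : P * Q * P * v = P := by
      rw [← hPw, mul_assoc, hv, Units.mul_inv, mul_one]
    have hwσ : σ (w Q : R) = w Q := by
      rw [hw Q hQP, hσ.add, hσ.sub, hσ.mul, hσ.mul, hσ.one, hPσ, hQσ, mul_assoc]
    have hvσ : σ v = v := hσ.unit_inv _ hwσ
    have hPf : P + f = Q * P * v := by
      have : f = Q * P * v - P * Q * P * v := by rw [hf]; noncomm_ring
      rw [this, hPQPv]; abel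
    have hPf' : P + σ f = v * P * Q := by
      have := congrArg σ hPf
      rwa [hσ.add, hσ.mul (Q * P), hσ.mul Q, hPσ, hQσ, hvσ, ← mul_assoc] at this
    have hf1 : π f = 0 := by
      rw [hf, map_mul, map_mul, map_mul, hQP, mul_assoc (π _) (π P), ← map_mul π P P, hPP,
        ← map_mul, sub_mul, one_mul, hPP, sub_self, map_zero, zero_mul]
    have hf2 : f * P = f := by
      rw [hf, mul_assoc, ← hcv, ← mul_assoc, mul_assoc _ P P, hPP]
    have hf3 : P * f = 0 := by
      rw [hf, ← mul_assoc, ← mul_assoc, ← mul_assoc, mul_sub, hPP, mul_one, sub_self, zero_mul,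
        zero_mul, zero_mul]
    obtain ⟨a1, a2, a3, a4, a5, a6⟩ := fwd f hf1 hf2 hf3
    set u' : R := ↑(u f)⁻¹ with hu'
    have huP : (u f : R) * P = v * P := by
      rw [← a3, hPf, hPf']
      calc v * P * Q * (Q * P * v) = v * (P * (Q * Q) * P * v) := by noncomm_ring
        _ = v * P := by rw [hQQ, hPQPv]
    have hP2 : P = u' * v * P := by
      rw [mul_assoc, ← huP, ← mul_assoc, hu', Units.inv_mul, one_mul]
    have hPvP : P * u' * v = P := by
      rw [a1, mul_assoc, hcv, ← mul_assoc, ← hP2]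
    have key : (P + f) * u' * (P + σ f) = Q * P * v * P * Q := by
      rw [hPf, hPf']
      calc Q * P * v * u' * (v * P * Q) = Q * (P * v) * u' * v * P * Q := by noncomm_ring
        _ = Q * v * (P * u' * v) * P * Q := by rw [hcv]; noncomm_ring
        _ = Q * (v * P) * P * Q := by rw [hPvP]; noncomm_ring
        _ = Q * P * v * P * Q := by rw [← hcv]; noncomm_ring
    refine Subtype.ext ?_
    show (P + f) * u' * (P + σ f) = Q
    rw [key]
    set Q' : R := Q * P * v * P * Q with hQ'
    have b1 : Q * Q' = Q' := by rw [hQ']; simp only [← mul_assoc, hQQ]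
    have b2 : Q' * Q = Q' := by rw [hQ', mul_assoc, hQQ]
    have b3 : Q' * Q' = Q' := by
      rw [hQ']
      calc Q * P * v * P * Q * (Q * P * v * P * Q)
          = Q * P * v * (P * (Q * Q) * P * v) * P * Q := by noncomm_ring
        _ = Q * P * v * (P * P) * Q := by rw [hQQ, hPQPv]; noncomm_ring
        _ = _ := by rw [hPP]
    -- The reconstructed Q' is an idempotent with Q Q' = Q' Q = Q', so Q - Q' is idempotent. It also
    -- lies in the nil kernel, and a nilpotent idempotent is zero.
    have hT : IsIdempotentElem (Q - Q') := by
      show _ * _ = _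
      rw [mul_sub, sub_mul, sub_mul, hQQ, b1, b2, b3]; abel
    have hπw : π (w Q : R) = 1 := by
      rw [hw Q hQP, map_add, map_sub, map_mul, map_mul, hQP, ← map_mul, ← map_mul, hPP, hPP,
        map_one]
      abel
    have hπv : π v = 1 := by
      have h7 := congrArg π (Units.mul_inv (w Q))
      rwa [map_mul, hπw, one_mul, map_one] at h7
    have hT0 : π (Q - Q') = 0 := by
      rw [hQ', map_sub, map_mul, map_mul, map_mul, map_mul, hQP, hπv, mul_one, ← map_mul, hPP,
        ← map_mul, hPP, ← map_mul, hPP, sub_self]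
    exact (sub_eq_zero.1 (hT.eq_zero_of_isNilpotent (hnil _ hT0))).symm
  · rintro ⟨f, h1, h2, h3⟩
    obtain ⟨a1, a2, a3, a4, a5, a6⟩ := fwd f h1 h2 h3
    refine Subtype.ext ?_
    simp only
    set v : R := ↑(u f)⁻¹ with hv
    set Q : R := (P + f) * v * (P + σ f) with hQ
    have hQP : π Q = π P := by
      rw [hQ, map_mul, map_mul, map_add, map_add, h1, hker f h1, a6, add_zero, mul_one,
        ← map_mul, hPP]
    have c1 : P * (P + f) = P := by rw [mul_add, hPP, h3, add_zero]
    have c2 : (P + σ f) * P = P := by rw [add_mul, hPP, a5, add_zero]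
    have hw' : (w Q : R) = P * v + (1 - P) := by
      rw [hw Q hQP, hQ]
      congr 1
      calc P * ((P + f) * v * (P + σ f)) * P = (P * (P + f)) * v * ((P + σ f) * P) := by
            noncomm_ring
        _ = P * v := by rw [c1, c2, mul_assoc, ← a1, ← mul_assoc, hPP]
    have d1 : (1 - P) * Q * P = f * v := by
      rw [hQ]
      calc (1 - P) * ((P + f) * v * (P + σ f)) * P
          = ((P + f) - P * (P + f)) * v * ((P + σ f) * P) := by noncomm_ring
        _ = f * (v * P) := by rw [c1, c2]; noncomm_ring
        _ = f * v := by rw [← a1, ← mul_assoc, h2]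
    rw [d1]
    -- Since f annihilates 1 - P on the right, only the corner P v of w Q is seen, and w Q then
    -- cancels in the recovered slope.
    have d2 : f * (w Q : R) = f * v := by
      rw [hw', mul_add, ← mul_assoc, h2, mul_sub, h2, mul_one, sub_self, add_zero]
    rw [← d2, mul_assoc, Units.mul_inv, mul_one]

omit hσ in
/-- Conjugate residues give equinumerous parameter spaces. -/
theorem card_corner_eq_of_conj (hπ : Function.Surjective π) {P E : R}
    (hP : IsIdempotentElem P) (hE : IsIdempotentElem E) (s : Sˣ)
    (hs : π P * s = s * π E) :
    Nat.card {f : R // π f = 0 ∧ f * P = f ∧ P * f = 0} =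
      Nat.card {f : R // π f = 0 ∧ f * E = f ∧ E * f = 0} := by
  have hPP : P * P = P := hP
  have hEE : E * E = E := hE
  obtain ⟨x, hx⟩ := hπ s
  -- Any lift x of s is corrected to an element that intertwines P and E exactly. Its residue is
  -- still s because s already intertwines the residues, so it is a unit.
  have hg : IsUnit (P * x * E + (1 - P) * x * (1 - E)) := by
    refine isUnit_of_isUnit_map hπ hnil ?_
    have : π (P * x * E + (1 - P) * x * (1 - E)) = s := by
      simp only [map_add, map_mul, map_sub, hx, sub_mul, mul_sub, one_mul, mul_one, hs]
      rw [mul_assoc, ← map_mul π E E, hEE]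
      abel
    rw [this]
    exact s.isUnit
  obtain ⟨g, hg⟩ := hg
  have hPg : P * (g : R) = g * E := by
    rw [hg]
    simp only [mul_add, add_mul, mul_sub, sub_mul, mul_one, one_mul, ← mul_assoc, hPP]
    simp only [mul_assoc, hEE]
    abel
  have hPg' : (↑g⁻¹ : R) * P = E * ↑g⁻¹ := by
    rw [Units.inv_mul_eq_iff_eq_mul, ← mul_assoc, ← hPg, mul_assoc, Units.mul_inv, mul_one]
  refine Nat.card_congr
    { toFun := fun f => ⟨↑g⁻¹ * f * g, ?_, ?_, ?_⟩
      invFun := fun f => ⟨g * f * ↑g⁻¹, ?_, ?_, ?_⟩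
      left_inv := fun f => Subtype.ext (by simp [mul_assoc])
      right_inv := fun f => Subtype.ext (by simp [mul_assoc]) }
  · rw [map_mul, map_mul, f.2.1, mul_zero, zero_mul]
  · rw [mul_assoc, ← hPg, ← mul_assoc, mul_assoc _ _ P, f.2.2.1]
  · rw [← mul_assoc, ← mul_assoc, ← hPg', mul_assoc _ P, f.2.2.2, mul_zero, zero_mul]
  · rw [map_mul, map_mul, f.2.1, mul_zero, zero_mul]
  · rw [mul_assoc, hPg', ← mul_assoc, mul_assoc _ _ E, f.2.2.1]
  · rw [← mul_assoc, ← mul_assoc, hPg, mul_assoc _ E, f.2.2.2, mul_zero, zero_mul]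

end IsAntiInvolution

end SelfAdjointIdempotents


/-! ### Complemented subgroups of a finite group with a symmetric pairing -/

section Pairing

variable {G : Type*} [AddCommGroup G] {q : ℕ} (β : G →+ G →+ ZMod q)

/-- The restriction of `β` to `D` has trivial radical. -/
def AddSubgroup.IsAnisotropicFor (D : AddSubgroup G) : Prop :=
  ∀ d ∈ D, (∀ c ∈ D, β d c = 0) → d = 0

variable {β} [Finite G] [NeZero q]

/-- Sending d to the character of D induced by β(d, ·) is injective because the radical is trivial.
A finite abelian group has as many complex characters as elements, so every character of D arises
this way, including the one coming from φ. -/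
theorem AddSubgroup.IsAnisotropicFor.exists_rep {D : AddSubgroup G} (hD : D.IsAnisotropicFor β)
    (φ : G →+ ZMod q) : ∃ d ∈ D, ∀ c ∈ D, β d c = φ c := by
  classical
  have := Fintype.ofFinite G
  let T : (G →+ ZMod q) → AddChar D ℂ := fun ψ =>
    (ZMod.stdAddChar (N := q)).compAddMonoidHom (ψ.comp D.subtype)
  have hT : ∀ ψ ψ' : G →+ ZMod q, T ψ = T ψ' → ∀ c ∈ D, ψ c = ψ' c := by
    intro ψ ψ' h c hc
    exact ZMod.injective_stdAddChar (DFunLike.congr_fun h (⟨c, hc⟩ : D))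
  have hinj : Function.Injective fun d : D => T (β d) := by
    intro d d' h
    have := hD (d - d') (D.sub_mem d.2 d'.2) fun c hc => by
      rw [map_sub, AddMonoidHom.sub_apply, hT _ _ h c hc, sub_self]
    exact Subtype.ext (sub_eq_zero.1 this)
  have hbij := (Fintype.bijective_iff_injective_and_card _).2 ⟨hinj, AddChar.card_eq.symm⟩
  obtain ⟨d, hd⟩ := hbij.2 (T φ)
  exact ⟨d, d.2, hT _ _ hd⟩

variable (hsymm : ∀ x y, β x y = β y x) (hnd : ∀ x, (∀ y, β x y = 0) → x = 0)

omit [Finite G] [NeZero q] in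
include hnd in
theorem eq_of_pairing_eq {x y : G} (h : ∀ z, β x z = β y z) : x = y :=
  sub_eq_zero.1 (hnd _ fun z => by rw [map_sub, AddMonoidHom.sub_apply, h, sub_self])

include hsymm hnd in
-- Nondegeneracy says that G itself has trivial radical, so each functional x ↦ β(y, f x) is
-- represented by an element of G; uniqueness makes the choice additive in y.
theorem exists_adjoint (f : Module.End ℤ G) :
    ∃ g : Module.End ℤ G, ∀ x y, β (f x) y = β x (g y) := by
  have htop : (⊤ : AddSubgroup G).IsAnisotropicFor β := fun d _ h => hnd d fun y => h y trivial
  have : ∀ y, ∃ y', ∀ x, β y' x = β y (f x) := fun y => by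
    obtain ⟨d, -, hd⟩ := htop.exists_rep ((β y).comp f.toAddMonoidHom)
    exact ⟨d, fun x => hd x trivial⟩
  choose g hg using this
  refine ⟨(AddMonoidHom.mk' g fun a b => ?_).toIntLinearMap, fun x y => ?_⟩
  · refine eq_of_pairing_eq hnd fun z => ?_
    rw [map_add, AddMonoidHom.add_apply, hg, hg, hg, map_add, AddMonoidHom.add_apply]
  · rw [hsymm, ← hg, hsymm]
    rfl

/-- The adjoint of an endomorphism with respect to a nondegenerate symmetric pairing. -/
noncomputable def pairingAdjoint (f : Module.End ℤ G) : Module.End ℤ G :=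
  (exists_adjoint hsymm hnd f).choose

theorem pairing_apply_left (f : Module.End ℤ G) (x y : G) :
    β (f x) y = β x (pairingAdjoint hsymm hnd f y) :=
  (exists_adjoint hsymm hnd f).choose_spec x y

theorem pairingAdjoint_eq {f g : Module.End ℤ G} (h : ∀ x y, β (f x) y = β x (g y)) :
    pairingAdjoint hsymm hnd f = g := by
  refine LinearMap.ext fun y => eq_of_pairing_eq hnd fun x => ?_
  rw [hsymm, ← pairing_apply_left, h, hsymm]

theorem isAntiInvolution_pairingAdjoint : IsAntiInvolution (pairingAdjoint hsymm hnd) where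
  add f g := pairingAdjoint_eq hsymm hnd fun x y => by
    rw [LinearMap.add_apply, LinearMap.add_apply, map_add, map_add, AddMonoidHom.add_apply,
      pairing_apply_left hsymm hnd, pairing_apply_left hsymm hnd]
  mul f g := pairingAdjoint_eq hsymm hnd fun x y => by
    rw [Module.End.mul_apply, Module.End.mul_apply, pairing_apply_left hsymm hnd,
      pairing_apply_left hsymm hnd]
  invol f := pairingAdjoint_eq hsymm hnd fun x y => by
    rw [hsymm, ← pairing_apply_left hsymm hnd, hsymm]

include hsymm in
/-- A subgroup on which the pairing has trivial radical is the range of a self-adjoint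
idempotent. -/
theorem AddSubgroup.IsAnisotropicFor.exists_idempotent {D : AddSubgroup G}
    (hD : D.IsAnisotropicFor β) : ∃ P : Module.End ℤ G, (∀ x y, β (P x) y = β x (P y)) ∧
      IsIdempotentElem P ∧ (LinearMap.range P).toAddSubgroup = D := by
  have : ∀ x, ∃ d ∈ D, ∀ c ∈ D, β d c = β x c := fun x => hD.exists_rep (β x)
  choose P hPD hP using this
  -- P x is the only element of D that pairs with D as x does. Additivity and the fact that P fixes
  -- D both follow from this uniqueness.
  have huniq : ∀ x, ∀ d ∈ D, (∀ c ∈ D, β d c = β x c) → P x = d := fun x d hd h =>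
    sub_eq_zero.1 (hD _ (D.sub_mem (hPD x) hd) fun c hc => by
      rw [map_sub, AddMonoidHom.sub_apply, h c hc, hP x c hc, sub_self])
  have hfix : ∀ d ∈ D, P d = d := fun d hd => huniq d d hd fun _ _ => rfl
  let P' : Module.End ℤ G := (AddMonoidHom.mk' P fun a b =>
    huniq _ _ (D.add_mem (hPD a) (hPD b)) fun c hc => by
      rw [map_add, map_add, AddMonoidHom.add_apply, AddMonoidHom.add_apply, hP a c hc,
        hP b c hc]).toIntLinearMap
  refine ⟨P', fun x y => ?_, LinearMap.ext fun x => hfix _ (hPD x), le_antisymm ?_ ?_⟩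
  · show β (P x) y = β x (P y)
    rw [hsymm, ← hP y _ (hPD x), hsymm, hP x _ (hPD y)]
  · rintro _ ⟨x, rfl⟩
    exact hPD x
  · intro d hd
    exact ⟨d, hfix d hd⟩

/-- Subgroups on which the pairing has trivial radical correspond to self-adjoint idempotents. -/
theorem card_anisotropic_eq_card_idempotent :
    Nat.card {D : AddSubgroup G // D.IsAnisotropicFor β} =
      Nat.card {P : Module.End ℤ G // pairingAdjoint hsymm hnd P = P ∧ IsIdempotentElem P} := by
  have hσ := isAntiInvolution_pairingAdjoint hsymm hnd
  have hidem : ∀ P : Module.End ℤ G, IsIdempotentElem P → ∀ x, P (P x) = P x :=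
    fun P hP x => DFunLike.congr_fun hP x
  have hran : ∀ P : {P : Module.End ℤ G // pairingAdjoint hsymm hnd P = P ∧ IsIdempotentElem P},
      (LinearMap.range P.1).toAddSubgroup.IsAnisotropicFor β := by
    rintro ⟨P, hP, hPP⟩ _ ⟨x, rfl⟩ h
    refine hnd _ fun y => ?_
    have := h (P y) ⟨y, rfl⟩
    rw [pairing_apply_left hsymm hnd, hP] at this ⊢
    rwa [hidem P hPP] at this
  refine (Nat.card_congr (Equiv.ofBijective
    (fun P => ⟨(LinearMap.range P.1).toAddSubgroup, hran P⟩) ⟨?_, ?_⟩)).symm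
  · rintro ⟨P, hP, hPP⟩ ⟨Q, hQ, hQQ⟩ h
    have hr : LinearMap.range P = LinearMap.range Q :=
      Submodule.toAddSubgroup_injective (congrArg Subtype.val h)
    have h1 : Q * P = P := LinearMap.ext fun x => by
      obtain ⟨y, hy⟩ : P x ∈ LinearMap.range Q := hr ▸ ⟨x, rfl⟩
      rw [Module.End.mul_apply, ← hy, hidem Q hQQ]
    have h2 : P * Q = Q := LinearMap.ext fun x => by
      obtain ⟨y, hy⟩ : Q x ∈ LinearMap.range P := hr ▸ ⟨x, rfl⟩
      rw [Module.End.mul_apply, ← hy, hidem P hPP]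
    -- Equal ranges give Q P = P and P Q = Q. Taking the adjoint of the first turns it into P Q = P,
    -- hence P = Q.
    have h3 := hσ.mul Q P
    rw [h1, hP, hQ, h2] at h3
    exact Subtype.ext h3
  · rintro ⟨D, hD⟩
    obtain ⟨P, h1, h2, h3⟩ := hD.exists_idempotent hsymm
    exact ⟨⟨P, pairingAdjoint_eq hsymm hnd h1, h2⟩, Subtype.ext h3⟩

end Pairing


/-! ### The group `(ℤ/p^(c+1))^ι ⊕ (ℤ/p^c)^κ` and its endomorphism ring -/

section MixedGroup

set_option linter.unusedSectionVars false

/-- The group `(ℤ/p^(c+1))^ι ⊕ (ℤ/p^c)^κ`. -/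
abbrev MixedGroup (p c : ℕ) (ι κ : Type*) : Type _ :=
  (ι → ZMod (p ^ (c + 1))) × (κ → ZMod (p ^ c))

/-- Multiplication by `p`, as an injection `ℤ/p^c → ℤ/p^(c+1)`. -/
def mulPrime (p c : ℕ) : ZMod (p ^ c) →+ ZMod (p ^ (c + 1)) :=
  ZMod.lift (p ^ c) ⟨zmultiplesHom _ (p : ZMod (p ^ (c + 1))), by
    have : ((p ^ c * p : ℕ) : ZMod (p ^ (c + 1))) = 0 := by
      rw [← pow_succ, ZMod.natCast_self]
    simpa using this⟩

theorem mulPrime_natCast (p c n : ℕ) : mulPrime p c n = p * n := by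
  have := ZMod.lift_coe (p ^ c) (A := ZMod (p ^ (c + 1)))
    ⟨zmultiplesHom _ (p : ZMod (p ^ (c + 1))), by
      have : ((p ^ c * p : ℕ) : ZMod (p ^ (c + 1))) = 0 := by
        rw [← pow_succ, ZMod.natCast_self]
      simpa using this⟩ (n : ℤ)
  refine (congrArg (mulPrime p c) (Int.cast_natCast n).symm).trans (this.trans ?_)
  simp [mul_comm]

variable {p : ℕ} [Fact p.Prime] {c : ℕ}

instance neZero_prime_pow (n : ℕ) : NeZero (p ^ n) :=
  ⟨pow_ne_zero _ (Fact.out : p.Prime).ne_zero⟩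

theorem mulPrime_eq (b : ZMod (p ^ c)) : mulPrime p c b = p * (b.val : ZMod (p ^ (c + 1))) := by
  rw [← mulPrime_natCast, ZMod.natCast_zmod_val]

theorem mulPrime_injective : Function.Injective (mulPrime p c) := by
  refine (injective_iff_map_eq_zero _).2 fun b hb => ?_
  rw [mulPrime_eq, ← Nat.cast_mul, ZMod.natCast_eq_zero_iff, pow_succ',
    Nat.mul_dvd_mul_iff_left (Fact.out : p.Prime).pos] at hb
  rw [← ZMod.natCast_zmod_val b, ZMod.natCast_eq_zero_iff]
  exact hb

/-- Reduction modulo `p`. -/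
def redPrime (p : ℕ) {n : ℕ} (hn : n ≠ 0) : ZMod (p ^ n) →+* ZMod p :=
  ZMod.castHom (dvd_pow_self p hn) (ZMod p)

theorem redPrime_val {n : ℕ} (hn : n ≠ 0) (z : ZMod p) :
    redPrime p hn (z.val : ZMod (p ^ n)) = z := by
  rw [map_natCast, ZMod.natCast_zmod_val]

theorem exists_eq_nsmul_of_redPrime_eq_zero {n : ℕ} (hn : n ≠ 0) {x : ZMod (p ^ n)}
    (hx : redPrime p hn x = 0) : ∃ y, x = p • y := by
  rw [← ZMod.natCast_zmod_val x, map_natCast, ZMod.natCast_eq_zero_iff] at hx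
  obtain ⟨y, hy⟩ := hx
  exact ⟨y, by rw [← ZMod.natCast_zmod_val x, hy]; simp⟩

/-- In ℤ/p^(c+1) the multiples of p are exactly the elements killed by p^c. The second block is
killed by p^c, so no homomorphic image of it is visible in the first block modulo p. -/
theorem redPrime_eq_zero_iff {x : ZMod (p ^ (c + 1))} :
    redPrime p (Nat.succ_ne_zero c) x = 0 ↔ p ^ c • x = 0 := by
  constructor
  · intro h
    obtain ⟨y, rfl⟩ := exists_eq_nsmul_of_redPrime_eq_zero _ h
    rw [← mul_smul, ← pow_succ, nsmul_eq_mul, ZMod.natCast_self, zero_mul]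
  · intro h
    rw [← ZMod.natCast_zmod_val x, nsmul_eq_mul, ← Nat.cast_mul, ZMod.natCast_eq_zero_iff] at h
    replace h := Nat.dvd_of_mul_dvd_mul_left (pow_pos (Fact.out : p.Prime).pos c)
      ((pow_succ p c).symm.dvd.trans h)
    rw [← ZMod.natCast_zmod_val x, map_natCast, ZMod.natCast_eq_zero_iff]
    exact h

variable {ι κ : Type*} [Fintype ι] [Fintype κ] [DecidableEq ι] [DecidableEq κ]

/-- The pairing `x₁ ⬝ y₁ + p (x₂ ⬝ y₂)`. -/
def mixedPairing (p c : ℕ) (ι κ : Type*) [Fintype ι] [Fintype κ] :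
    MixedGroup p c ι κ →+ MixedGroup p c ι κ →+ ZMod (p ^ (c + 1)) :=
  AddMonoidHom.mk' (fun x => AddMonoidHom.mk'
    (fun y => x.1 ⬝ᵥ y.1 + mulPrime p c (x.2 ⬝ᵥ y.2))
    fun y z => by simp only [Prod.fst_add, Prod.snd_add, dotProduct_add, map_add]; abel)
    fun x y => by
      ext z : 1
      simp only [AddMonoidHom.mk'_apply, AddMonoidHom.add_apply, Prod.fst_add, Prod.snd_add,
        add_dotProduct, map_add]
      abel

omit [Fact p.Prime] [DecidableEq ι] [DecidableEq κ] in
theorem mixedPairing_apply (x y : MixedGroup p c ι κ) :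
    mixedPairing p c ι κ x y = x.1 ⬝ᵥ y.1 + mulPrime p c (x.2 ⬝ᵥ y.2) := rfl

omit [Fact p.Prime] [DecidableEq ι] [DecidableEq κ] in
theorem mixedPairing_symm (x y : MixedGroup p c ι κ) :
    mixedPairing p c ι κ x y = mixedPairing p c ι κ y x := by
  rw [mixedPairing_apply, mixedPairing_apply, dotProduct_comm, dotProduct_comm x.2]

/-- The basis vectors of the first block. -/
def unitLeft (p c : ℕ) (κ : Type*) {ι : Type*} [DecidableEq ι] (i : ι) : MixedGroup p c ι κ :=
  (Pi.single i 1, 0)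

/-- The basis vectors of the second block. -/
def unitRight (p c : ℕ) (ι : Type*) {κ : Type*} [DecidableEq κ] (k : κ) : MixedGroup p c ι κ :=
  (0, Pi.single k 1)

omit [Fact p.Prime] in
theorem mixedPairing_unitLeft (x : MixedGroup p c ι κ) (i : ι) :
    mixedPairing p c ι κ x (unitLeft p c κ i) = x.1 i := by
  rw [mixedPairing_apply, unitLeft, dotProduct_single_one, dotProduct_zero, map_zero, add_zero]

omit [Fact p.Prime] in
theorem mixedPairing_unitRight (x : MixedGroup p c ι κ) (k : κ) :
    mixedPairing p c ι κ x (unitRight p c ι k) = mulPrime p c (x.2 k) := by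
  rw [mixedPairing_apply, unitRight, dotProduct_single_one, dotProduct_zero, zero_add]

theorem mixedPairing_nondegenerate (x : MixedGroup p c ι κ)
    (h : ∀ y, mixedPairing p c ι κ x y = 0) : x = 0 := by
  refine Prod.ext (funext fun i => ?_) (funext fun k => ?_)
  · rw [← mixedPairing_unitLeft, h]; rfl
  · refine mulPrime_injective ?_
    rw [← mixedPairing_unitRight, h]
    exact (map_zero _).symm

omit [Fact p.Prime] in
theorem mixedGroup_hom_ext {M : Type*} [AddCommGroup M] {φ ψ : MixedGroup p c ι κ →+ M}
    (h1 : ∀ i, φ (unitLeft p c κ i) = ψ (unitLeft p c κ i))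
    (h2 : ∀ k, φ (unitRight p c ι k) = ψ (unitRight p c ι k)) : φ = ψ := by
  have zext : ∀ {n : ℕ} {φ ψ : ZMod n →+ M}, φ 1 = ψ 1 → φ = ψ := fun {n φ ψ} h => by
    refine AddMonoidHom.ext fun z => ?_
    obtain ⟨z, rfl⟩ := ZMod.intCast_surjective z
    rw [← zsmul_one, map_zsmul, map_zsmul, h]
  have e1 : φ.comp (AddMonoidHom.inl _ _) = ψ.comp (AddMonoidHom.inl _ _) :=
    AddMonoidHom.functions_ext' _ _ _ fun i => zext (h1 i)
  have e2 : φ.comp (AddMonoidHom.inr _ _) = ψ.comp (AddMonoidHom.inr _ _) :=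
    AddMonoidHom.functions_ext' _ _ _ fun i => zext (h2 i)
  refine AddMonoidHom.ext fun x => ?_
  have : x = (x.1, 0) + (0, x.2) := by simp
  rw [this, map_add, map_add]
  exact congrArg₂ (· + ·) (DFunLike.congr_fun e1 x.1) (DFunLike.congr_fun e2 x.2)

/-- Reduction modulo `p` of the first block. -/
def redLeft (p c : ℕ) (ι κ : Type*) : MixedGroup p c ι κ →+ (ι → ZMod p) :=
  AddMonoidHom.mk' (fun x i => redPrime p (Nat.succ_ne_zero c) (x.1 i)) fun x y => by
    ext i; simp

/-- Reduction modulo `p` of the second block. -/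
def redRight (p : ℕ) {c : ℕ} (hc : c ≠ 0) (ι κ : Type*) : MixedGroup p c ι κ →+ (κ → ZMod p) :=
  AddMonoidHom.mk' (fun x k => redPrime p hc (x.2 k)) fun x y => by
    ext i; simp

theorem redLeft_eq_zero_of_nsmul {x : MixedGroup p c ι κ} (hx : p ^ c • x = 0) :
    redLeft p c ι κ x = 0 :=
  funext fun i => redPrime_eq_zero_iff.2 (congrFun (congrArg Prod.fst hx) i)

theorem nsmul_unitRight (k : κ) : p ^ c • unitRight p c ι k = 0 := by
  refine Prod.ext ?_ (funext fun k' => ?_)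
  · simp [unitRight]
  · show p ^ c • (Pi.single k (1 : ZMod (p ^ c)) : κ → ZMod (p ^ c)) k' = 0
    rw [nsmul_eq_mul, ZMod.natCast_self, zero_mul]

theorem nsmul_prime_eq_zero {α : Type*} (v : α → ZMod p) : p • v = 0 := by
  ext i; simp

variable (hc : c ≠ 0)

theorem exists_eq_nsmul {x : MixedGroup p c ι κ} (h1 : redLeft p c ι κ x = 0)
    (h2 : redRight p hc ι κ x = 0) : ∃ y, x = p • y := by
  choose a ha using fun i => exists_eq_nsmul_of_redPrime_eq_zero
    (Nat.succ_ne_zero c) (congrFun h1 i)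
  choose b hb using fun k => exists_eq_nsmul_of_redPrime_eq_zero hc (congrFun h2 k)
  exact ⟨(a, b), Prod.ext (funext ha) (funext hb)⟩

/-- The residue matrix of the first block of an endomorphism. -/
def residueLeft (f : Module.End ℤ (MixedGroup p c ι κ)) : Matrix ι ι (ZMod p) :=
  Matrix.of fun i j => redLeft p c ι κ (f (unitLeft p c κ j)) i

/-- The residue matrix of the second block of an endomorphism. -/
def residueRight (f : Module.End ℤ (MixedGroup p c ι κ)) : Matrix κ κ (ZMod p) :=
  Matrix.of fun i j => redRight p hc ι κ (f (unitRight p c ι j)) i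

theorem redLeft_unitLeft (i : ι) : redLeft p c ι κ (unitLeft p c κ i) = Pi.single i 1 := by
  ext j
  simp only [redLeft, unitLeft, AddMonoidHom.mk'_apply, Pi.single_apply]
  split_ifs <;> simp

theorem redRight_unitRight (i : κ) : redRight p hc ι κ (unitRight p c ι i) = Pi.single i 1 := by
  ext j
  simp only [redRight, unitRight, AddMonoidHom.mk'_apply, Pi.single_apply]
  split_ifs <;> simp

theorem redLeft_unitRight (k : κ) : redLeft p c ι κ (unitRight p c ι k) = 0 :=
  redLeft_eq_zero_of_nsmul (nsmul_unitRight k)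

/-- Homomorphisms preserve p^c-torsion, so the second block contributes nothing to the first one
modulo p. Modulo p the endomorphism is therefore block triangular, and its diagonal blocks multiply.
-/
theorem redLeft_apply (f : Module.End ℤ (MixedGroup p c ι κ)) (x : MixedGroup p c ι κ) :
    redLeft p c ι κ (f x) = (residueLeft f).mulVec (redLeft p c ι κ x) := by
  refine DFunLike.congr_fun (f := (redLeft p c ι κ).comp f.toAddMonoidHom)
    (g := (residueLeft f).mulVecLin.toAddMonoidHom.comp (redLeft p c ι κ))
    (mixedGroup_hom_ext (fun i => ?_) fun k => ?_) x
  · show redLeft p c ι κ (f _) = (residueLeft f).mulVec (redLeft p c ι κ _)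
    rw [redLeft_unitLeft, Matrix.mulVec_single_one]
    rfl
  · show redLeft p c ι κ (f _) = (residueLeft f).mulVec (redLeft p c ι κ _)
    rw [redLeft_unitRight, Matrix.mulVec_zero, redLeft_eq_zero_of_nsmul]
    rw [← map_nsmul, nsmul_unitRight, map_zero]

/-- If the first block of x is p times something, its image under f is divisible by p and drops out.
Without this hypothesis the first block may contribute to the second modulo p, which is the
off-diagonal part of the triangular residue. -/
theorem redRight_apply (f : Module.End ℤ (MixedGroup p c ι κ)) {x : MixedGroup p c ι κ}
    (hx : redLeft p c ι κ x = 0) :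
    redRight p hc ι κ (f x) = (residueRight hc f).mulVec (redRight p hc ι κ x) := by
  choose a ha using fun i => exists_eq_nsmul_of_redPrime_eq_zero
    (Nat.succ_ne_zero c) (congrFun hx i)
  have h1 : x = p • ((a, 0) : MixedGroup p c ι κ) + (0, x.2) := by
    refine Prod.ext ?_ ?_
    · simp only [Prod.fst_add, Prod.smul_fst, add_zero]
      exact funext ha
    · simp
  let τ : MixedGroup p c ι κ →+ MixedGroup p c ι κ :=
    (AddMonoidHom.inr (ι → ZMod (p ^ (c + 1))) (κ → ZMod (p ^ c))).comp (AddMonoidHom.snd _ _)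
  have h2 : redRight p hc ι κ (f (τ x)) = (residueRight hc f).mulVec (redRight p hc ι κ x) := by
    refine DFunLike.congr_fun (f := ((redRight p hc ι κ).comp f.toAddMonoidHom).comp τ)
      (g := (residueRight hc f).mulVecLin.toAddMonoidHom.comp (redRight p hc ι κ))
      (mixedGroup_hom_ext (fun i => ?_) fun k => ?_) x
    · show redRight p hc ι κ (f (0, 0)) = (residueRight hc f).mulVec (redRight p hc ι κ _)
      have : redRight p hc ι κ (unitLeft p c κ i) = 0 := by
        ext; simp [redRight, unitLeft]
      rw [this, Matrix.mulVec_zero, Prod.mk_zero_zero, map_zero, map_zero]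
    · show redRight p hc ι κ (f (unitRight p c ι k))
        = (residueRight hc f).mulVec (redRight p hc ι κ _)
      rw [redRight_unitRight, Matrix.mulVec_single_one]
      rfl
  rw [← h2]
  conv_lhs => rw [h1]
  rw [map_add, map_add, map_nsmul, map_nsmul, nsmul_prime_eq_zero, zero_add]
  rfl

/-- The residue homomorphism of the endomorphism ring. -/
def residueHom : Module.End ℤ (MixedGroup p c ι κ) →+* Matrix ι ι (ZMod p) × Matrix κ κ (ZMod p) where
  toFun f := (residueLeft f, residueRight hc f)
  map_one' := by
    refine Prod.ext (Matrix.ext_col fun i => ?_) (Matrix.ext_col fun k => ?_)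
    · show redLeft p c ι κ (unitLeft p c κ i) = _
      rw [redLeft_unitLeft]
      ext j; simp [Matrix.one_apply, Pi.single_apply]
    · show redRight p hc ι κ (unitRight p c ι k) = _
      rw [redRight_unitRight]
      ext j; simp [Matrix.one_apply, Pi.single_apply]
  map_mul' f g := by
    refine Prod.ext (Matrix.ext_col fun i => ?_) (Matrix.ext_col fun k => ?_)
    · show redLeft p c ι κ (f (g (unitLeft p c κ i))) = _
      rw [redLeft_apply]
      rfl
    · show redRight p hc ι κ (f (g (unitRight p c ι k))) = _
      rw [redRight_apply hc]
      · rfl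
      -- This is where triangularity is used: g carries second-block generators to elements whose
      -- first block is zero modulo p.
      · rw [redLeft_apply, redLeft_unitRight, Matrix.mulVec_zero]
  map_zero' := by
    refine Prod.ext (Matrix.ext_col fun i => ?_) (Matrix.ext_col fun k => ?_)
    · exact map_zero (redLeft p c ι κ)
    · exact map_zero (redRight p hc ι κ)
  map_add' f g := by
    refine Prod.ext (Matrix.ext_col fun i => ?_) (Matrix.ext_col fun k => ?_)
    · exact map_add (redLeft p c ι κ) _ _
    · exact map_add (redRight p hc ι κ) _ _

theorem residueHom_eq_zero_iff (f : Module.End ℤ (MixedGroup p c ι κ)) :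
    residueHom hc f = 0 ↔ (∀ i, redLeft p c ι κ (f (unitLeft p c κ i)) = 0) ∧
      ∀ k, redRight p hc ι κ (f (unitRight p c ι k)) = 0 := by
  constructor
  · intro h
    exact ⟨fun i => funext fun j => congrFun (congrFun (congrArg Prod.fst h) j) i,
      fun i => funext fun j => congrFun (congrFun (congrArg Prod.snd h) j) i⟩
  · intro h
    exact Prod.ext (Matrix.ext_col fun i => h.1 i) (Matrix.ext_col fun i => h.2 i)

/-- One application of f makes the first block divisible by p, and a second application then makes
both blocks divisible by p. So f² maps G into pG, and the power 2(c + 1) maps G into p^(c+1)G = 0.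
-/
theorem isNilpotent_of_residueHom_eq_zero (f : Module.End ℤ (MixedGroup p c ι κ))
    (hf : residueHom hc f = 0) : IsNilpotent f := by
  have h1 : residueLeft f = 0 := congrArg Prod.fst hf
  have h2 : residueRight hc f = 0 := congrArg Prod.snd hf
  have h3 : ∀ x, redLeft p c ι κ (f x) = 0 := fun x => by
    rw [redLeft_apply, h1, Matrix.zero_mulVec]
  have h4 : ∀ x, ∃ y, f (f x) = p • y := fun x => exists_eq_nsmul hc (h3 _) (by
    rw [redRight_apply hc f (h3 x), h2, Matrix.zero_mulVec])
  have h5 : ∀ n x, ∃ y, ((f ^ 2) ^ n) x = p ^ n • y := by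
    intro n
    induction n with
    | zero => exact fun x => ⟨x, by simp⟩
    | succ n ih =>
      intro x
      obtain ⟨y, hy⟩ := ih x
      obtain ⟨z, hz⟩ := h4 y
      refine ⟨z, ?_⟩
      rw [pow_succ' (f ^ 2), Module.End.mul_apply, hy, map_nsmul, sq, Module.End.mul_apply, hz,
        smul_smul, pow_succ p n]
  refine ⟨2 * (c + 1), LinearMap.ext fun x => ?_⟩
  obtain ⟨y, hy⟩ := h5 (c + 1) x
  rw [pow_mul, hy]
  refine Prod.ext (funext fun i => ?_) (funext fun k => ?_)
  · show p ^ (c + 1) • y.1 i = 0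
    rw [nsmul_eq_mul, ZMod.natCast_self, zero_mul]
  · show p ^ (c + 1) • y.2 k = 0
    rw [nsmul_eq_mul, (ZMod.natCast_eq_zero_iff _ _).2 (pow_dvd_pow p (Nat.le_succ c)), zero_mul]

/-- The block diagonal endomorphism lifting a pair of residue matrices. -/
def liftBlocks (p c : ℕ) {ι κ : Type*} [Fintype ι] [Fintype κ] (a : Matrix ι ι (ZMod p))
    (d : Matrix κ κ (ZMod p)) : Module.End ℤ (MixedGroup p c ι κ) :=
  LinearMap.prodMap
    ((a.map fun z => (z.val : ZMod (p ^ (c + 1)))).mulVecLin.restrictScalars ℤ)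
    ((d.map fun z => (z.val : ZMod (p ^ c))).mulVecLin.restrictScalars ℤ)

omit [Fact p.Prime] [DecidableEq ι] [DecidableEq κ] in
theorem liftBlocks_apply (a : Matrix ι ι (ZMod p)) (d : Matrix κ κ (ZMod p))
    (x : MixedGroup p c ι κ) : liftBlocks p c a d x =
      ((a.map fun z => (z.val : ZMod (p ^ (c + 1)))).mulVec x.1,
        (d.map fun z => (z.val : ZMod (p ^ c))).mulVec x.2) := rfl

theorem residueHom_liftBlocks (a : Matrix ι ι (ZMod p)) (d : Matrix κ κ (ZMod p)) :
    residueHom hc (liftBlocks p c a d) = (a, d) := by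
  refine Prod.ext (Matrix.ext fun i j => ?_) (Matrix.ext fun i j => ?_)
  · show redPrime p (Nat.succ_ne_zero c) ((liftBlocks p c a d (unitLeft p c κ j)).1 i) = a i j
    rw [liftBlocks_apply, unitLeft, Matrix.mulVec_single_one]
    exact redPrime_val _ _
  · show redPrime p hc ((liftBlocks p c a d (unitRight p c ι j)).2 i) = d i j
    rw [liftBlocks_apply, unitRight, Matrix.mulVec_single_one]
    exact redPrime_val _ _

theorem residueHom_surjective : Function.Surjective
    (residueHom hc : Module.End ℤ (MixedGroup p c ι κ) →+* _) :=
  fun s => ⟨liftBlocks p c s.1 s.2, residueHom_liftBlocks hc _ _⟩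

/-- The adjoint with respect to `mixedPairing`. -/
noncomputable abbrev mixedAdjoint (f : Module.End ℤ (MixedGroup p c ι κ)) : Module.End ℤ (MixedGroup p c ι κ) :=
  pairingAdjoint mixedPairing_symm mixedPairing_nondegenerate f

/-- The pairing is an orthogonal sum of multiples of dot products, so it transposes each block
separately. In particular a symmetric pair of residues has a self-adjoint lift, from which the
idempotent correction starts. -/
theorem mixedAdjoint_liftBlocks (a : Matrix ι ι (ZMod p)) (d : Matrix κ κ (ZMod p)) :
    mixedAdjoint (liftBlocks p c a d) = liftBlocks p c a.transpose d.transpose := by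
  refine pairingAdjoint_eq _ _ fun x y => ?_
  simp only [mixedPairing_apply, liftBlocks_apply, Matrix.transpose_map, Matrix.dotProduct_mulVec,
    Matrix.vecMul_transpose]

/-- Pairing with a unit vector of the first block reads off a coordinate, so moving f across the
pairing interchanges row and column. In the second block the pairing returns p times the coordinate,
and injectivity of `mulPrime` removes the factor. -/
theorem residueLeft_mixedAdjoint (f : Module.End ℤ (MixedGroup p c ι κ)) :
    residueLeft (mixedAdjoint f) = (residueLeft f).transpose := by
  ext i j
  show redPrime p (Nat.succ_ne_zero c) ((mixedAdjoint f (unitLeft p c κ j)).1 i)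
    = redPrime p (Nat.succ_ne_zero c) ((f (unitLeft p c κ i)).1 j)
  rw [← mixedPairing_unitLeft, ← mixedPairing_unitLeft, mixedPairing_symm,
    pairing_apply_left mixedPairing_symm mixedPairing_nondegenerate]

theorem residueRight_mixedAdjoint (f : Module.End ℤ (MixedGroup p c ι κ)) :
    residueRight hc (mixedAdjoint f) = (residueRight hc f).transpose := by
  ext i j
  show redPrime p hc ((mixedAdjoint f (unitRight p c ι j)).2 i)
    = redPrime p hc ((f (unitRight p c ι i)).2 j)
  congr 1
  refine mulPrime_injective ?_
  rw [← mixedPairing_unitRight, ← mixedPairing_unitRight, mixedPairing_symm,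
    pairing_apply_left mixedPairing_symm mixedPairing_nondegenerate]

theorem residueHom_mixedAdjoint (f : Module.End ℤ (MixedGroup p c ι κ)) :
    residueHom hc (mixedAdjoint f)
      = ((residueHom hc f).1.transpose, (residueHom hc f).2.transpose) :=
  Prod.ext (residueLeft_mixedAdjoint f) (residueRight_mixedAdjoint hc f)

end MixedGroup


/-! ### Counting the corner of a coordinate idempotent -/

section Corner

set_option linter.unusedSectionVars false

variable {p : ℕ} [Fact p.Prime] {c : ℕ} (hc : c ≠ 0)
variable {ι κ : Type*} [Fintype ι] [Fintype κ] [DecidableEq ι] [DecidableEq κ]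

/-- Multiplication by p identifies ℤ/p^(c-1) with the multiples of p in ℤ/p^c. -/
theorem card_redPrime_eq_zero (hc : c ≠ 0) :
    Nat.card {x : ZMod (p ^ c) // redPrime p hc x = 0} = p ^ (c - 1) := by
  obtain ⟨d, rfl⟩ := Nat.exists_eq_succ_of_ne_zero hc
  have hz : ∀ b, redPrime p hc (mulPrime p d b) = 0 := fun b => by
    rw [mulPrime_eq, map_mul, map_natCast, ZMod.natCast_self, zero_mul]
  rw [Nat.succ_sub_one, ← Nat.card_zmod (p ^ d)]
  refine (Nat.card_congr (Equiv.ofBijective (fun b => ⟨mulPrime p d b, hz b⟩)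
    ⟨fun a b h => mulPrime_injective (congrArg Subtype.val h), ?_⟩)).symm
  rintro ⟨x, hx⟩
  obtain ⟨y, hy⟩ := exists_eq_nsmul_of_redPrime_eq_zero _ hx
  refine ⟨(y.val : ZMod (p ^ d)), Subtype.ext ?_⟩
  show mulPrime p d _ = x
  rw [mulPrime_natCast, hy, nsmul_eq_mul, ZMod.natCast_zmod_val]

/-- The idempotent keeping the coordinates in `I` and `K`. -/
def coordProj (p c : ℕ) (I : Finset ι) (K : Finset κ) : Module.End ℤ (MixedGroup p c ι κ) :=
  (AddMonoidHom.mk' (fun x => (fun i => if i ∈ I then x.1 i else 0,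
    fun k => if k ∈ K then x.2 k else 0)) fun x y => by
      ext i <;> simp only [Prod.fst_add, Prod.snd_add, Pi.add_apply] <;>
        split_ifs <;> simp).toIntLinearMap

theorem coordProj_apply (I : Finset ι) (K : Finset κ) (x : MixedGroup p c ι κ) :
    coordProj p c I K x = (fun i => if i ∈ I then x.1 i else 0,
      fun k => if k ∈ K then x.2 k else 0) := rfl

theorem isIdempotentElem_coordProj (I : Finset ι) (K : Finset κ) :
    IsIdempotentElem (coordProj p c I K) := by
  refine LinearMap.ext fun x => ?_
  show coordProj p c I K (coordProj p c I K x) = _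
  simp only [coordProj_apply]
  refine Prod.ext (funext fun i => ?_) (funext fun k => ?_) <;> simp only <;> split_ifs <;> rfl

theorem coordProj_eq_zero_iff (I : Finset ι) (K : Finset κ) (x : MixedGroup p c ι κ) :
    coordProj p c I K x = 0 ↔ (∀ i ∈ I, x.1 i = 0) ∧ ∀ k ∈ K, x.2 k = 0 := by
  rw [coordProj_apply, Prod.mk_eq_zero]
  refine and_congr ⟨fun h i hi => ?_, fun h => funext fun i => ?_⟩
    ⟨fun h i hi => ?_, fun h => funext fun i => ?_⟩
  · simpa [hi] using congrFun h i
  · simpa using h i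
  · simpa [hi] using congrFun h i
  · simpa using h i

theorem coordProj_unitLeft (I : Finset ι) (K : Finset κ) (i : ι) :
    coordProj p c I K (unitLeft p c κ i) = if i ∈ I then unitLeft p c κ i else 0 := by
  rw [coordProj_apply]
  refine Prod.ext (funext fun j => ?_) (funext fun j => ?_)
  · rcases eq_or_ne j i with rfl | hj
    · split_ifs <;> simp_all [unitLeft]
    · split_ifs <;> simp_all [unitLeft]
  · split_ifs <;> simp_all [unitLeft]

theorem coordProj_unitRight (I : Finset ι) (K : Finset κ) (i : κ) :
    coordProj p c I K (unitRight p c ι i) = if i ∈ K then unitRight p c ι i else 0 := by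
  rw [coordProj_apply]
  refine Prod.ext (funext fun j => ?_) (funext fun j => ?_)
  · split_ifs <;> simp_all [unitRight]
  · rcases eq_or_ne j i with rfl | hj
    · split_ifs <;> simp_all [unitRight]
    · split_ifs <;> simp_all [unitRight]

theorem residueHom_coordProj (I : Finset ι) (K : Finset κ) :
    residueHom hc (coordProj p c I K) =
      (Matrix.diagonal fun i => if i ∈ I then 1 else 0,
        Matrix.diagonal fun k => if k ∈ K then 1 else 0) := by
  refine Prod.ext (Matrix.ext_col fun i => ?_) (Matrix.ext_col fun i => ?_)
  · show redLeft p c ι κ (coordProj p c I K (unitLeft p c κ i)) = _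
    rw [coordProj_unitLeft]
    ext j
    by_cases hi : i ∈ I <;> by_cases hj : j = i
    all_goals simp_all [redLeft_unitLeft]
  · show redRight p hc ι κ (coordProj p c I K (unitRight p c ι i)) = _
    rw [coordProj_unitRight]
    ext j
    by_cases hi : i ∈ K <;> by_cases hj : j = i
    all_goals simp_all [redRight_unitRight]

theorem mixedGroup_end_ext {f g : Module.End ℤ (MixedGroup p c ι κ)}
    (h1 : ∀ i, f (unitLeft p c κ i) = g (unitLeft p c κ i))
    (h2 : ∀ k, f (unitRight p c ι k) = g (unitRight p c ι k)) : f = g := by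
  have := mixedGroup_hom_ext (φ := f.toAddMonoidHom) (ψ := g.toAddMonoidHom) h1 h2
  exact LinearMap.ext fun x => DFunLike.congr_fun this x

theorem mixedGroup_nsmul (x : MixedGroup p c ι κ) : p ^ (c + 1) • x = 0 := by
  refine Prod.ext (funext fun i => ?_) (funext fun k => ?_)
  · show p ^ (c + 1) • x.1 i = 0
    rw [nsmul_eq_mul, ZMod.natCast_self, zero_mul]
  · show p ^ (c + 1) • x.2 k = 0
    rw [nsmul_eq_mul, (ZMod.natCast_eq_zero_iff _ _).2 (pow_dvd_pow p (Nat.le_succ c)), zero_mul]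

theorem nsmul_eq_zero_of_redLeft {x : MixedGroup p c ι κ} (hx : redLeft p c ι κ x = 0) :
    p ^ c • x = 0 := by
  refine Prod.ext (funext fun i => ?_) (funext fun k => ?_)
  · exact redPrime_eq_zero_iff.1 (congrFun hx i)
  · show p ^ c • x.2 k = 0
    rw [nsmul_eq_mul, ZMod.natCast_self, zero_mul]

/-- Generators of the first block have order p^(c+1), which kills the whole group, so their images
are free. Those of the second block have order p^c, which is the only relation to respect. -/
theorem exists_end_of_images (g : ι → MixedGroup p c ι κ) (h : κ → MixedGroup p c ι κ)
    (hh : ∀ k, p ^ c • h k = 0) : ∃ f : Module.End ℤ (MixedGroup p c ι κ),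
      (∀ i, f (unitLeft p c κ i) = g i) ∧ ∀ k, f (unitRight p c ι k) = h k := by
  have ex : ∀ (n : ℕ) (z : MixedGroup p c ι κ), n • z = 0 →
      ∃ φ : ZMod n →+ MixedGroup p c ι κ, φ 1 = z := fun n z hz => by
    refine ⟨ZMod.lift n ⟨zmultiplesHom _ z, by simpa using hz⟩, ?_⟩
    have := ZMod.lift_coe n (A := MixedGroup p c ι κ)
      ⟨zmultiplesHom _ z, by simpa using hz⟩ 1
    rw [Int.cast_one] at this
    rw [this]
    simp
  choose φ hφ using fun i => ex (p ^ (c + 1)) (g i) (mixedGroup_nsmul _)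
  choose ψ hψ using fun k => ex (p ^ c) (h k) (hh k)
  let F : MixedGroup p c ι κ →+ MixedGroup p c ι κ :=
    AddMonoidHom.mk' (fun x => ∑ i, φ i (x.1 i) + ∑ k, ψ k (x.2 k)) fun x y => by
      simp only [Prod.fst_add, Prod.snd_add, Pi.add_apply, map_add, Finset.sum_add_distrib]
      abel
  refine ⟨F.toIntLinearMap, fun i => ?_, fun k => ?_⟩
  · show ∑ j, φ j (Pi.single (M := fun _ => ZMod (p ^ (c + 1))) i 1 j)
      + ∑ k, ψ k ((0 : κ → ZMod (p ^ c)) k) = _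
    rw [Finset.sum_eq_single i, Pi.single_eq_same, hφ]
    · simp
    · intro j _ hj
      rw [Pi.single_eq_of_ne hj, map_zero]
    · simp
  · show ∑ j, φ j ((0 : ι → ZMod (p ^ (c + 1))) j)
      + ∑ j, ψ j (Pi.single (M := fun _ => ZMod (p ^ c)) k 1 j) = _
    rw [Finset.sum_eq_single k (M := MixedGroup p c ι κ) (f := fun j =>
      ψ j (Pi.single (M := fun _ => ZMod (p ^ c)) k 1 j)), Pi.single_eq_same, hψ]
    · simp
    · intro j _ hj
      rw [Pi.single_eq_of_ne hj, map_zero]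
    · simp

theorem prod_ite_mem_eq_pow {α : Type*} [Fintype α] [DecidableEq α] (I : Finset α) (n : ℕ) :
    ∏ i : α, (if i ∈ I then 1 else n) = n ^ (Fintype.card α - I.card) := by
  rw [Finset.prod_ite, Finset.prod_const_one, one_mul, Finset.prod_const]
  congr 1
  rw [← Finset.card_compl]
  congr 1
  ext
  simp

/-- These are the possible images of a first-block generator under a corner element of the residue
kernel: supported off I and K, with first block divisible by p and no divisibility imposed on the
second. Each free coordinate of either block has p^c values. -/
theorem card_imageLeft (I : Finset ι) (K : Finset κ) :
    Nat.card {x : MixedGroup p c ι κ // coordProj p c I K x = 0 ∧ redLeft p c ι κ x = 0} =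
      (p ^ c) ^ (Fintype.card ι - I.card) * (p ^ c) ^ (Fintype.card κ - K.card) := by
  let A : ι → Type := fun i =>
    {a : ZMod (p ^ (c + 1)) // (i ∈ I → a = 0) ∧ redPrime p (Nat.succ_ne_zero c) a = 0}
  let B : κ → Type := fun k => {b : ZMod (p ^ c) // k ∈ K → b = 0}
  have hA : ∀ i, Nat.card (A i) = if i ∈ I then 1 else p ^ c := fun i => by
    split_ifs with hi
    · refine Nat.card_eq_one_iff_unique.2 ⟨⟨fun a b => Subtype.ext ?_⟩, ⟨⟨0, by simp⟩⟩⟩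
      rw [a.2.1 hi, b.2.1 hi]
    · simp only [A, hi, false_imp_iff, true_and]
      exact card_redPrime_eq_zero _
  have hB : ∀ k, Nat.card (B k) = if k ∈ K then 1 else p ^ c := fun k => by
    split_ifs with hi
    · refine Nat.card_eq_one_iff_unique.2 ⟨⟨fun a b => Subtype.ext ?_⟩, ⟨⟨0, by simp⟩⟩⟩
      rw [a.2 hi, b.2 hi]
    · rw [← Nat.card_zmod (p ^ c)]
      exact Nat.card_congr (Equiv.subtypeUnivEquiv fun _ h => absurd h hi)
  have e : {x : MixedGroup p c ι κ // coordProj p c I K x = 0 ∧ redLeft p c ι κ x = 0} ≃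
      (∀ i, A i) × (∀ k, B k) :=
    { toFun := fun x => (fun i => ⟨x.1.1 i,
          fun hi => ((coordProj_eq_zero_iff I K x.1).1 x.2.1).1 i hi, congrFun x.2.2 i⟩,
        fun k => ⟨x.1.2 k, fun hk => ((coordProj_eq_zero_iff I K x.1).1 x.2.1).2 k hk⟩)
      invFun := fun y => ⟨(fun i => (y.1 i).1, fun k => (y.2 k).1),
        (coordProj_eq_zero_iff I K _).2 ⟨fun i hi => (y.1 i).2.1 hi, fun k hk => (y.2 k).2 hk⟩,
        funext fun i => (y.1 i).2.2⟩
      left_inv := fun _ => rfl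
      right_inv := fun _ => rfl }
  rw [Nat.card_congr e, Nat.card_prod, Nat.card_pi, Nat.card_pi, Finset.prod_congr rfl fun i _ =>
    hA i, Finset.prod_congr rfl fun k _ => hB k, prod_ite_mem_eq_pow, prod_ite_mem_eq_pow]

/-- For a second-block generator the image must also have its second block divisible by p, because
the residue vanishes; this lowers the choices there to p^(c-1). Divisibility of the first block is
automatic from torsion. -/
theorem card_imageRight (I : Finset ι) (K : Finset κ) :
    Nat.card {x : MixedGroup p c ι κ // coordProj p c I K x = 0 ∧ redLeft p c ι κ x = 0 ∧
        redRight p hc ι κ x = 0} =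
      (p ^ c) ^ (Fintype.card ι - I.card) * (p ^ (c - 1)) ^ (Fintype.card κ - K.card) := by
  let A : ι → Type := fun i =>
    {a : ZMod (p ^ (c + 1)) // (i ∈ I → a = 0) ∧ redPrime p (Nat.succ_ne_zero c) a = 0}
  let B : κ → Type := fun k => {b : ZMod (p ^ c) // (k ∈ K → b = 0) ∧ redPrime p hc b = 0}
  have hA : ∀ i, Nat.card (A i) = if i ∈ I then 1 else p ^ c := fun i => by
    split_ifs with hi
    · refine Nat.card_eq_one_iff_unique.2 ⟨⟨fun a b => Subtype.ext ?_⟩, ⟨⟨0, by simp⟩⟩⟩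
      rw [a.2.1 hi, b.2.1 hi]
    · simp only [A, hi, false_imp_iff, true_and]
      exact card_redPrime_eq_zero _
  have hB : ∀ k, Nat.card (B k) = if k ∈ K then 1 else p ^ (c - 1) := fun k => by
    split_ifs with hi
    · refine Nat.card_eq_one_iff_unique.2 ⟨⟨fun a b => Subtype.ext ?_⟩, ⟨⟨0, by simp⟩⟩⟩
      rw [a.2.1 hi, b.2.1 hi]
    · simp only [B, hi, false_imp_iff, true_and]
      exact card_redPrime_eq_zero _
  have e : {x : MixedGroup p c ι κ // coordProj p c I K x = 0 ∧ redLeft p c ι κ x = 0 ∧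
        redRight p hc ι κ x = 0} ≃
      (∀ i, A i) × (∀ k, B k) :=
    { toFun := fun x => (fun i => ⟨x.1.1 i,
          fun hi => ((coordProj_eq_zero_iff I K x.1).1 x.2.1).1 i hi, congrFun x.2.2.1 i⟩,
        fun k => ⟨x.1.2 k, fun hk => ((coordProj_eq_zero_iff I K x.1).1 x.2.1).2 k hk,
          congrFun x.2.2.2 k⟩)
      invFun := fun y => ⟨(fun i => (y.1 i).1, fun k => (y.2 k).1),
        (coordProj_eq_zero_iff I K _).2 ⟨fun i hi => (y.1 i).2.1 hi, fun k hk => (y.2 k).2.1 hk⟩,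
        funext fun i => (y.1 i).2.2, funext fun i => (y.2 i).2.2⟩
      left_inv := fun _ => rfl
      right_inv := fun _ => rfl }
  rw [Nat.card_congr e, Nat.card_prod, Nat.card_pi, Nat.card_pi, Finset.prod_congr rfl fun i _ =>
    hA i, Finset.prod_congr rfl fun k _ => hB k, prod_ite_mem_eq_pow, prod_ite_mem_eq_pow]

/-- The number of endomorphisms in the kernel of the residue map sending the coordinates in
`I, K` to the remaining ones. -/
theorem card_corner (I : Finset ι) (K : Finset κ) :
    Nat.card {f : Module.End ℤ (MixedGroup p c ι κ) // residueHom hc f = 0 ∧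
        f * coordProj p c I K = f ∧ coordProj p c I K * f = 0} =
      p ^ ((Fintype.card ι - I.card) * c * (I.card + K.card) +
        (Fintype.card κ - K.card) * (c * I.card + (c - 1) * K.card)) := by
  let X := {x : MixedGroup p c ι κ // coordProj p c I K x = 0 ∧ redLeft p c ι κ x = 0}
  let Y := {x : MixedGroup p c ι κ // coordProj p c I K x = 0 ∧ redLeft p c ι κ x = 0 ∧
        redRight p hc ι κ x = 0}
  have key : Nat.card {f : Module.End ℤ (MixedGroup p c ι κ) // residueHom hc f = 0 ∧
        f * coordProj p c I K = f ∧ coordProj p c I K * f = 0} =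
        Nat.card ((I → X) × (K → Y)) := by
    have hmem : ∀ f : {f : Module.End ℤ (MixedGroup p c ι κ) // residueHom hc f = 0 ∧
        f * coordProj p c I K = f ∧ coordProj p c I K * f = 0},
        (∀ i, coordProj p c I K (f.1 (unitLeft p c κ i)) = 0 ∧
          redLeft p c ι κ (f.1 (unitLeft p c κ i)) = 0) ∧
        (∀ k, coordProj p c I K (f.1 (unitRight p c ι k)) = 0 ∧
          redLeft p c ι κ (f.1 (unitRight p c ι k)) = 0 ∧
          redRight p hc ι κ (f.1 (unitRight p c ι k)) = 0) := fun ⟨f, h1, h2, h3⟩ => by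
      obtain ⟨h4, h5⟩ := (residueHom_eq_zero_iff hc f).1 h1
      refine ⟨fun i => ⟨LinearMap.congr_fun h3 _, h4 i⟩,
        fun k => ⟨LinearMap.congr_fun h3 _, ?_, h5 k⟩⟩
      -- Not part of the vanishing of the residue: it holds for every endomorphism, by torsion.
      rw [redLeft_apply, redLeft_unitRight, Matrix.mulVec_zero]
    refine Nat.card_congr (Equiv.ofBijective (fun f => (fun i => ⟨f.1 (unitLeft p c κ i),
      (hmem f).1 i⟩, fun k => ⟨f.1 (unitRight p c ι k), (hmem f).2 k⟩)) ⟨?_, ?_⟩)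
    · rintro ⟨f, h1, h2, h3⟩ ⟨f', h1', h2', h3'⟩ h
      refine Subtype.ext (mixedGroup_end_ext (fun i => ?_) fun k => ?_)
      · by_cases hi : i ∈ I
        · exact congrArg Subtype.val (congrFun (congrArg Prod.fst h) ⟨i, hi⟩)
        · show f _ = f' _
          rw [← h2, ← h2', Module.End.mul_apply, Module.End.mul_apply, coordProj_unitLeft,
            if_neg hi, map_zero, map_zero]
      · by_cases hi : k ∈ K
        · exact congrArg Subtype.val (congrFun (congrArg Prod.snd h) ⟨k, hi⟩)
        · show f _ = f' _
          rw [← h2, ← h2', Module.End.mul_apply, Module.End.mul_apply, coordProj_unitRight,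
            if_neg hi, map_zero, map_zero]
    · rintro ⟨x, y⟩
      obtain ⟨f, hf1, hf2⟩ := exists_end_of_images
        (fun i => if hi : i ∈ I then (x ⟨i, hi⟩).1 else 0)
        (fun k => if hk : k ∈ K then (y ⟨k, hk⟩).1 else 0) (fun k => by
          split_ifs with hk
          · exact nsmul_eq_zero_of_redLeft (y ⟨k, hk⟩).2.2.1
          · exact smul_zero _)
      refine ⟨⟨f, (residueHom_eq_zero_iff hc f).2 ⟨fun i => ?_, fun k => ?_⟩,
        mixedGroup_end_ext (fun i => ?_) (fun k => ?_),
        mixedGroup_end_ext (fun i => ?_) (fun k => ?_)⟩,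
        Prod.ext (funext fun i => Subtype.ext ?_) (funext fun k => Subtype.ext ?_)⟩
      · rw [hf1]
        split_ifs with hi
        · exact (x ⟨i, hi⟩).2.2
        · exact map_zero _
      · rw [hf2]
        split_ifs with hi
        · exact (y ⟨k, hi⟩).2.2.2
        · exact map_zero _
      · rw [Module.End.mul_apply, coordProj_unitLeft]
        split_ifs with hi
        · rfl
        · rw [map_zero, hf1, dif_neg hi]
      · rw [Module.End.mul_apply, coordProj_unitRight]
        split_ifs with hi
        · rfl
        · rw [map_zero, hf2, dif_neg hi]
      · rw [Module.End.mul_apply, hf1]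
        split_ifs with hi
        · exact (x ⟨i, hi⟩).2.1
        · exact map_zero _
      · rw [Module.End.mul_apply, hf2]
        split_ifs with hi
        · exact (y ⟨k, hi⟩).2.1
        · exact map_zero _
      · exact (hf1 i).trans (dif_pos i.2)
      · exact (hf2 k).trans (dif_pos k.2)
  rw [key, Nat.card_prod, Nat.card_fun, Nat.card_fun, card_imageLeft, card_imageRight hc,
    Nat.card_eq_fintype_card, Nat.card_eq_fintype_card, Fintype.card_coe, Fintype.card_coe]
  simp only [← pow_mul, ← pow_add]
  congr 1
  ring

end Corner


/-! ### Summing over symmetric idempotent residues -/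

section ResidueSum

set_option linter.unusedSectionVars false

/-- The space is the direct sum of the range and the kernel of M. A basis adapted to this splitting,
reindexed by α, has as its matrix the conjugating unit, and I marks the indices of the vectors taken
from the range. -/
theorem Matrix.exists_conj_diagonal_of_isIdempotentElem {F α : Type*} [Field F] [Fintype α]
    [DecidableEq α] {M : Matrix α α F} (hM : IsIdempotentElem M) :
    ∃ I : Finset α, I.card = M.rank ∧ ∃ u : (Matrix α α F)ˣ,
      M * (u : Matrix α α F) =
        (u : Matrix α α F) * Matrix.diagonal (fun i => if i ∈ I then 1 else 0) := by
  have hf : IsIdempotentElem M.mulVecLin := by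
    show M.mulVecLin * M.mulVecLin = _
    rw [Module.End.mul_eq_comp, ← Matrix.mulVecLin_mul, hM]
  have hcompl : IsCompl (LinearMap.range M.mulVecLin) (LinearMap.ker M.mulVecLin) :=
    (LinearMap.IsIdempotentElem.isCompl hf)
  let b0 := ((Module.finBasis F (LinearMap.range M.mulVecLin)).prod
    (Module.finBasis F (LinearMap.ker M.mulVecLin))).map (Submodule.prodEquivOfIsCompl _ _ hcompl)
  let e := b0.indexEquiv (Pi.basisFun F α)
  let b := b0.reindex e
  let I : Finset α := Finset.univ.map (Function.Embedding.inl.trans e.toEmbedding)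
  have hI : I.card = M.rank := by
    rw [Finset.card_map, Finset.card_univ, Fintype.card_fin]; rfl
  have hinv := (Pi.basisFun F α).invertibleToMatrix b
  refine ⟨I, hI, unitOfInvertible ((Pi.basisFun F α).toMatrix b), ?_⟩
  refine Matrix.ext_col fun j => ?_
  obtain ⟨j, rfl⟩ := e.surjective j
  have hcol : ∀ j, ((Pi.basisFun F α).toMatrix b).col j = b j := fun j => by
    ext i; simp [Module.Basis.toMatrix_apply, Matrix.col]
  have h1 : (M * (Pi.basisFun F α).toMatrix b).col (e j) = M.mulVec (b (e j)) := by
    rw [← hcol]; rfl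
  have h2 : ((Pi.basisFun F α).toMatrix b * Matrix.diagonal (fun i => if i ∈ I then 1 else 0)).col
      (e j) = (if e j ∈ I then (1 : F) else 0) • b (e j) := by
    rw [← hcol]
    ext i
    simp [Matrix.col, Matrix.mul_diagonal]
  show (M * (Pi.basisFun F α).toMatrix b).col (e j) = ((Pi.basisFun F α).toMatrix b *
    Matrix.diagonal (fun i => if i ∈ I then 1 else 0)).col (e j)
  rw [h1, h2]
  have hb : b (e j) = b0 j := by simp [b]
  rw [hb]
  rcases j with j | j
  · have hmem : e (Sum.inl j) ∈ I := Finset.mem_map.2 ⟨j, Finset.mem_univ _, rfl⟩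
    rw [if_pos hmem, one_smul]
    have : b0 (Sum.inl j) = (Module.finBasis F (LinearMap.range M.mulVecLin) j : α → F) := by
      simp [b0]
    rw [this]
    obtain ⟨y, hy⟩ := (Module.finBasis F (LinearMap.range M.mulVecLin) j).2
    rw [← hy]
    exact LinearMap.congr_fun hf y
  · have hmem : e (Sum.inr j) ∉ I := fun h => by
      obtain ⟨k, -, hk⟩ := Finset.mem_map.1 h
      exact Sum.inl_ne_inr (e.injective hk)
    rw [if_neg hmem, zero_smul]
    have : b0 (Sum.inr j) = (Module.finBasis F (LinearMap.ker M.mulVecLin) j : α → F) := by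
      simp [b0]
    rw [this]
    exact (Module.finBasis F (LinearMap.ker M.mulVecLin) j).2

/-- Symmetric idempotent matrices. -/
abbrev SymmIdempotent (F α : Type*) [Field F] [Fintype α] : Type _ :=
  {M : Matrix α α F // M.transpose = M ∧ IsIdempotentElem M}

noncomputable instance {p : ℕ} [Fact p.Prime] {α : Type*} [Fintype α] :
    Fintype (SymmIdempotent (ZMod p) α) := by
  classical exact Fintype.ofFinite _

variable {p : ℕ} [Fact p.Prime] {c : ℕ} (hc : c ≠ 0)
variable {ι κ : Type*} [Fintype ι] [Fintype κ] [DecidableEq ι] [DecidableEq κ]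

instance : Finite (Module.End ℤ (MixedGroup p c ι κ)) :=
  Finite.of_injective (fun f => (f : MixedGroup p c ι κ → MixedGroup p c ι κ))
    DFunLike.coe_injective

/-- The block diagonal lift is self-adjoint and idempotent modulo the kernel, so it can be corrected
to a base point P of the fibre. The fibre is parametrised by the corner at P, and this corner is
conjugate to that of a coordinate projection of the same residue ranks. -/
theorem card_idempotent_over (M : SymmIdempotent (ZMod p) ι) (L : SymmIdempotent (ZMod p) κ) :
    Nat.card {P : Module.End ℤ (MixedGroup p c ι κ) //
        (mixedAdjoint P = P ∧ IsIdempotentElem P) ∧ residueHom hc P = (M.1, L.1)} =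
      p ^ ((Fintype.card ι - M.1.rank) * c * (M.1.rank + L.1.rank) +
        (Fintype.card κ - L.1.rank) * (c * M.1.rank + (c - 1) * L.1.rank)) := by
  have hσ := isAntiInvolution_pairingAdjoint (mixedPairing_symm (p := p) (c := c) (ι := ι) (κ := κ))
    mixedPairing_nondegenerate
  have hnil := isNilpotent_of_residueHom_eq_zero (p := p) (ι := ι) (κ := κ) hc
  have hML : IsIdempotentElem (M.1, L.1) := Prod.ext M.2.2 L.2.2
  obtain ⟨P, hP, hPP, hPM⟩ := hσ.exists_idempotent_lift hnil (x := liftBlocks p c M.1 L.1)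
    ((mixedAdjoint_liftBlocks _ _).trans (by rw [M.2.1, L.2.1])) (by rw [residueHom_liftBlocks]; exact hML)
  rw [residueHom_liftBlocks] at hPM
  rw [← hPM, hσ.card_idempotent_fiber hnil (fun f hf => by
    rw [residueHom_mixedAdjoint, hf]; rfl) hPP hP]
  obtain ⟨I, hI, u, hu⟩ := Matrix.exists_conj_diagonal_of_isIdempotentElem M.2.2
  obtain ⟨K, hK, v, hv⟩ := Matrix.exists_conj_diagonal_of_isIdempotentElem L.2.2
  rw [IsAntiInvolution.card_corner_eq_of_conj hnil (residueHom_surjective hc) hPP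
    (isIdempotentElem_coordProj I K) (MulEquiv.prodUnits.symm (u, v)) (by
      rw [hPM, residueHom_coordProj]
      exact Prod.ext hu hv), card_corner, hI, hK]

theorem card_anisotropic_eq_sum (hc : c ≠ 0) :
    Nat.card {D : AddSubgroup (MixedGroup p c ι κ) // D.IsAnisotropicFor (mixedPairing p c ι κ)} =
      ∑ s : SymmIdempotent (ZMod p) ι × SymmIdempotent (ZMod p) κ,
        p ^ ((Fintype.card ι - s.1.1.rank) * c * (s.1.1.rank + s.2.1.rank) +
          (Fintype.card κ - s.2.1.rank) * (c * s.1.1.rank + (c - 1) * s.2.1.rank)) := by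
  rw [card_anisotropic_eq_card_idempotent mixedPairing_symm mixedPairing_nondegenerate,
    ← Finset.sum_congr rfl fun s _ => card_idempotent_over hc s.1 s.2, ← Nat.card_sigma]
  have hres : ∀ P : Module.End ℤ (MixedGroup p c ι κ), mixedAdjoint P = P → IsIdempotentElem P →
      ((residueHom hc P).1.transpose = (residueHom hc P).1 ∧
        IsIdempotentElem (residueHom hc P).1) ∧
      ((residueHom hc P).2.transpose = (residueHom hc P).2 ∧
        IsIdempotentElem (residueHom hc P).2) := fun P h1 h2 => by
    have h3 := residueHom_mixedAdjoint hc P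
    rw [h1] at h3
    have h4 : residueHom hc P * residueHom hc P = residueHom hc P := by rw [← map_mul, h2]
    exact ⟨⟨(congrArg Prod.fst h3).symm, congrArg Prod.fst h4⟩,
      ⟨(congrArg Prod.snd h3).symm, congrArg Prod.snd h4⟩⟩
  exact Nat.card_congr
    { toFun := fun P => ⟨(⟨(residueHom hc P.1).1, (hres P.1 P.2.1 P.2.2).1⟩,
        ⟨(residueHom hc P.1).2, (hres P.1 P.2.1 P.2.2).2⟩), ⟨P.1, P.2, rfl⟩⟩
      invFun := fun x => ⟨x.2.1, x.2.2.1⟩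
      left_inv := fun _ => rfl
      right_inv := by
        rintro ⟨⟨⟨M, hM⟩, ⟨L, hL⟩⟩, ⟨P, hP, h⟩⟩
        obtain ⟨h1, h2⟩ := Prod.ext_iff.1 h
        subst h1 h2
        rfl }

theorem isEuclideanLCD_iff {n : ℕ} (D : Submodule (ZMod p) (Fin n → ZMod p)) :
    IsEuclideanLCD D ↔ ∀ d ∈ D, (∀ c ∈ D, d ⬝ᵥ c = 0) → d = 0 := by
  rw [IsEuclideanLCD, Set.eq_singleton_iff_unique_mem]
  constructor
  · rintro ⟨-, h⟩ d hd h'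
    exact h d ⟨hd, h'⟩
  · intro h
    exact ⟨⟨D.zero_mem, fun c _ => by simp⟩, fun d hd => h d hd.1 hd.2⟩

/-- Euclidean LCD codes are the column spaces of symmetric idempotent matrices. -/
theorem numLCD_eq_card_symmIdempotent (n s : ℕ) :
    numLCD p n s = Nat.card {M : SymmIdempotent (ZMod p) (Fin n) // M.1.rank = s} := by
  have hmv : ∀ M : SymmIdempotent (ZMod p) (Fin n), ∀ x, M.1.mulVec (M.1.mulVec x) = M.1.mulVec x :=
    fun M x => by rw [Matrix.mulVec_mulVec, M.2.2]
  have hadj : ∀ M : SymmIdempotent (ZMod p) (Fin n), ∀ x y,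
      M.1.mulVec x ⬝ᵥ y = x ⬝ᵥ M.1.mulVec y := fun M x y => by
    rw [Matrix.dotProduct_mulVec, ← Matrix.mulVec_transpose, M.2.1]
  have hran : ∀ M : {M : SymmIdempotent (ZMod p) (Fin n) // M.1.rank = s},
      Module.finrank (ZMod p) (LinearMap.range M.1.1.mulVecLin) = s ∧
        IsEuclideanLCD (LinearMap.range M.1.1.mulVecLin) := by
    rintro ⟨M, hM⟩
    refine ⟨hM, (isEuclideanLCD_iff _).2 ?_⟩
    rintro _ ⟨x, rfl⟩ h
    refine dotProduct_eq_zero _ fun y => ?_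
    have := h _ ⟨y, rfl⟩
    simp only [Matrix.mulVecLin_apply] at this ⊢
    rwa [← hadj, hmv] at this
  refine (Nat.card_congr (Equiv.ofBijective
    (fun M => ⟨LinearMap.range M.1.1.mulVecLin, hran M⟩) ⟨?_, ?_⟩)).symm
  · rintro ⟨M, hM⟩ ⟨L, hL⟩ h
    have hr : LinearMap.range M.1.mulVecLin = LinearMap.range L.1.mulVecLin :=
      congrArg Subtype.val h
    have h1 : L.1 * M.1 = M.1 := Matrix.toLin'.injective (LinearMap.ext fun x => by
      obtain ⟨y, hy⟩ : M.1.mulVecLin x ∈ LinearMap.range L.1.mulVecLin := hr ▸ ⟨x, rfl⟩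
      simp only [Matrix.mulVecLin_apply, Matrix.toLin'_apply] at hy ⊢
      rw [← Matrix.mulVec_mulVec, ← hy, hmv])
    have h2 : M.1 * L.1 = L.1 := Matrix.toLin'.injective (LinearMap.ext fun x => by
      obtain ⟨y, hy⟩ : L.1.mulVecLin x ∈ LinearMap.range M.1.mulVecLin := hr ▸ ⟨x, rfl⟩
      simp only [Matrix.mulVecLin_apply, Matrix.toLin'_apply] at hy ⊢
      rw [← Matrix.mulVec_mulVec, ← hy, hmv])
    have h3 := Matrix.transpose_mul L.1 M.1
    rw [h1, M.2.1, L.2.1, h2] at h3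
    exact Subtype.ext (Subtype.ext h3)
  · rintro ⟨D, hs, hD⟩
    let β : (Fin n → ZMod p) →+ (Fin n → ZMod p) →+ ZMod p :=
      AddMonoidHom.mk' (fun x => AddMonoidHom.mk' (fun y => x ⬝ᵥ y) (dotProduct_add x))
        fun x y => AddMonoidHom.ext fun z => add_dotProduct x y z
    have hβ : D.toAddSubgroup.IsAnisotropicFor β := (isEuclideanLCD_iff D).1 hD
    obtain ⟨P, h1, h2, h3⟩ := hβ.exists_idempotent (fun x y => dotProduct_comm x y)
    -- The projection comes from the group-theoretic construction and is only additive; over the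
    -- prime field ℤ/p additive maps are linear.
    let P' : (Fin n → ZMod p) →ₗ[ZMod p] (Fin n → ZMod p) :=
      P.toAddMonoidHom.toZModLinearMap p
    have hP' : (LinearMap.toMatrix' P').mulVecLin = P' := Matrix.toLin'_toMatrix' P'
    have hr : LinearMap.range P' = D := by
      refine SetLike.ext fun x => ?_
      rw [← Submodule.mem_toAddSubgroup D, ← h3]
      rfl
    refine ⟨⟨⟨LinearMap.toMatrix' P', ?_, ?_⟩, ?_⟩, Subtype.ext ?_⟩
    · ext i j
      rw [Matrix.transpose_apply, LinearMap.toMatrix'_apply, LinearMap.toMatrix'_apply]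
      have := h1 (Pi.single i 1) (Pi.single j 1)
      change P' (Pi.single i 1) ⬝ᵥ Pi.single j 1 = Pi.single i 1 ⬝ᵥ P' (Pi.single j 1) at this
      rwa [dotProduct_single_one, single_one_dotProduct] at this
    · show _ * _ = _
      rw [← LinearMap.toMatrix'_mul]
      congr 1
      exact LinearMap.ext fun x => LinearMap.congr_fun h2 x
    · rw [Matrix.rank, hP', hr, hs]
    · show LinearMap.range (LinearMap.toMatrix' P').mulVecLin = D
      rw [hP', hr]

theorem sum_symmIdempotent_eq (n : ℕ) (f : ℕ → ℕ) :
    ∑ M : SymmIdempotent (ZMod p) (Fin n), f M.1.rank =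
      ∑ i ∈ Finset.range (n + 1), numLCD p n i * f i := by
  classical
  rw [← Finset.sum_fiberwise_of_maps_to (t := Finset.range (n + 1)) (g := fun M => M.1.rank)
    fun M _ => Finset.mem_range_succ_iff.2 (by simpa using M.1.rank_le_card_width)]
  refine Finset.sum_congr rfl fun i _ => ?_
  rw [Finset.sum_congr rfl fun M hM => congrArg f (Finset.mem_filter.1 hM).2, Finset.sum_const,
    smul_eq_mul, numLCD_eq_card_symmIdempotent, Nat.card_eq_fintype_card, Fintype.card_subtype]

/-- The number of subgroups of `(ℤ/p^(c+1))^m ⊕ (ℤ/p^c)^n` with trivial radical. -/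
theorem card_anisotropic_eq_sum_numLCD (hc : c ≠ 0) (m n : ℕ) :
    Nat.card {D : AddSubgroup (MixedGroup p c (Fin m) (Fin n)) //
        D.IsAnisotropicFor (mixedPairing p c (Fin m) (Fin n))} =
      ∑ i ∈ Finset.range (m + 1), ∑ j ∈ Finset.range (n + 1), numLCD p m i * numLCD p n j *
        p ^ ((m - i) * c * (i + j) + (n - j) * (c * i + (c - 1) * j)) := by
  rw [card_anisotropic_eq_sum hc, Fintype.sum_prod_type]
  simp only [Fintype.card_fin]
  rw [sum_symmIdempotent_eq m fun i => ∑ L : SymmIdempotent (ZMod p) (Fin n),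
    p ^ ((m - i) * c * (i + L.1.rank) + (n - L.1.rank) * (c * i + (c - 1) * L.1.rank))]
  refine Finset.sum_congr rfl fun i _ => ?_
  rw [sum_symmIdempotent_eq n fun j =>
    p ^ ((m - i) * c * (i + j) + (n - j) * (c * i + (c - 1) * j)), Finset.mul_sum]
  exact Finset.sum_congr rfl fun j _ => (mul_assoc _ _ _).symm

end ResidueSum


/-! ### Additive codes over the chain ring in coordinates -/

section ChainRingCoordinates

namespace EisensteinData

variable {p r k t : ℕ} [Fact p.Prime]

/-- The integer representatives of the second block are not additive. The carry is a multiple of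
p^(e-1) and stands in front of y^(t+j), so it lies in the ideal. -/
theorem ofCoords_add {e : ℕ} (E : EisensteinData p e r k t) (v w : MixedCoords p e r k t) :
    E.ofCoords (v + w) = E.ofCoords v + E.ofCoords w := by
  rw [ofCoords, ofCoords, ofCoords, ← map_add]
  refine Ideal.Quotient.eq.2 ?_
  have hl : ∀ i, E.grOfCoords ((v + w).1 i) = E.grOfCoords (v.1 i) + E.grOfCoords (w.1 i) :=
    fun i => by
      have := E.grOfCoords_sub ((v + w).1 i) (w.1 i)
      rw [Prod.fst_add, Pi.add_apply, add_sub_cancel_right] at this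
      rw [Prod.fst_add, Pi.add_apply, this, sub_add_cancel]
  have hr : ∀ j, (p : E.GR) ^ (e - 1) ∣
      (E.grOfCoords fun s => (((v + w).2 j s).val : ZMod (p ^ e))) -
        ((E.grOfCoords fun s => ((v.2 j s).val : ZMod (p ^ e))) +
          E.grOfCoords fun s => ((w.2 j s).val : ZMod (p ^ e))) := fun j => by
    rw [← sub_sub, ← grOfCoords_sub, ← grOfCoords_sub]
    refine E.dvd_grOfCoords _ fun s => dvd_of_castHom_eq_zero _ ?_
    rw [Pi.sub_apply, Pi.sub_apply, map_sub, map_sub, castHom_val, castHom_val, castHom_val,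
      Prod.snd_add, Pi.add_apply, Pi.add_apply]
    ring
  choose z hz using hr
  have : E.polyOfCoords (v + w) - (E.polyOfCoords v + E.polyOfCoords w) =
      ∑ j : Fin (k - t), (C (z j) * X ^ (j : ℕ)) * (C ((p : E.GR) ^ (e - 1)) * X ^ t) := by
    have hz' : ∀ j, E.grOfCoords (fun s => (((v + w).2 j s).val : ZMod (p ^ e))) =
      (p : E.GR) ^ (e - 1) * z j + ((E.grOfCoords fun s => ((v.2 j s).val : ZMod (p ^ e))) +
          E.grOfCoords fun s => ((w.2 j s).val : ZMod (p ^ e))) := fun j => by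
      rw [← hz]; ring
    rw [polyOfCoords_eq, polyOfCoords_eq, polyOfCoords_eq]
    simp only [hl, hz', C_add, C_mul, add_mul, Finset.sum_add_distrib]
    have h1 : ∀ j : Fin (k - t), C (z j) * X ^ (j : ℕ) * (C ((p : E.GR) ^ (e - 1)) * X ^ t)
        = C ((p : E.GR) ^ (e - 1)) * C (z j) * X ^ (t + (j : ℕ)) := fun j => by
      rw [pow_add]; ring
    simp only [h1]
    ring
  rw [this]
  exact Ideal.sum_mem _ fun j _ => Ideal.mul_mem_left _ _ (Ideal.subset_span (by simp))

theorem Psi_add {e : ℕ} (E : EisensteinData p e r k t) (a b : E.ChainRing) :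
    E.Psi (a + b) = E.Psi a + E.Psi b := by
  have hP : ∀ v, E.Psi (E.ofCoords v) = v := (Equiv.ofBijective E.ofCoords _).symm_apply_apply
  obtain ⟨v, rfl⟩ := E.ofCoords_bijective.2 a
  obtain ⟨w, rfl⟩ := E.ofCoords_bijective.2 b
  rw [← ofCoords_add, hP, hP, hP]

/-- Enumeration of triples of indices. -/
def tripleEquiv (N r t : ℕ) : (Fin N × Fin r) × Fin t ≃ Fin (N * r * t) :=
  (finProdFinEquiv.prodCongr (Equiv.refl _)).trans finProdFinEquiv

theorem sum_tripleEquiv {M : Type*} [AddCommMonoid M] {N r t : ℕ}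
    (f : (Fin N × Fin r) × Fin t → M) :
    ∑ x, f ((tripleEquiv N r t).symm x) = ∑ l, ∑ s, ∑ i, f ((l, s), i) := by
  rw [Equiv.sum_comp (tripleEquiv N r t).symm f, Fintype.sum_prod_type, Fintype.sum_prod_type]

variable {c : ℕ} (E : EisensteinData p (c + 1) r k t) {N : ℕ}

/-- The coordinates of all entries of a tuple, as an element of `MixedGroup`. -/
noncomputable def tupleCoords (u : Fin N → E.ChainRing) :
    MixedGroup p c (Fin (N * r * t)) (Fin (N * r * (k - t))) :=
  (fun x => (E.Psi (u ((tripleEquiv N r t).symm x).1.1)).1 ((tripleEquiv N r t).symm x).2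
      ((tripleEquiv N r t).symm x).1.2,
    fun x => (E.Psi (u ((tripleEquiv N r (k - t)).symm x).1.1)).2
      ((tripleEquiv N r (k - t)).symm x).2 ((tripleEquiv N r (k - t)).symm x).1.2)

theorem tupleCoords_bijective : Function.Bijective (E.tupleCoords (N := N)) := by
  constructor
  · intro u v h
    funext l
    refine E.Psi.injective (Prod.ext (funext fun i => funext fun s => ?_)
      (funext fun i => funext fun s => ?_))
    · have := congrFun (congrArg Prod.fst h) (tripleEquiv N r t ((l, s), i))
      simpa only [tupleCoords, Equiv.symm_apply_apply] using this
    · have := congrFun (congrArg Prod.snd h) (tripleEquiv N r (k - t) ((l, s), i))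
      simpa only [tupleCoords, Equiv.symm_apply_apply] using this
  · intro y
    refine ⟨fun l => E.Psi.symm (fun i s => y.1 (tripleEquiv N r t ((l, s), i)),
      fun i s => y.2 (tripleEquiv N r (k - t) ((l, s), i))), ?_⟩
    refine Prod.ext (funext fun x => ?_) (funext fun x => ?_)
    · simp only [tupleCoords, Equiv.apply_symm_apply]
      exact congrArg y.1 ((tripleEquiv N r t).apply_symm_apply x)
    · simp only [tupleCoords, Equiv.apply_symm_apply]
      exact congrArg y.2 ((tripleEquiv N r (k - t)).apply_symm_apply x)

/-- `tupleCoords` as an additive equivalence. -/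
noncomputable def tupleEquiv : (Fin N → E.ChainRing) ≃+
    MixedGroup p c (Fin (N * r * t)) (Fin (N * r * (k - t))) :=
  AddEquiv.ofBijective (AddMonoidHom.mk' E.tupleCoords fun u v => by
    refine Prod.ext (funext fun x => ?_) (funext fun x => ?_) <;>
    · simp only [tupleCoords, Pi.add_apply, Psi_add]
      rfl) E.tupleCoords_bijective

/-- All factors combine into one power of ξ. Its exponent is a natural number whose class modulo
p^(c+1) is the pairing, and ξ is primitive of exactly that order. -/
theorem chiVec_eq_one_iff {ξ : ℂ} (hξ : IsPrimitiveRoot ξ (p ^ (c + 1)))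
    (u v : Fin N → E.ChainRing) :
    E.chiVec ξ u v = 1 ↔ mixedPairing p c _ _ (E.tupleEquiv u) (E.tupleEquiv v) = 0 := by
  have h1 : E.chiVec ξ u v = ξ ^ (∑ l : Fin N, ∑ s : Fin r,
      (∑ i : Fin t, ((E.Psi (u l)).1 i s * (E.Psi (v l)).1 i s).val +
        ∑ j : Fin (k - t), p * ((E.Psi (u l)).2 j s * (E.Psi (v l)).2 j s).val)) := by
    simp only [chiVec, chi, Finset.prod_pow_eq_pow_sum, ← pow_add]
  rw [h1, hξ.pow_eq_one_iff_dvd, ← ZMod.natCast_eq_zero_iff, mixedPairing_apply]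
  have h2 : (E.tupleEquiv u).1 ⬝ᵥ (E.tupleEquiv v).1 = ∑ l : Fin N, ∑ s : Fin r, ∑ i : Fin t,
      (E.Psi (u l)).1 i s * (E.Psi (v l)).1 i s :=
    sum_tripleEquiv fun y => (E.Psi (u y.1.1)).1 y.2 y.1.2 * (E.Psi (v y.1.1)).1 y.2 y.1.2
  have h3 : (E.tupleEquiv u).2 ⬝ᵥ (E.tupleEquiv v).2 = ∑ l : Fin N, ∑ s : Fin r,
      ∑ j : Fin (k - t), ((E.Psi (u l)).2 j s * (E.Psi (v l)).2 j s : ZMod (p ^ c)) :=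
    sum_tripleEquiv (t := k - t) fun y =>
      ((E.Psi (u y.1.1)).2 y.2 y.1.2 * (E.Psi (v y.1.1)).2 y.2 y.1.2 : ZMod (p ^ c))
  rw [h2, h3]
  have h4 : ((∑ l : Fin N, ∑ s : Fin r,
      (∑ i : Fin t, ((E.Psi (u l)).1 i s * (E.Psi (v l)).1 i s).val +
        ∑ j : Fin (k - t), p * ((E.Psi (u l)).2 j s * (E.Psi (v l)).2 j s).val) : ℕ) :
          ZMod (p ^ (c + 1))) =
      ∑ l : Fin N, ∑ s : Fin r, ∑ i : Fin t, (E.Psi (u l)).1 i s * (E.Psi (v l)).1 i s +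
      mulPrime p c (∑ l : Fin N, ∑ s : Fin r,
        ∑ j : Fin (k - t), ((E.Psi (u l)).2 j s * (E.Psi (v l)).2 j s : ZMod (p ^ c))) := by
    simp only [map_sum, mulPrime_eq, ← Finset.sum_add_distrib, Nat.cast_sum, Nat.cast_add,
      Nat.cast_mul, ZMod.natCast_zmod_val]
  rw [h4]

theorem isACD_iff {ξ : ℂ} (hξ : IsPrimitiveRoot ξ (p ^ (c + 1)))
    (D : AddSubgroup (Fin N → E.ChainRing)) :
    E.IsACD ξ D ↔ ((E.tupleEquiv).mapAddSubgroup D).IsAnisotropicFor (mixedPairing p c _ _) := by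
  have hmem : ∀ x ∈ (E.tupleEquiv).mapAddSubgroup D, ∃ u ∈ D, E.tupleEquiv u = x := fun x hx => hx
  rw [IsACD, Set.eq_singleton_iff_unique_mem]
  constructor
  · rintro ⟨-, h⟩ x hx h'
    obtain ⟨u, hu, rfl⟩ := hmem x hx
    rw [h u ⟨hu, fun v hv => (E.chiVec_eq_one_iff hξ u v).2 (h' _ ⟨v, hv, rfl⟩)⟩, map_zero]
  · intro h
    refine ⟨⟨D.zero_mem, fun v _ => (E.chiVec_eq_one_iff hξ 0 v).2 (by
      rw [map_zero, map_zero]; rfl)⟩, fun u hu => ?_⟩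
    refine E.tupleEquiv.injective ((h _ ⟨u, hu.1, rfl⟩ fun x hx => ?_).trans (map_zero _).symm)
    obtain ⟨v, hv, rfl⟩ := hmem x hx
    exact (E.chiVec_eq_one_iff hξ u v).1 (hu.2 v hv)

theorem card_isACD {ξ : ℂ} (hξ : IsPrimitiveRoot ξ (p ^ (c + 1))) (hc : c ≠ 0) :
    Nat.card {D : AddSubgroup (Fin N → E.ChainRing) // E.IsACD ξ D} =
      ∑ i ∈ Finset.range (N * r * t + 1), ∑ j ∈ Finset.range (N * r * (k - t) + 1),
        numLCD p (N * r * t) i * numLCD p (N * r * (k - t)) j *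
          p ^ ((N * r * t - i) * c * (i + j) +
            (N * r * (k - t) - j) * (c * i + (c - 1) * j)) := by
  rw [← card_anisotropic_eq_sum_numLCD hc]
  exact Nat.card_congr ((E.tupleEquiv).mapAddSubgroup.toEquiv.subtypeEquiv (E.isACD_iff hξ))

end EisensteinData

end ChainRingCoordinates


/-! ### Nondegenerate subspaces of a symmetric bilinear space -/

section NondegenerateSubspaces

open LinearMap (BilinForm)

variable {K V : Type*} [Field K] [AddCommGroup V] [Module K V]

/-- The restriction of `B` to `U` has trivial radical. -/
def LinearMap.BilinForm.NondegOn (B : BilinForm K V) (U : Submodule K V) : Prop :=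
  ∀ x ∈ U, (∀ y ∈ U, B x y = 0) → x = 0

variable {B : BilinForm K V}

theorem mem_orthogonal_span_singleton {v x : V} :
    x ∈ B.orthogonal (Submodule.span K {v}) ↔ B v x = 0 := by
  rw [LinearMap.BilinForm.mem_orthogonal_iff]
  refine ⟨fun h => h v (Submodule.mem_span_singleton_self v), fun h y hy => ?_⟩
  obtain ⟨a, rfl⟩ := Submodule.mem_span_singleton.1 hy
  show B (a • v) x = 0
  rw [map_smul, LinearMap.smul_apply, h, smul_zero]

theorem nondegOn_bot : B.NondegOn ⊥ := fun _ hx _ => hx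

theorem nondegOn_span_singleton {v : V} (hv : B v v ≠ 0) :
    B.NondegOn (Submodule.span K {v}) := by
  intro x hx h
  obtain ⟨a, rfl⟩ := Submodule.mem_span_singleton.1 hx
  have := h v (Submodule.mem_span_singleton_self v)
  rw [map_smul, LinearMap.smul_apply, smul_eq_mul, mul_eq_zero, or_iff_left hv] at this
  rw [this, zero_smul]

variable (hB : B.IsSymm)
include hB

namespace LinearMap.BilinForm.NondegOn

variable {U W X : Submodule K V}

theorem disjoint (hW : B.NondegOn W) : Disjoint W (B.orthogonal W) := by
  rw [Submodule.disjoint_def]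
  intro x hx h
  exact hW x hx fun y hy => (hB.eq y x).symm.trans (h y hy)

theorem isCompl [FiniteDimensional K V] (hW : B.NondegOn W) : IsCompl W (B.orthogonal W) :=
  (LinearMap.BilinForm.isCompl_orthogonal_iff_disjoint hB.isRefl).2 (hW.disjoint hB)

theorem sup_inf_orthogonal [FiniteDimensional K V] (hW : B.NondegOn W) (hWU : W ≤ U) :
    W ⊔ U ⊓ B.orthogonal W = U := by
  rw [inf_comm U, ← sup_inf_assoc_of_le _ hWU, (hW.isCompl hB).sup_eq_top, top_inf_eq]

theorem exists_add [FiniteDimensional K V] (hW : B.NondegOn W) (hWU : W ≤ U) {x : V}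
    (hx : x ∈ U) : ∃ w ∈ W, ∃ y ∈ U ⊓ B.orthogonal W, w + y = x := by
  rw [← hW.sup_inf_orthogonal hB hWU] at hx
  exact Submodule.mem_sup.1 hx

theorem inf_orthogonal [FiniteDimensional K V] (hU : B.NondegOn U) (hW : B.NondegOn W)
    (hWU : W ≤ U) : B.NondegOn (U ⊓ B.orthogonal W) := by
  intro x hx h
  refine hU x hx.1 fun y hy => ?_
  obtain ⟨w, hw, z, hz, rfl⟩ := hW.exists_add hB hWU hy
  rw [map_add, h z hz, add_zero]
  exact (hB.eq w x).symm.trans (hx.2 w hw)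

theorem finrank_add [FiniteDimensional K V] (hW : B.NondegOn W) (hWU : W ≤ U) :
    Module.finrank K W + Module.finrank K (U ⊓ B.orthogonal W : Submodule K V) =
      Module.finrank K U := by
  have h1 := Submodule.finrank_sup_add_finrank_inf_eq W (U ⊓ B.orthogonal W)
  have h2 : W ⊓ (U ⊓ B.orthogonal W) = ⊥ :=
    eq_bot_iff.2 ((inf_le_inf_left W inf_le_right).trans (hW.disjoint hB).le_bot)
  rw [hW.sup_inf_orthogonal hB hWU, h2, finrank_bot, add_zero] at h1
  exact h1.symm

theorem sup (hW : B.NondegOn W) (hX : B.NondegOn X) (hXW : X ≤ B.orthogonal W) :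
    B.NondegOn (W ⊔ X) := by
  intro x hx h
  obtain ⟨w, hw, y, hy, rfl⟩ := Submodule.mem_sup.1 hx
  have h0 : ∀ a ∈ W, ∀ b ∈ X, B a b = 0 := fun a ha b hb => hXW hb a ha
  have h1 : w = 0 := hW w hw fun w' hw' => by
    have := h w' (Submodule.mem_sup_left hw')
    rwa [map_add, LinearMap.add_apply, (hB.eq y w').trans (h0 w' hw' y hy), add_zero] at this
  have h2 : y = 0 := hX y hy fun y' hy' => by
    have := h y' (Submodule.mem_sup_right hy')
    rwa [map_add, LinearMap.add_apply, h0 w hw y' hy', zero_add] at this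
  rw [h1, h2, add_zero]

theorem inf_orthogonal_inf_orthogonal [FiniteDimensional K V] (hU : B.NondegOn U)
    (hW : B.NondegOn W) (hWU : W ≤ U) : U ⊓ B.orthogonal (U ⊓ B.orthogonal W) = W := by
  refine le_antisymm (fun x hx => ?_) (le_inf hWU fun x hx y hy =>
    (hB.eq y x).trans (hy.2 x hx))
  obtain ⟨w, hw, y, hy, rfl⟩ := hW.exists_add hB hWU hx.1
  have : y = 0 := hU.inf_orthogonal hB hW hWU y hy fun z hz => by
    have h1 : B z (w + y) = 0 := hx.2 z hz
    have h2 : B w z = 0 := hz.2 w hw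
    rw [map_add, (hB.eq z w).trans h2, zero_add] at h1
    exact (hB.eq y z).trans h1
  rw [this, add_zero]
  exact hw

end LinearMap.BilinForm.NondegOn

variable [FiniteDimensional K V] {U W : Submodule K V} {v : V}

/-- The complement of a vector in a subspace. -/
abbrev perpIn (B : BilinForm K V) (U : Submodule K V) (v : V) : Submodule K V :=
  U ⊓ B.orthogonal (Submodule.span K {v})

theorem nondegOn_perpIn (hU : B.NondegOn U) (hv : v ∈ U) (hvv : B v v ≠ 0) :
    B.NondegOn (perpIn B U v) :=
  hU.inf_orthogonal hB (nondegOn_span_singleton hvv)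
    ((Submodule.span_singleton_le_iff_mem _ _).2 hv)

theorem finrank_perpIn (hv : v ∈ U) (hvv : B v v ≠ 0) :
    Module.finrank K (perpIn B U v) + 1 = Module.finrank K U := by
  rw [← (nondegOn_span_singleton hvv).finrank_add hB
    ((Submodule.span_singleton_le_iff_mem _ _).2 hv), finrank_span_singleton, add_comm]
  rintro rfl
  exact hvv (by simp)

theorem span_sup_perpIn (hv : v ∈ U) (hvv : B v v ≠ 0) :
    Submodule.span K {v} ⊔ perpIn B U v = U :=
  (nondegOn_span_singleton hvv).sup_inf_orthogonal hB
    ((Submodule.span_singleton_le_iff_mem _ _).2 hv)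

omit hB [FiniteDimensional K V] in
theorem perpIn_span_sup (hvv : B v v ≠ 0) (hW : W ≤ B.orthogonal (Submodule.span K {v})) :
    perpIn B (Submodule.span K {v} ⊔ W) v = W := by
  refine le_antisymm (fun x hx => ?_) (le_inf le_sup_right hW)
  obtain ⟨y, hy, w, hw, rfl⟩ := Submodule.mem_sup.1 hx.1
  obtain ⟨a, rfl⟩ := Submodule.mem_span_singleton.1 hy
  have h1 := mem_orthogonal_span_singleton.1 hx.2
  rw [map_add, mem_orthogonal_span_singleton.1 (hW hw), add_zero, map_smul, smul_eq_mul,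
    mul_eq_zero, or_iff_left hvv] at h1
  rwa [h1, zero_smul, zero_add]

/-- Splitting v off both U and W leaves the complement of W in U unchanged. Conditions imposed on
that complement therefore pass through the induction on dimension. -/
theorem inf_orthogonal_eq_perpIn (hvv : B v v ≠ 0) (hv : v ∈ W) :
    U ⊓ B.orthogonal W = perpIn B U v ⊓ B.orthogonal (perpIn B W v) := by
  conv_lhs => rw [← span_sup_perpIn hB hv hvv]
  refine le_antisymm (fun x h => ⟨⟨h.1, fun y hy => h.2 y (Submodule.mem_sup_left hy)⟩,
    fun y hy => h.2 y (Submodule.mem_sup_right hy)⟩) (fun x h => ⟨h.1.1, fun y hy => ?_⟩)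
  obtain ⟨a, ha, b, hb, rfl⟩ := Submodule.mem_sup.1 hy
  have h1 : B a x = 0 := h.1.2 a ha
  have h2 : B b x = 0 := h.2 b hb
  show B (a + b) x = 0
  rw [map_add, LinearMap.add_apply, h1, h2, add_zero]

/-- Nondegenerate subspaces of `U` through an anisotropic vector `v` correspond to
nondegenerate subspaces of the complement of `v` in `U`. -/
theorem card_subspaces_through (hv : v ∈ U) (hvv : B v v ≠ 0)
    (Φ : Submodule K V → Prop) :
    Nat.card {W : Submodule K V // (W ≤ U ∧ B.NondegOn W ∧ Φ (perpIn B W v)) ∧ v ∈ W} =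
      Nat.card {W : Submodule K V // W ≤ perpIn B U v ∧ B.NondegOn W ∧ Φ W} := by
  refine Nat.card_congr
    { toFun := fun W => ⟨perpIn B W.1 v, inf_le_inf_right _ W.2.1.1,
        nondegOn_perpIn hB W.2.1.2.1 W.2.2 hvv, W.2.1.2.2⟩
      invFun := fun W => ⟨Submodule.span K {v} ⊔ W.1, ⟨sup_le
        ((Submodule.span_singleton_le_iff_mem _ _).2 hv) (W.2.1.trans inf_le_left),
        (nondegOn_span_singleton hvv).sup hB W.2.2.1 (W.2.1.trans inf_le_right), ?_⟩,
        Submodule.mem_sup_left (Submodule.mem_span_singleton_self v)⟩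
      left_inv := fun W => Subtype.ext (span_sup_perpIn hB W.2.2 hvv)
      right_inv := fun W => Subtype.ext (perpIn_span_sup hvv (W.2.1.trans inf_le_right)) }
  rw [perpIn_span_sup hvv (W.2.1.trans inf_le_right)]
  exact W.2.2.2

omit hB [FiniteDimensional K V] in
theorem card_mul_eq_card_mul_of_relation {α β : Type*} [Finite α] [Finite β] (P : α → Prop)
    (Q : β → Prop) (R : α → β → Prop) (a l : ℕ)
    (h1 : ∀ x, P x → Nat.card {y // Q y ∧ R x y} = a)
    (h2 : ∀ y, Q y → Nat.card {x // P x ∧ R x y} = l) :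
    Nat.card {x // P x} * a = Nat.card {y // Q y} * l := by
  classical
  have := Fintype.ofFinite α
  have := Fintype.ofFinite β
  have e : (Σ x : {x // P x}, {y // Q y ∧ R x y}) ≃ Σ y : {y // Q y}, {x // P x ∧ R x y} :=
    { toFun := fun z => ⟨⟨z.2.1, z.2.2.1⟩, ⟨z.1.1, z.1.2, z.2.2.2⟩⟩
      invFun := fun z => ⟨⟨z.2.1, z.2.2.1⟩, ⟨z.1.1, z.1.2, z.2.2.2⟩⟩
      left_inv := fun _ => rfl
      right_inv := fun _ => rfl }
  have h := Nat.card_congr e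
  rw [Nat.card_sigma, Nat.card_sigma] at h
  simp only [fun x : {x // P x} => h1 x.1 x.2, fun y : {y // Q y} => h2 y.1 y.2] at h
  simpa using h

end NondegenerateSubspaces


/-! ### Gaussian binomials and quotients of group orders -/

section OrderQuotients

/-- The product `∏_(i=1)^m (q^i - 1)`. -/
def gaussFactorial (q : ℚ) (m : ℕ) : ℚ := ∏ i ∈ Finset.range m, (q ^ (i + 1) - 1)

theorem gaussFactorial_succ (q : ℚ) (m : ℕ) :
    gaussFactorial q (m + 1) = gaussFactorial q m * (q ^ (m + 1) - 1) :=
  Finset.prod_range_succ _ _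

theorem gaussFactorial_pos {q : ℚ} (hq : 1 < q) (m : ℕ) : 0 < gaussFactorial q m :=
  Finset.prod_pos fun i _ => sub_pos.2 (one_lt_pow₀ hq (Nat.succ_ne_zero i))

theorem gaussFactorial_ne_zero {q : ℚ} (hq : 1 < q) (m : ℕ) : gaussFactorial q m ≠ 0 :=
  (gaussFactorial_pos hq m).ne'

/-- Each factor is q^i (q^(l+d-i) - 1). The product is a power of q times the top part of a
q-factorial, stated without division so that no condition on q is needed. -/
theorem prod_pow_sub_pow_mul (q : ℚ) (l d : ℕ) :
    (∏ i ∈ Finset.range l, (q ^ (l + d) - q ^ i)) * gaussFactorial q d =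
      q ^ (∑ i ∈ Finset.range l, i) * gaussFactorial q (l + d) := by
  induction l with
  | zero => simp
  | succ l ih =>
    rw [Finset.prod_range_succ']
    have h1 : ∀ i, q ^ (l + 1 + d) - q ^ (i + 1) = q * (q ^ (l + d) - q ^ i) := fun i => by ring
    rw [Finset.prod_congr rfl fun i _ => h1 i]
    rw [Finset.prod_mul_distrib, Finset.prod_const, Finset.card_range, Finset.sum_range_succ,
      pow_add q (∑ i ∈ Finset.range l, i), show l + 1 + d = l + d + 1 by ring, gaussFactorial_succ]
    rw [pow_zero]
    generalize ∏ i ∈ Finset.range l, (q ^ (l + d) - q ^ i) = A at ih ⊢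
    linear_combination q ^ l * (q ^ (l + d + 1) - 1) * ih

theorem gaussBinom_add (l d : ℕ) {q : ℕ} (hq : 1 < q) :
    gaussBinom (l + d) l q =
      gaussFactorial q (l + d) / (gaussFactorial q l * gaussFactorial q d) := by
  have hq' : (1 : ℚ) < q := by exact_mod_cast hq
  have h0 : (q : ℚ) ≠ 0 := by positivity
  have h1 := prod_pow_sub_pow_mul q l d
  have h2 := prod_pow_sub_pow_mul q l 0
  have hd := gaussFactorial_ne_zero hq' d
  have hl := gaussFactorial_ne_zero hq' l
  have hz : gaussFactorial q 0 = 1 := by simp [gaussFactorial]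
  rw [add_zero, hz, mul_one] at h2
  have hs : (q : ℚ) ^ (∑ i ∈ Finset.range l, i) ≠ 0 := pow_ne_zero _ h0
  rw [gaussBinom, h2, eq_div_of_mul_eq hd h1]
  field_simp

/-- The order of the symplectic group of rank `a` over `𝔽₂`. -/
def symplecticOrderTwo (a : ℕ) : ℚ := 2 ^ (a ^ 2) * gaussFactorial 4 a

/-- The order of the isometry group of the dot product on `𝔽₂^m`, `m ≥ 1`. -/
def dotOrderTwo (m : ℕ) : ℚ :=
  if Odd m then symplecticOrderTwo (m / 2) else 2 ^ (m - 1) * symplecticOrderTwo (m / 2 - 1)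

theorem symplecticOrderTwo_pos (a : ℕ) : 0 < symplecticOrderTwo a :=
  mul_pos (by positivity) (gaussFactorial_pos (by norm_num) a)

theorem symplecticOrderTwo_succ (a : ℕ) :
    symplecticOrderTwo (a + 1) = 2 ^ (2 * a + 1) * (4 ^ (a + 1) - 1) * symplecticOrderTwo a := by
  rw [symplecticOrderTwo, symplecticOrderTwo, gaussFactorial_succ,
    show (a + 1) ^ 2 = a ^ 2 + (2 * a + 1) by ring, pow_add]
  ring

theorem dotOrderTwo_odd (a : ℕ) : dotOrderTwo (2 * a + 1) = symplecticOrderTwo a := by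
  rw [dotOrderTwo, if_pos ⟨a, rfl⟩, show (2 * a + 1) / 2 = a by omega]

theorem dotOrderTwo_even (a : ℕ) :
    dotOrderTwo (2 * a + 2) = 2 ^ (2 * a + 1) * symplecticOrderTwo a := by
  rw [dotOrderTwo, if_neg (by rw [Nat.not_odd_iff]; omega), show (2 * a + 2) / 2 - 1 = a by omega,
    show 2 * a + 2 - 1 = 2 * a + 1 by omega]

theorem dotOrderTwo_pos (m : ℕ) : 0 < dotOrderTwo m := by
  rw [dotOrderTwo]
  have := symplecticOrderTwo_pos
  split_ifs
  · exact this _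
  · exact mul_pos (by positivity) (this _)

/-- Gaussian binomials in base 4 are quotients of symplectic orders up to the cross term of (b +
c)²; all binary closed forms below are rewritten through this identity. -/
theorem symplecticOrderTwo_div (b c : ℕ) :
    symplecticOrderTwo (b + c) / (symplecticOrderTwo b * symplecticOrderTwo c) =
      2 ^ (2 * b * c) * gaussBinom (b + c) b 4 := by
  have h1 := gaussFactorial_ne_zero (q := 4) (by norm_num)
  have h := gaussBinom_add b c (q := 4) (by norm_num)
  rw [Nat.cast_ofNat] at h
  rw [h, symplecticOrderTwo, symplecticOrderTwo, symplecticOrderTwo,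
    show (b + c) ^ 2 = b ^ 2 + c ^ 2 + 2 * b * c by ring, pow_add, pow_add]
  have := h1 b; have := h1 c
  field_simp

theorem gaussBinom_comm_add (b c : ℕ) {q : ℕ} (hq : 1 < q) :
    gaussBinom (b + c) c q = gaussBinom (b + c) b q := by
  rw [gaussBinom_add b c hq, add_comm b c, gaussBinom_add c b hq, mul_comm (gaussFactorial _ c)]

/-- The two summands separate the types of the even-dimensional complement: not alternating, or
alternating with a symplectic isometry group. The subspace itself, of odd dimension, cannot be
alternating. For n odd and s even the roles are exchanged, and for n even and s odd only one type
survives. -/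
theorem lcdFormulaTwo_odd_odd (b c : ℕ) :
    lcdFormulaTwo (2 * b + 1 + (2 * c + 2)) (2 * b + 1) =
      dotOrderTwo (2 * b + 1 + (2 * c + 2)) / (dotOrderTwo (2 * b + 1) * dotOrderTwo (2 * c + 2)) +
        dotOrderTwo (2 * b + 1 + (2 * c + 2)) /
          (dotOrderTwo (2 * b + 1) * symplecticOrderTwo (c + 1)) := by
  have g := symplecticOrderTwo_div b (c + 1)
  have hb := (symplecticOrderTwo_pos b).ne'
  have hc := (symplecticOrderTwo_pos c).ne'
  have h4 : (4 : ℚ) ^ (c + 1) - 1 ≠ 0 :=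
    (sub_pos.2 (one_lt_pow₀ (by norm_num) (Nat.succ_ne_zero c))).ne'
  rw [lcdFormulaTwo, if_pos ⟨b + c + 1, by ring⟩, if_pos ⟨b, rfl⟩, Nat.add_sub_cancel_left,
    show (2 * b + 1 + (2 * c + 2) - 1) / 2 = b + (c + 1) by omega,
    show (2 * b + 1 - 1) / 2 = b by omega,
    show (2 * c + 2) * (2 * b + 1 + 1) / 2 = 2 * b * (c + 1) + 2 * (c + 1) from
      Nat.div_eq_of_eq_mul_left two_pos (by ring), pow_add, mul_right_comm, ← g,
    show 2 * b + 1 + (2 * c + 2) = 2 * (b + (c + 1)) + 1 by ring, dotOrderTwo_odd, dotOrderTwo_odd,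
    dotOrderTwo_even, symplecticOrderTwo_succ c]
  have f : (2 : ℚ) ^ (2 * (c + 1)) = 4 ^ (c + 1) := by rw [pow_mul]; norm_num
  rw [f]
  field_simp
  ring

theorem lcdFormulaTwo_odd_even (b c : ℕ) :
    lcdFormulaTwo (2 * c + 2 + (2 * b + 1)) (2 * c + 2) =
      dotOrderTwo (2 * c + 2 + (2 * b + 1)) / (dotOrderTwo (2 * c + 2) * dotOrderTwo (2 * b + 1)) +
        dotOrderTwo (2 * c + 2 + (2 * b + 1)) /
          (symplecticOrderTwo (c + 1) * dotOrderTwo (2 * b + 1)) := by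
  have g := symplecticOrderTwo_div (c + 1) b
  have hb := (symplecticOrderTwo_pos b).ne'
  have hc := (symplecticOrderTwo_pos c).ne'
  have h4 : (4 : ℚ) ^ (c + 1) - 1 ≠ 0 :=
    (sub_pos.2 (one_lt_pow₀ (by norm_num) (Nat.succ_ne_zero c))).ne'
  rw [lcdFormulaTwo, if_pos ⟨b + c + 1, by ring⟩, if_neg (by rw [Nat.not_odd_iff]; omega),
    Nat.add_sub_cancel_left,
    show (2 * c + 2 + (2 * b + 1) - 1) / 2 = c + 1 + b by omega,
    show (2 * c + 2) / 2 = c + 1 by omega,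
    show (2 * c + 2) * (2 * b + 1 + 1) / 2 = 2 * (c + 1) * b + 2 * (c + 1) from
      Nat.div_eq_of_eq_mul_left two_pos (by ring), pow_add, mul_right_comm, ← g,
    show 2 * c + 2 + (2 * b + 1) = 2 * (c + 1 + b) + 1 by ring, dotOrderTwo_odd, dotOrderTwo_odd,
    dotOrderTwo_even, symplecticOrderTwo_succ c]
  have f : (2 : ℚ) ^ (2 * (c + 1)) = 4 ^ (c + 1) := by rw [pow_mul]; norm_num
  rw [f]
  field_simp
  ring

theorem lcdFormulaTwo_even_odd (b c : ℕ) :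
    lcdFormulaTwo (2 * b + 1 + (2 * c + 1)) (2 * b + 1) =
      dotOrderTwo (2 * b + 1 + (2 * c + 1)) /
        (dotOrderTwo (2 * b + 1) * dotOrderTwo (2 * c + 1)) := by
  have g := symplecticOrderTwo_div b c
  have hns : (2 * b + 1 + (2 * c + 1)) * (2 * b + 1) - (2 * b + 1) ^ 2
      + (2 * b + 1 + (2 * c + 1)) - 1 = (2 * b * c + 2 * (b + c) + 1) * 2 := by
    have : (2 * b + 1 + (2 * c + 1)) * (2 * b + 1) = (2 * b + 1) ^ 2 + (2 * c + 1) * (2 * b + 1) := by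
      ring
    rw [this, Nat.add_sub_cancel_left]
    have : (2 * c + 1) * (2 * b + 1) = 4 * (b * c) + 2 * b + 2 * c + 1 := by ring
    rw [this, show 2 * b * c = 2 * (b * c) by ring]
    omega
  rw [lcdFormulaTwo, if_neg (by rw [Nat.not_odd_iff]; omega), if_pos ⟨b, rfl⟩, hns,
    Nat.mul_div_cancel _ two_pos,
    show (2 * b + 1 + (2 * c + 1) - 2) / 2 = b + c by omega,
    show (2 * b + 1 - 1) / 2 = b by omega, add_assoc, pow_add, mul_right_comm, ← g,
    show 2 * b + 1 + (2 * c + 1) = 2 * (b + c) + 2 by ring, dotOrderTwo_odd, dotOrderTwo_odd,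
    dotOrderTwo_even]
  ring

/-- With both dimensions even three types occur: neither part alternating, only the complement, or
only the subspace. The two Gaussian binomials of the closed form have different lower indices, so
both are first expressed by the same symplectic orders. -/
theorem lcdFormulaTwo_even_even (b c : ℕ) :
    lcdFormulaTwo (2 * b + 2 + (2 * c + 2)) (2 * b + 2) =
      dotOrderTwo (2 * b + 2 + (2 * c + 2)) / (dotOrderTwo (2 * b + 2) * dotOrderTwo (2 * c + 2)) +
      dotOrderTwo (2 * b + 2 + (2 * c + 2)) /
        (dotOrderTwo (2 * b + 2) * symplecticOrderTwo (c + 1)) +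
      dotOrderTwo (2 * b + 2 + (2 * c + 2)) /
        (symplecticOrderTwo (b + 1) * dotOrderTwo (2 * c + 2)) := by
  have g1 := symplecticOrderTwo_div (b + 1) c
  have g2 := symplecticOrderTwo_div b (c + 1)
  rw [show b + (c + 1) = b + 1 + c by ring] at g2
  have hns : (2 * b + 2 + (2 * c + 2)) * (2 * b + 2) - (2 * b + 2) ^ 2 - 2
      = (2 * (b * c) + 2 * b + 2 * c + 1) * 2 := by
    have : (2 * b + 2 + (2 * c + 2)) * (2 * b + 2) = (2 * b + 2) ^ 2 + (2 * c + 2) * (2 * b + 2) := by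
      ring
    rw [this, Nat.add_sub_cancel_left]
    have : (2 * c + 2) * (2 * b + 2) = 4 * (b * c) + 4 * b + 4 * c + 4 := by ring
    omega
  have g1' : gaussBinom (b + 1 + c) (b + 1) 4 = symplecticOrderTwo (b + 1 + c) /
      (symplecticOrderTwo (b + 1) * symplecticOrderTwo c) / 2 ^ (2 * (b + 1) * c) := by
    rw [g1]; field_simp
  have g2' : gaussBinom (b + 1 + c) b 4 = symplecticOrderTwo (b + 1 + c) /
      (symplecticOrderTwo b * symplecticOrderTwo (c + 1)) / 2 ^ (2 * b * (c + 1)) := by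
    rw [g2]; field_simp
  rw [lcdFormulaTwo, if_neg (by rw [Nat.not_odd_iff]; omega),
    if_neg (by rw [Nat.not_odd_iff]; omega), hns, Nat.mul_div_cancel _ two_pos,
    Nat.add_sub_cancel_left, show (2 * b + 2 + (2 * c + 2) - 2) / 2 = b + 1 + c by omega,
    show (2 * b + 2) / 2 = b + 1 by omega, show (2 * b + 2 - 2) / 2 = b by omega, g1', g2',
    show 2 * b + 2 + (2 * c + 2) = 2 * (b + 1 + c) + 2 by ring, dotOrderTwo_even, dotOrderTwo_even,
    dotOrderTwo_even, symplecticOrderTwo_succ b, symplecticOrderTwo_succ c]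
  have hb := (symplecticOrderTwo_pos b).ne'
  have hc := (symplecticOrderTwo_pos c).ne'
  have h4 : ∀ m : ℕ, (4 : ℚ) ^ (m + 1) - 1 ≠ 0 := fun m =>
    (sub_pos.2 (one_lt_pow₀ (by norm_num) (Nat.succ_ne_zero m))).ne'
  have hb4 := h4 b
  have hc4 := h4 c
  generalize symplecticOrderTwo (b + 1 + c) = S
  generalize symplecticOrderTwo b = Sb at *
  generalize symplecticOrderTwo c = Sc at *
  -- All exponents are now expressed through 2^b, 2^c and 2^(bc), which are then treated as
  -- independent variables; the claim becomes an identity of rational functions.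
  have f1 : ∀ m : ℕ, (4 : ℚ) ^ (m + 1) = 4 * (2 ^ m) ^ 2 := fun m => by
    rw [show (4 : ℚ) = 2 ^ 2 by norm_num, ← pow_mul]; ring
  rw [f1] at hb4 hc4
  have f2 : (2 : ℚ) ^ (2 * (b * c) + 2 * b + 2 * c + 1)
      = 2 * (2 ^ (b * c)) ^ 2 * (2 ^ b) ^ 2 * (2 ^ c) ^ 2 := by ring
  have f3 : (2 : ℚ) ^ (2 * (b + 1) * c) = (2 ^ (b * c)) ^ 2 * (2 ^ c) ^ 2 := by ring
  have f4 : (2 : ℚ) ^ (2 * b * (c + 1)) = (2 ^ (b * c)) ^ 2 * (2 ^ b) ^ 2 := by ring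
  have f5 : (2 : ℚ) ^ (2 * (b + 1 + c) + 1) = 8 * (2 ^ b) ^ 2 * (2 ^ c) ^ 2 := by ring
  have f6 : ∀ m : ℕ, (2 : ℚ) ^ (2 * m + 1) = 2 * (2 ^ m) ^ 2 := fun m => by ring
  have f7 : ∀ m : ℕ, (2 : ℚ) ^ (2 * m + 2) = 4 * (2 ^ m) ^ 2 := fun m => by ring
  have f8 : ∀ m : ℕ, (2 : ℚ) ^ (2 * m + 2 + 1) = 8 * (2 ^ m) ^ 2 := fun m => by ring
  rw [f1, f1, f2, f3, f4, f5, f6, f6, f7, f7, f8]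
  have hx : (2 : ℚ) ^ b ≠ 0 := by positivity
  have hy : (2 : ℚ) ^ c ≠ 0 := by positivity
  have hz : (2 : ℚ) ^ (b * c) ≠ 0 := by positivity
  generalize (2 : ℚ) ^ b = x at *
  generalize (2 : ℚ) ^ c = y at *
  generalize (2 : ℚ) ^ (b * c) = z at *
  clear f1 f2 f3 f4 f5 f6 f7 f8 g1 g2 g1' g2' h4
  generalize hu : 4 * x ^ 2 - 1 = u at *
  generalize hv : 4 * y ^ 2 - 1 = v at *
  field_simp
  rw [← hu, ← hv]
  ring

/-- The order of the isometry group of a nondegenerate quadratic space of dimension `m` over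
`𝔽_p` whose discriminant has quadratic character `σ`, where `θ` is the quadratic character
of `-1`. -/
def orthogonalOrder (p : ℕ) (θ : ℚ) (m : ℕ) (σ : ℚ) : ℚ :=
  if m = 0 then 1
  else if Odd m then 2 * p ^ ((m / 2) ^ 2) * gaussFactorial (p ^ 2) (m / 2)
  else 2 * p ^ ((m / 2) * (m / 2 - 1)) * (p ^ (m / 2) - σ * θ ^ (m / 2)) *
    gaussFactorial (p ^ 2) (m / 2 - 1)

theorem orthogonalOrder_odd (p : ℕ) (θ : ℚ) (a : ℕ) (σ : ℚ) :
    orthogonalOrder p θ (2 * a + 1) σ = 2 * p ^ (a ^ 2) * gaussFactorial (p ^ 2) a := by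
  rw [orthogonalOrder, if_neg (by omega), if_pos ⟨a, rfl⟩, show (2 * a + 1) / 2 = a by omega]

theorem orthogonalOrder_even (p : ℕ) (θ : ℚ) (a : ℕ) (σ : ℚ) :
    orthogonalOrder p θ (2 * a + 2) σ = 2 * p ^ ((a + 1) * a) *
      (p ^ (a + 1) - σ * θ ^ (a + 1)) * gaussFactorial (p ^ 2) a := by
  rw [orthogonalOrder, if_neg (by omega), if_neg (by rw [Nat.not_odd_iff]; omega),
    show (2 * a + 2) / 2 = a + 1 by omega, Nat.add_sub_cancel]

variable {p : ℕ} (hp : 1 < p)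
include hp

theorem gaussFactorial_sq_ne_zero (a : ℕ) : gaussFactorial ((p : ℚ) ^ 2) a ≠ 0 :=
  gaussFactorial_ne_zero (one_lt_pow₀ (by exact_mod_cast hp) two_ne_zero) a

theorem gaussBinom_sq_add (b c : ℕ) : gaussBinom (b + c) b (p ^ 2) =
    gaussFactorial ((p : ℚ) ^ 2) (b + c) /
      (gaussFactorial ((p : ℚ) ^ 2) b * gaussFactorial ((p : ℚ) ^ 2) c) := by
  rw [gaussBinom_add b c (Nat.one_lt_pow two_ne_zero hp), Nat.cast_pow]

theorem pow_sub_ne_zero {θ σ : ℚ} (hθ : θ ^ 2 = 1) (hσ : σ ^ 2 = 1) (m : ℕ) :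
    (p : ℚ) ^ (m + 1) - σ * θ ^ (m + 1) ≠ 0 := by
  intro h
  have h1 : ((p : ℚ) ^ (m + 1)) ^ 2 = 1 := by
    rw [sub_eq_zero.1 h, mul_pow, hσ, one_mul, ← pow_mul, mul_comm, pow_mul, hθ, one_pow]
  have h2 : (1 : ℚ) < (p : ℚ) ^ (m + 1) :=
    one_lt_pow₀ (by exact_mod_cast hp) (Nat.succ_ne_zero m)
  nlinarith

theorem orthogonalOrder_ne_zero {θ σ : ℚ} (hθ : θ ^ 2 = 1) (hσ : σ ^ 2 = 1) (m : ℕ) :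
    orthogonalOrder p θ m σ ≠ 0 := by
  have h0 : (p : ℚ) ≠ 0 := by positivity
  rcases Nat.even_or_odd' m with ⟨a, rfl | rfl⟩
  · rcases a with _ | a
    · simp [orthogonalOrder]
    · rw [show 2 * (a + 1) = 2 * a + 2 by ring, orthogonalOrder_even]
      have := pow_sub_ne_zero hp hθ hσ a
      have := gaussFactorial_sq_ne_zero hp a
      positivity
  · rw [orthogonalOrder_odd]
    have := gaussFactorial_sq_ne_zero hp a
    positivity

/-- Orders in odd dimension do not depend on the sign, so with x = p^(c+1) and η = θ^(c+1) the sum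
over signs is governed by 1/(x - η) + 1/(x + η) = 2x/(x² - 1). The same identity serves s odd and s
even, by exchanging a subspace with its complement. -/
theorem odd_even_quotient (b c : ℕ) {θ : ℚ} (hθ : θ ^ 2 = 1) :
    (p : ℚ) ^ (2 * b * (c + 1) + 2 * (c + 1)) * gaussBinom (b + (c + 1)) b (p ^ 2) =
      orthogonalOrder p θ (2 * (b + (c + 1)) + 1) 1 /
        (orthogonalOrder p θ (2 * b + 1) 1 * orthogonalOrder p θ (2 * c + 2) 1) +
      orthogonalOrder p θ (2 * (b + (c + 1)) + 1) 1 /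
        (orthogonalOrder p θ (2 * b + 1) (-1) * orthogonalOrder p θ (2 * c + 2) (-1)) := by
  have hb := gaussFactorial_sq_ne_zero hp b
  have hc := gaussFactorial_sq_ne_zero hp c
  have h1 := pow_sub_ne_zero hp hθ (one_pow 2) c
  have h2 := pow_sub_ne_zero hp hθ (σ := -1) (by norm_num) c
  have h0 : (p : ℚ) ≠ 0 := by positivity
  have hθc : (θ ^ (c + 1)) ^ 2 = 1 := by rw [← pow_mul, mul_comm, pow_mul, hθ, one_pow]
  rw [gaussBinom_sq_add hp, orthogonalOrder_odd, orthogonalOrder_odd, orthogonalOrder_odd,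
    orthogonalOrder_even, orthogonalOrder_even, gaussFactorial_succ _ c]
  have e1 : ((p : ℚ) ^ 2) ^ (c + 1) - 1 = ((p : ℚ) ^ (c + 1) - 1 * θ ^ (c + 1)) *
      ((p : ℚ) ^ (c + 1) - -1 * θ ^ (c + 1)) := by
    linear_combination hθc
  have e2 : (p : ℚ) ^ (2 * b * (c + 1) + 2 * (c + 1)) =
    (p : ℚ) ^ (2 * b * (c + 1)) * ((p : ℚ) ^ (c + 1)) ^ 2 := by ring
  have e3 : (p : ℚ) ^ (b + (c + 1)) ^ 2 = (p : ℚ) ^ b ^ 2 * (p : ℚ) ^ (2 * b * (c + 1)) *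
    ((p : ℚ) ^ ((c + 1) * c) * (p : ℚ) ^ (c + 1)) := by ring
  rw [e1, e2, e3]
  have hx : (p : ℚ) ^ (c + 1) ≠ 0 := by positivity
  have hy : (p : ℚ) ^ ((c + 1) * c) ≠ 0 := by positivity
  have hz : (p : ℚ) ^ b ^ 2 ≠ 0 := by positivity
  clear e1 e2 e3
  generalize (p : ℚ) ^ (2 * b * (c + 1)) = w
  generalize (p : ℚ) ^ (c + 1) = x at *
  generalize (p : ℚ) ^ ((c + 1) * c) = y at *
  generalize (p : ℚ) ^ b ^ 2 = z at *
  generalize θ ^ (c + 1) = η at *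
  generalize hu : x - 1 * η = u at *
  generalize hv : x - -1 * η = v at *
  field_simp
  rw [← hu, ← hv]
  ring

theorem lcdFormulaOdd_odd_odd (b c : ℕ) {θ : ℚ} (hθ : θ ^ 2 = 1) :
    lcdFormulaOdd p (2 * b + 1 + (2 * c + 2)) (2 * b + 1) =
      orthogonalOrder p θ (2 * b + 1 + (2 * c + 2)) 1 /
        (orthogonalOrder p θ (2 * b + 1) 1 * orthogonalOrder p θ (2 * c + 2) 1) +
      orthogonalOrder p θ (2 * b + 1 + (2 * c + 2)) 1 /
        (orthogonalOrder p θ (2 * b + 1) (-1) * orthogonalOrder p θ (2 * c + 2) (-1)) := by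
  rw [lcdFormulaOdd, if_pos ⟨b + c + 1, by ring⟩, if_pos ⟨b, rfl⟩, Nat.add_sub_cancel_left,
    show (2 * b + 1 + (2 * c + 2) - 1) / 2 = b + (c + 1) by omega,
    show (2 * b + 1 - 1) / 2 = b by omega,
    show (2 * c + 2) * (2 * b + 1 + 1) / 2 = 2 * b * (c + 1) + 2 * (c + 1) from
      Nat.div_eq_of_eq_mul_left two_pos (by ring),
    show 2 * b + 1 + (2 * c + 2) = 2 * (b + (c + 1)) + 1 by ring]
  exact odd_even_quotient hp b c hθ

theorem lcdFormulaOdd_odd_even (b c : ℕ) {θ : ℚ} (hθ : θ ^ 2 = 1) :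
    lcdFormulaOdd p (2 * c + 2 + (2 * b + 1)) (2 * c + 2) =
      orthogonalOrder p θ (2 * c + 2 + (2 * b + 1)) 1 /
        (orthogonalOrder p θ (2 * c + 2) 1 * orthogonalOrder p θ (2 * b + 1) 1) +
      orthogonalOrder p θ (2 * c + 2 + (2 * b + 1)) 1 /
        (orthogonalOrder p θ (2 * c + 2) (-1) * orthogonalOrder p θ (2 * b + 1) (-1)) := by
  have h := odd_even_quotient hp b c hθ
  rw [← gaussBinom_comm_add b (c + 1) (Nat.one_lt_pow two_ne_zero hp)] at h
  rw [lcdFormulaOdd, if_pos ⟨b + c + 1, by ring⟩, if_neg (by rw [Nat.not_odd_iff]; omega),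
    Nat.add_sub_cancel_left,
    show (2 * c + 2 + (2 * b + 1) - 1) / 2 = b + (c + 1) by omega,
    show (2 * c + 2) / 2 = c + 1 by omega,
    show (2 * c + 2) * (2 * b + 1 + 1) / 2 = 2 * b * (c + 1) + 2 * (c + 1) from
      Nat.div_eq_of_eq_mul_left two_pos (by ring),
    show 2 * c + 2 + (2 * b + 1) = 2 * (b + (c + 1)) + 1 by ring, h,
    mul_comm (orthogonalOrder p θ (2 * c + 2) 1), mul_comm (orthogonalOrder p θ (2 * c + 2) (-1))]

/-- Both parts have odd dimension, so the two summands are equal. The sign enters only through the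
factor p^(n/2) - θ^(n/2) of the ambient order. -/
theorem lcdFormulaOdd_even_odd (b c : ℕ) {θ : ℚ} (hθ : θ = if p % 4 = 1 then 1 else -1) :
    lcdFormulaOdd p (2 * b + 1 + (2 * c + 1)) (2 * b + 1) =
      orthogonalOrder p θ (2 * b + 1 + (2 * c + 1)) 1 /
        (orthogonalOrder p θ (2 * b + 1) 1 * orthogonalOrder p θ (2 * c + 1) 1) +
      orthogonalOrder p θ (2 * b + 1 + (2 * c + 1)) 1 /
        (orthogonalOrder p θ (2 * b + 1) (-1) * orthogonalOrder p θ (2 * c + 1) (-1)) := by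
  have hb := gaussFactorial_sq_ne_zero hp b
  have hc := gaussFactorial_sq_ne_zero hp c
  have h0 : (p : ℚ) ≠ 0 := by positivity
  have hns : (2 * b + 1 + (2 * c + 1)) * (2 * b + 1) - (2 * b + 1) ^ 2 - 1
      = (2 * (b * c) + b + c) * 2 := by
    have : (2 * b + 1 + (2 * c + 1)) * (2 * b + 1) = (2 * b + 1) ^ 2 + (2 * c + 1) * (2 * b + 1) := by
      ring
    rw [this, Nat.add_sub_cancel_left]
    have : (2 * c + 1) * (2 * b + 1) = 4 * (b * c) + 2 * b + 2 * c + 1 := by ring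
    omega
  -- The power θ^(n/2) equals -1 exactly when θ = -1 and n/2 is odd, which is the second branch of
  -- the closed form.
  have hsign : (if p % 4 = 1 ∨ (2 * b + 1 + (2 * c + 1)) % 4 = 0 then
      (p : ℚ) ^ (2 * (b * c) + b + c) * ((p : ℚ) ^ (b + c + 1) - 1) *
          gaussBinom (b + c) b (p ^ 2)
      else (p : ℚ) ^ (2 * (b * c) + b + c) * ((p : ℚ) ^ (b + c + 1) + 1) *
          gaussBinom (b + c) b (p ^ 2)) =
      (p : ℚ) ^ (2 * (b * c) + b + c) * ((p : ℚ) ^ (b + c + 1) - 1 * θ ^ (b + c + 1)) *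
          gaussBinom (b + c) b (p ^ 2) := by
    by_cases h1 : p % 4 = 1
    · rw [if_pos (Or.inl h1), hθ, if_pos h1, one_pow, one_mul]
    · rw [hθ, if_neg h1]
      by_cases h2 : (2 * b + 1 + (2 * c + 1)) % 4 = 0
      · rw [if_pos (Or.inr h2), Even.neg_one_pow (by rw [Nat.even_iff]; omega), one_mul]
      · rw [if_neg (by tauto), Odd.neg_one_pow (by rw [Nat.odd_iff]; omega), one_mul, sub_neg_eq_add]
  rw [lcdFormulaOdd, if_neg (by rw [Nat.not_odd_iff]; omega), if_pos ⟨b, rfl⟩, hns,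
    Nat.mul_div_cancel _ two_pos, show (2 * b + 1 + (2 * c + 1)) / 2 = b + c + 1 by omega,
    show (2 * b + 1 + (2 * c + 1) - 2) / 2 = b + c by omega,
    show (2 * b + 1 - 1) / 2 = b by omega, hsign, gaussBinom_sq_add hp,
    show 2 * b + 1 + (2 * c + 1) = 2 * (b + c) + 2 by ring, orthogonalOrder_odd,
    orthogonalOrder_odd, orthogonalOrder_odd, orthogonalOrder_odd, orthogonalOrder_even]
  have e3 : (p : ℚ) ^ ((b + c + 1) * (b + c)) = (p : ℚ) ^ b ^ 2 * (p : ℚ) ^ c ^ 2 *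
    (p : ℚ) ^ (2 * (b * c) + b + c) := by ring
  rw [e3]
  field_simp
  ring

/-- With x, x' the powers of p and η, η' the signs of the two parts, the sum over signs rests on (x
+ η)(x' + η') + (x - η)(x' - η') = 2(xx' + ηη'). This multiplies the ambient factor xx' - ηη' into
(xx')² - 1, the last factor of the numerator of the Gaussian binomial. -/
theorem lcdFormulaOdd_even_even (b c : ℕ) {θ : ℚ} (hθ : θ ^ 2 = 1) :
    lcdFormulaOdd p (2 * b + 2 + (2 * c + 2)) (2 * b + 2) =
      orthogonalOrder p θ (2 * b + 2 + (2 * c + 2)) 1 /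
        (orthogonalOrder p θ (2 * b + 2) 1 * orthogonalOrder p θ (2 * c + 2) 1) +
      orthogonalOrder p θ (2 * b + 2 + (2 * c + 2)) 1 /
        (orthogonalOrder p θ (2 * b + 2) (-1) * orthogonalOrder p θ (2 * c + 2) (-1)) := by
  have hb := gaussFactorial_sq_ne_zero hp b
  have hc := gaussFactorial_sq_ne_zero hp c
  have h0 : (p : ℚ) ≠ 0 := by positivity
  have pw : ∀ m : ℕ, (θ ^ m) ^ 2 = 1 := fun m => by
    rw [← pow_mul, mul_comm, pow_mul, hθ, one_pow]
  have b1 := pow_sub_ne_zero hp hθ (one_pow 2) b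
  have b2 := pow_sub_ne_zero hp hθ (σ := -1) (by norm_num) b
  have c1 := pow_sub_ne_zero hp hθ (one_pow 2) c
  have c2 := pow_sub_ne_zero hp hθ (σ := -1) (by norm_num) c
  have hb' := pw (b + 1)
  have hc' := pw (c + 1)
  have g := gaussBinom_sq_add hp (b + 1) (c + 1)
  rw [gaussFactorial_succ _ b, gaussFactorial_succ _ c,
    show b + 1 + (c + 1) = b + c + 1 + 1 by ring, gaussFactorial_succ _ (b + c + 1)] at g
  rw [lcdFormulaOdd, if_neg (by rw [Nat.not_odd_iff]; omega),
    if_neg (by rw [Nat.not_odd_iff]; omega), Nat.add_sub_cancel_left,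
    show (2 * b + 2) * (2 * c + 2) / 2 = 2 * ((b + 1) * (c + 1)) from
      Nat.div_eq_of_eq_mul_left two_pos (by ring),
    show (2 * b + 2 + (2 * c + 2)) / 2 = b + c + 1 + 1 by omega,
    show (2 * b + 2) / 2 = b + 1 by omega, g,
    show 2 * b + 2 + (2 * c + 2) = 2 * (b + c + 1) + 2 by ring, orthogonalOrder_even,
    orthogonalOrder_even, orthogonalOrder_even, orthogonalOrder_even, orthogonalOrder_even]
  have e1 : ∀ m : ℕ, ((p : ℚ) ^ 2) ^ (m + 1) - 1 = ((p : ℚ) ^ (m + 1) - 1 * θ ^ (m + 1)) *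
      ((p : ℚ) ^ (m + 1) - -1 * θ ^ (m + 1)) := fun m => by
    linear_combination pw (m + 1)
  have e3 : (p : ℚ) ^ ((b + c + 1 + 1) * (b + c + 1)) = (p : ℚ) ^ ((b + 1) * b) *
    (p : ℚ) ^ ((c + 1) * c) * (p : ℚ) ^ (2 * ((b + 1) * (c + 1))) := by ring
  have e4 : (p : ℚ) ^ (b + c + 1 + 1) = (p : ℚ) ^ (b + 1) * (p : ℚ) ^ (c + 1) := by ring
  have e5 : θ ^ (b + c + 1 + 1) = θ ^ (b + 1) * θ ^ (c + 1) := by ring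
  rw [e1, e1, e1, e3, e4, e5]
  have hy : (p : ℚ) ^ ((b + 1) * b) ≠ 0 := by positivity
  have hz : (p : ℚ) ^ ((c + 1) * c) ≠ 0 := by positivity
  clear e1 e3 e4 e5 pw g
  generalize (p : ℚ) ^ (2 * ((b + 1) * (c + 1))) = w
  generalize (p : ℚ) ^ ((b + 1) * b) = y at *
  generalize (p : ℚ) ^ ((c + 1) * c) = z at *
  generalize (p : ℚ) ^ (b + 1) = x at *
  generalize (p : ℚ) ^ (c + 1) = x' at *
  generalize θ ^ (b + 1) = η at *
  generalize θ ^ (c + 1) = η' at *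
  generalize hu : x - 1 * η = u at *
  generalize hv : x - -1 * η = v at *
  generalize hu' : x' - 1 * η' = u' at *
  generalize hv' : x' - -1 * η' = v' at *
  generalize gaussFactorial ((p : ℚ) ^ 2) (b + c + 1) = F
  field_simp
  rw [← hu, ← hv, ← hu', ← hv']
  ring

end OrderQuotients


/-! ### Counting nondegenerate subspaces by anisotropic vectors -/

section AnisotropicVectors

open LinearMap (BilinForm)

variable {K V : Type*} [Field K] [AddCommGroup V] [Module K V] [Finite V]
  {B : BilinForm K V} {U : Submodule K V}

/-- Double count of the pairs `(v, W)` of an anisotropic vector and a nondegenerate subspace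
containing it. -/
theorem card_anisotropic_mul [FiniteDimensional K V] (hB : B.IsSymm) (P : V → Prop)
    (G : Submodule K V → Prop) (R Φ : V → Submodule K V → Prop)
    (hP : ∀ v, P v → v ∈ U ∧ B v v ≠ 0)
    (hΦ : ∀ v W, P v → W ≤ U → B.NondegOn W → v ∈ W → (G W ∧ R v W ↔ Φ v (perpIn B W v)))
    (a l : ℕ)
    (h1 : ∀ v, P v →
      Nat.card {W : Submodule K V // W ≤ perpIn B U v ∧ B.NondegOn W ∧ Φ v W} = a)
    (h2 : ∀ W, W ≤ U → B.NondegOn W → G W → Nat.card {v // P v ∧ v ∈ W ∧ R v W} = l) :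
    Nat.card {v // P v} * a =
      Nat.card {W : Submodule K V // W ≤ U ∧ B.NondegOn W ∧ G W} * l := by
  have : Finite (Submodule K V) := Finite.of_injective _ SetLike.coe_injective
  refine card_mul_eq_card_mul_of_relation P _ (fun v W => v ∈ W ∧ R v W) a l (fun v hv => ?_)
    fun W hW => h2 W hW.1 hW.2.1 hW.2.2
  rw [← h1 v hv, ← card_subspaces_through hB (hP v hv).1 (hP v hv).2]
  refine Nat.card_congr (Equiv.subtypeEquivRight fun W => ?_)
  constructor
  · rintro ⟨⟨hW, hn, hG⟩, hvW, hR⟩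
    exact ⟨⟨hW, hn, (hΦ v W hv hW hn hvW).1 ⟨hG, hR⟩⟩, hvW⟩
  · rintro ⟨⟨hW, hn, h⟩, hvW⟩
    have := (hΦ v W hv hW hn hvW).2 h
    exact ⟨⟨hW, hn, this.1⟩, hvW, this.2⟩

end AnisotropicVectors

/-! ### Symmetric bilinear spaces over `𝔽₂` -/

section BinaryForms

open LinearMap (BilinForm)

variable {V : Type*} [AddCommGroup V] [Module (ZMod 2) V]

/-- The restriction of `B` to `U` is alternating. -/
def LinearMap.BilinForm.AltOn (B : BilinForm (ZMod 2) V) (U : Submodule (ZMod 2) V) : Prop :=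
  ∀ x ∈ U, B x x = 0

theorem zmod_two_eq_one {a : ZMod 2} (h : a ≠ 0) : a = 1 := by
  revert a; decide

theorem zmod_two_mul_self : ∀ a : ZMod 2, a * a = a := by decide

variable {B : BilinForm (ZMod 2) V} {U W : Submodule (ZMod 2) V}

theorem exists_of_not_altOn (h : ¬ B.AltOn U) : ∃ v ∈ U, B v v = 1 := by
  simp only [LinearMap.BilinForm.AltOn, not_forall] at h
  obtain ⟨v, hv, hvv⟩ := h
  exact ⟨v, hv, zmod_two_eq_one hvv⟩

theorem not_altOn_of_mem {v : V} (hv : v ∈ U) (hvv : B v v = 1) : ¬ B.AltOn U := fun h => by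
  rw [h v hv] at hvv
  exact zero_ne_one hvv

variable [Finite V] (hB : B.IsSymm)
include hB

/-- A nonzero x has a partner y with B(x, y) = 1, and the hyperbolic plane they span splits off;
induction applies to its complement. -/
theorem even_finrank_of_altOn (hU : B.NondegOn U) (hA : B.AltOn U) :
    Even (Module.finrank (ZMod 2) U) := by
  induction h : Module.finrank (ZMod 2) U using Nat.strong_induction_on generalizing U with
  | _ m ih =>
  rcases eq_or_ne U ⊥ with rfl | hne
  · rw [← h, finrank_bot]; exact Even.zero
  obtain ⟨x, hx, hx0⟩ := (Submodule.ne_bot_iff U).1 hne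
  obtain ⟨y, hy, hxy⟩ : ∃ y ∈ U, B x y = 1 := by
    by_contra hc
    refine hx0 (hU x hx fun y hy => ?_)
    by_contra h0
    exact hc ⟨y, hy, zmod_two_eq_one h0⟩
  have hyx : B y x = 1 := (hB.eq y x).trans hxy
  have hxx := hA x hx
  have hyy := hA y hy
  set P : Submodule (ZMod 2) V := Submodule.span (ZMod 2) {x, y} with hPdef
  have hPU : P ≤ U := Submodule.span_le.2 (by
    rintro z (rfl | rfl)
    · exact hx
    · exact hy)
  have hxP : x ∈ P := Submodule.subset_span (by simp)
  have hyP : y ∈ P := Submodule.subset_span (by simp)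
  have hP : B.NondegOn P := by
    intro z hz h
    obtain ⟨a, b, rfl⟩ := Submodule.mem_span_pair.1 hz
    have h1 := h x hxP
    have h2 := h y hyP
    simp only [map_add, map_smul, LinearMap.add_apply, LinearMap.smul_apply, smul_eq_mul, hxx,
      hyy, hxy, hyx, mul_one, mul_zero, add_zero, zero_add] at h1 h2
    rw [h1, h2]; simp
  have hfr : Module.finrank (ZMod 2) P = 2 := by
    have hli : LinearIndependent (ZMod 2) ![x, y] := by
      rw [LinearIndependent.pair_iff]
      intro a b hab
      have h1 : B x (a • x + b • y) = 0 := by rw [hab, map_zero]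
      have h2 : B y (a • x + b • y) = 0 := by rw [hab, map_zero]
      simp only [map_add, map_smul, smul_eq_mul, hxx,
        hyy, hxy, hyx, mul_one, mul_zero, add_zero, zero_add] at h1 h2
      exact ⟨h2, h1⟩
    have := finrank_span_eq_card hli
    rwa [Matrix.range_cons, Matrix.range_cons, Matrix.range_empty, Set.union_empty,
      Set.singleton_union, Fintype.card_fin] at this
  have hadd := hP.finrank_add hB hPU
  rw [hfr] at hadd
  have := ih _ (by omega) (hU.inf_orthogonal hB hP hPU) (fun z hz => hA z hz.1) rfl
  rw [← h, ← hadd]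
  exact even_two.add this

/-- The characteristic vector of a nondegenerate subspace. -/
theorem exists_characteristic (hU : B.NondegOn U) :
    ∃ w ∈ U, (∀ x ∈ U, B w x = B x x) ∧ B w w = (Module.finrank (ZMod 2) U : ZMod 2) := by
  induction h : Module.finrank (ZMod 2) U generalizing U with
  | zero =>
    refine ⟨0, U.zero_mem, fun x hx => ?_, by simp⟩
    rw [Submodule.finrank_eq_zero.1 h] at hx
    rw [(Submodule.mem_bot _).1 hx]
  | succ m ih =>
    by_cases hA : B.AltOn U
    · refine ⟨0, U.zero_mem, fun x hx => by simp [hA x hx], ?_⟩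
      have := even_finrank_of_altOn hB hU hA
      rw [h] at this
      rw [(ZMod.natCast_eq_zero_iff _ 2).2 this.two_dvd]
      simp
    obtain ⟨v, hv, hvv⟩ := exists_of_not_altOn hA
    have hv0 : B v v ≠ 0 := by rw [hvv]; exact one_ne_zero
    have hf := finrank_perpIn hB hv hv0
    obtain ⟨w, hw, hwx, hww⟩ := ih (nondegOn_perpIn hB hU hv hv0) (by omega)
    have hvw : B v w = 0 := mem_orthogonal_span_singleton.1 hw.2
    have hwv : B w v = 0 := (hB.eq w v).trans hvw
    -- Characteristic vectors add over orthogonal sums. On the line of v the vector v is itself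
    -- characteristic, since a² = a in 𝔽₂.
    refine ⟨v + w, U.add_mem hv hw.1, fun x hx => ?_, ?_⟩
    · rw [← span_sup_perpIn hB hv hv0] at hx
      obtain ⟨z, hz, y, hy, rfl⟩ := Submodule.mem_sup.1 hx
      obtain ⟨a, rfl⟩ := Submodule.mem_span_singleton.1 hz
      have hvy : B v y = 0 := mem_orthogonal_span_singleton.1 hy.2
      have hyv : B y v = 0 := (hB.eq y v).trans hvy
      have haa := zmod_two_mul_self a
      simp only [map_add, map_smul, LinearMap.add_apply, LinearMap.smul_apply, smul_eq_mul,
        hvv, hvy, hyv, hwv, hwx y hy, mul_one, mul_zero, add_zero, zero_add, haa]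
    · simp only [map_add, LinearMap.add_apply, hvv, hvw, hwv, hww]
      push_cast
      ring

/-- In characteristic two x ↦ B(x, x) is additive. It is nonzero on U, so it takes the value 1 on
exactly half of U; translation by a vector of norm 1 exchanges the halves. -/
theorem card_odd_vectors (hA : ¬ B.AltOn U) :
    2 * Nat.card {v // v ∈ U ∧ B v v = 1} = 2 ^ Module.finrank (ZMod 2) U := by
  obtain ⟨w, hw, hww⟩ := exists_of_not_altOn hA
  have key : ∀ x, B (x + w) (x + w) = B x x + 1 := fun x => by
    have h : B w x = B x w := hB.eq w x
    have h2 : B x w + B x w = 0 := CharTwo.add_self_eq_zero _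
    simp only [map_add, LinearMap.add_apply, hww, h]
    linear_combination h2
  have e : {v // v ∈ U ∧ B v v = 0} ≃ {v // v ∈ U ∧ B v v = 1} :=
    { toFun := fun x => ⟨x.1 + w, U.add_mem x.2.1 hw, by rw [key, x.2.2, zero_add]⟩
      invFun := fun x => ⟨x.1 + w, U.add_mem x.2.1 hw, by rw [key, x.2.2]; rfl⟩
      left_inv := fun x => Subtype.ext (by
        show x.1 + w + w = x.1
        rw [add_assoc, ← two_smul (ZMod 2) w, show (2 : ZMod 2) = 0 from rfl, zero_smul, add_zero])
      right_inv := fun x => Subtype.ext (by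
        show x.1 + w + w = x.1
        rw [add_assoc, ← two_smul (ZMod 2) w, show (2 : ZMod 2) = 0 from rfl, zero_smul,
          add_zero]) }
  have hU : Nat.card U = 2 ^ Module.finrank (ZMod 2) U := by
    rw [Module.natCard_eq_pow_finrank (K := ZMod 2), Nat.card_zmod]
  classical
  have e2 : U ≃ {v // v ∈ U ∧ B v v = 0} ⊕ {v // v ∈ U ∧ B v v = 1} :=
    { toFun := fun x => if h : B x.1 x.1 = 0 then Sum.inl ⟨x.1, x.2, h⟩
        else Sum.inr ⟨x.1, x.2, zmod_two_eq_one h⟩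
      invFun := Sum.elim (fun x => ⟨x.1, x.2.1⟩) (fun x => ⟨x.1, x.2.1⟩)
      left_inv := fun x => by by_cases h : B x.1 x.1 = 0 <;> simp [h]
      right_inv := by rintro (x | x) <;> simp [x.2.2] }
  rw [← hU, Nat.card_congr e2, Nat.card_sum, Nat.card_congr e, two_mul]

/-- The complement of `v` is alternating for `v` the characteristic vector only. -/
theorem altOn_perpIn_iff (hU : B.NondegOn U) {v w : V} (hv : v ∈ U) (hvv : B v v = 1)
    (hw : w ∈ U) (hwx : ∀ x ∈ U, B w x = B x x) : B.AltOn (perpIn B U v) ↔ v = w := by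
  have hv0 : B v v ≠ 0 := by rw [hvv]; exact one_ne_zero
  constructor
  · intro h
    rw [← sub_eq_zero]
    refine hU _ (U.sub_mem hv hw) fun x hx => ?_
    rw [map_sub, LinearMap.sub_apply, hwx x hx, sub_eq_zero]
    rw [← span_sup_perpIn hB hv hv0] at hx
    obtain ⟨z, hz, y, hy, rfl⟩ := Submodule.mem_sup.1 hx
    obtain ⟨a, rfl⟩ := Submodule.mem_span_singleton.1 hz
    have hvy : B v y = 0 := mem_orthogonal_span_singleton.1 hy.2
    have hyv : B y v = 0 := (hB.eq y v).trans hvy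
    have haa := zmod_two_mul_self a
    simp only [map_add, map_smul, LinearMap.add_apply, LinearMap.smul_apply, smul_eq_mul,
      hvv, hvy, hyv, h y hy, mul_one, mul_zero, add_zero, haa]
  · rintro rfl x hx
    rw [← hwx x hx.1]
    exact mem_orthogonal_span_singleton.1 hx.2

/-- Only the characteristic vector can have alternating complement, and its norm is the dimension
modulo 2. In even dimension such a v would leave an alternating nondegenerate space of odd
dimension. -/
theorem card_odd_vectors_altOn (hU : B.NondegOn U) :
    Nat.card {v // v ∈ U ∧ B v v = 1 ∧ B.AltOn (perpIn B U v)} =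
      if Odd (Module.finrank (ZMod 2) U) then 1 else 0 := by
  split_ifs with h
  · obtain ⟨w, hw, hwx, hww⟩ := exists_characteristic hB hU
    rw [(ZMod.natCast_eq_one_iff_odd).2 h] at hww
    rw [Nat.card_eq_one_iff_exists]
    refine ⟨⟨w, hw, hww, (altOn_perpIn_iff hB hU hw hww hw hwx).2 rfl⟩, fun v => ?_⟩
    exact Subtype.ext ((altOn_perpIn_iff hB hU v.2.1 v.2.2.1 hw hwx).1 v.2.2.2)
  · rw [Nat.card_eq_zero]
    refine Or.inl ⟨fun v => ?_⟩
    have hv0 : B v.1 v.1 ≠ 0 := by rw [v.2.2.1]; exact one_ne_zero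
    have h1 := even_finrank_of_altOn hB (nondegOn_perpIn hB hU v.2.1 hv0) v.2.2.2
    have h2 := finrank_perpIn hB v.2.1 hv0
    rw [← h2] at h
    exact h h1.add_one

theorem card_odd_vectors_not_altOn (hU : B.NondegOn U) (hA : ¬ B.AltOn U) {m : ℕ}
    (hm : Module.finrank (ZMod 2) U = m + 1) :
    Nat.card {v // v ∈ U ∧ B v v = 1 ∧ ¬ B.AltOn (perpIn B U v)} +
      (if Odd (m + 1) then 1 else 0) = 2 ^ m := by
  have h1 := card_odd_vectors hB hA
  have h2 := card_odd_vectors_altOn hB hU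
  rw [hm] at h1 h2
  rw [pow_succ', Nat.mul_right_inj two_ne_zero] at h1
  rw [← h1, ← h2]
  classical
  have e : {v // v ∈ U ∧ B v v = 1} ≃ {v // v ∈ U ∧ B v v = 1 ∧ ¬ B.AltOn (perpIn B U v)} ⊕
      {v // v ∈ U ∧ B v v = 1 ∧ B.AltOn (perpIn B U v)} :=
    { toFun := fun x => if h : B.AltOn (perpIn B U x.1) then Sum.inr ⟨x.1, x.2.1, x.2.2, h⟩
        else Sum.inl ⟨x.1, x.2.1, x.2.2, h⟩
      invFun := Sum.elim (fun x => ⟨x.1, x.2.1, x.2.2.1⟩) (fun x => ⟨x.1, x.2.1, x.2.2.1⟩)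
      left_inv := fun x => by by_cases h : B.AltOn (perpIn B U x.1) <;> simp [h]
      right_inv := by rintro (x | x) <;> simp [x.2.2.2] }
  rw [Nat.card_congr e, Nat.card_sum]

omit hB [Finite V] [AddCommGroup V] [Module (ZMod 2) V] in
-- Orbit-stabiliser in numerical form: x counts the vectors of norm 1 whose complement is not
-- alternating. The case j = 0 must be excluded, because there the complement is zero, hence
-- alternating, and x = 0.
theorem dotOrderTwo_succ {x j : ℕ} (hj : j ≠ 0)
    (hx : x + (if Odd (j + 1) then 1 else 0) = 2 ^ j) :
    dotOrderTwo (j + 1) = x * dotOrderTwo j := by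
  obtain ⟨a, rfl | rfl⟩ := Nat.even_or_odd' j
  · obtain ⟨a, rfl⟩ := Nat.exists_eq_succ_of_ne_zero (show a ≠ 0 by omega)
    rw [if_pos ⟨a + 1, rfl⟩] at hx
    have hx' : (x : ℚ) = 4 ^ (a + 1) - 1 := by
      have : ((x + 1 : ℕ) : ℚ) = ((2 ^ (2 * (a + 1)) : ℕ) : ℚ) := by rw [← hx]
      push_cast at this
      rw [pow_mul] at this
      linear_combination this
    rw [show a.succ = a + 1 from rfl, dotOrderTwo_odd, symplecticOrderTwo_succ, hx',
      show 2 * (a + 1) = 2 * a + 2 by ring, dotOrderTwo_even]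
    ring
  · rw [if_neg (by rw [Nat.not_odd_iff]; omega), add_zero] at hx
    rw [dotOrderTwo_odd, dotOrderTwo_even, hx]
    push_cast
    ring

/-- Number of non-alternating nondegenerate subspaces of dimension `s + 1` whose complement
satisfies `Ψ`, given the case of dimension one. -/
theorem card_nonalternating (Ψ : Submodule (ZMod 2) V → Prop) (j : ℕ) (f : ℚ)
    (hbase : ∀ U : Submodule (ZMod 2) V, Module.finrank (ZMod 2) U = j + 1 → B.NondegOn U →
      ¬ B.AltOn U → Nat.card {v // v ∈ U ∧ B v v = 1 ∧ Ψ (perpIn B U v)} * f =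
        dotOrderTwo (j + 1)) (s : ℕ) (hm : Module.finrank (ZMod 2) U = s + 1 + j)
    (hU : B.NondegOn U) (hA : ¬ B.AltOn U) :
    Nat.card {W : Submodule (ZMod 2) V // W ≤ U ∧ B.NondegOn W ∧ ¬ B.AltOn W ∧
      Module.finrank (ZMod 2) W = s + 1 ∧ Ψ (U ⊓ B.orthogonal W)} * dotOrderTwo (s + 1) * f =
      dotOrderTwo (s + 1 + j) := by
  have h10 : ∀ {v : V}, B v v = 1 → B v v ≠ 0 := fun h => by rw [h]; exact one_ne_zero
  induction s generalizing U with
  | zero =>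
    -- In dimension one W is the line of its unique vector of norm 1, so the double count has
    -- multiplicity one on both sides.
    have h := card_anisotropic_mul (U := U) hB (fun v => v ∈ U ∧ B v v = 1 ∧ Ψ (perpIn B U v))
      (fun W => ¬ B.AltOn W ∧ Module.finrank (ZMod 2) W = 0 + 1 ∧ Ψ (U ⊓ B.orthogonal W))
      (fun _ _ => True) (fun _ W => Module.finrank (ZMod 2) W = 0)
      (fun v hv => ⟨hv.1, h10 hv.2.1⟩) (fun v W hv hWU hW hvW => ?_) 1 1 (fun v hv => ?_)
      (fun W hWU hW hG => ?_)
    · rw [mul_one, mul_one] at h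
      rw [← h, show (0 + 1 : ℕ) = 2 * 0 + 1 by rfl, dotOrderTwo_odd, symplecticOrderTwo,
        show 2 * 0 + 1 + j = j + 1 by ring, ← hbase U (by omega) hU hA]
      simp [gaussFactorial]
    · have h1 := finrank_perpIn hB hvW (h10 hv.2.1)
      constructor
      · rintro ⟨⟨-, h2, -⟩, -⟩
        omega
      · intro h2
        refine ⟨⟨not_altOn_of_mem hvW hv.2.1, by omega, ?_⟩, trivial⟩
        rw [inf_orthogonal_eq_perpIn hB (h10 hv.2.1) hvW, Submodule.finrank_eq_zero.1 h2,
          LinearMap.BilinForm.orthogonal_bot, inf_top_eq]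
        exact hv.2.2
    · rw [Nat.card_eq_one_iff_exists]
      exact ⟨⟨⊥, bot_le, nondegOn_bot, finrank_bot _ _⟩, fun W =>
        Subtype.ext (Submodule.finrank_eq_zero.1 W.2.2.2)⟩
    · have h1 := card_odd_vectors hB hG.1
      rw [hG.2.1] at h1
      rw [← Nat.mul_right_inj two_ne_zero, mul_one]
      refine Eq.trans ?_ (h1.trans (by norm_num))
      congr 1
      refine Nat.card_congr (Equiv.subtypeEquivRight fun v => ⟨fun h => ⟨h.2.1, h.1.2.1⟩,
        fun h => ⟨⟨hWU h.1, h.2, ?_⟩, h.1, trivial⟩⟩)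
      have h2 := finrank_perpIn hB h.1 (h10 h.2)
      have h3 := inf_orthogonal_eq_perpIn (U := U) hB (h10 h.2) h.1
      rw [Submodule.finrank_eq_zero.1 (show Module.finrank (ZMod 2) (perpIn B W v) = 0 by omega),
        LinearMap.BilinForm.orthogonal_bot, inf_top_eq] at h3
      rw [← h3]
      exact hG.2.2
  | succ s ih =>
    have hx := card_odd_vectors_not_altOn hB hU hA (m := s + 1 + j) (by omega)
    -- This l is the number of vectors of norm 1 in W whose complement within W is not alternating.
    -- Restricting the count to such pairs keeps the smaller subspace, and the smaller ambient space
    -- containing it, non-alternating.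
    obtain ⟨l, hl⟩ : ∃ l, l + (if Odd (s + 1 + 1) then 1 else 0) = 2 ^ (s + 1) := by
      refine ⟨2 ^ (s + 1) - (if Odd (s + 1 + 1) then 1 else 0), Nat.sub_add_cancel ?_⟩
      have := Nat.one_le_two_pow (n := s + 1)
      split_ifs <;> omega
    obtain ⟨v₀, hv₀⟩ : ∃ v, v ∈ U ∧ B v v = 1 ∧ ¬ B.AltOn (perpIn B U v) := by
      by_contra hc
      have : Nat.card {v // v ∈ U ∧ B v v = 1 ∧ ¬ B.AltOn (perpIn B U v)} = 0 :=
        Nat.card_eq_zero.2 (Or.inl ⟨fun v => hc ⟨v.1, v.2⟩⟩)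
      rw [this] at hx
      have : 2 ≤ 2 ^ (s + 1 + j) := Nat.le_self_pow (by omega) 2
      split_ifs at hx <;> omega
    -- If f were zero, the induction hypothesis at v₀ would equate zero with a positive order.
    have hf : f ≠ 0 := by
      rintro rfl
      have h2 := finrank_perpIn hB hv₀.1 (h10 hv₀.2.1)
      have h3 := ih (by omega) (nondegOn_perpIn hB hU hv₀.1 (h10 hv₀.2.1)) hv₀.2.2
      rw [mul_zero] at h3
      exact (dotOrderTwo_pos (s + 1 + j)).ne h3
    have hd := (dotOrderTwo_pos (s + 1)).ne'
    have hIH : ∀ v, (v ∈ U ∧ B v v = 1 ∧ ¬ B.AltOn (perpIn B U v)) →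
        (Nat.card {W : Submodule (ZMod 2) V // W ≤ perpIn B U v ∧ B.NondegOn W ∧ ¬ B.AltOn W ∧
          Module.finrank (ZMod 2) W = s + 1 ∧ Ψ (perpIn B U v ⊓ B.orthogonal W)} : ℚ) =
          dotOrderTwo (s + 1 + j) / (dotOrderTwo (s + 1) * f) := fun v hv => by
      have h2 := finrank_perpIn hB hv.1 (h10 hv.2.1)
      rw [eq_div_iff (mul_ne_zero hd hf), ← mul_assoc]
      exact ih (by omega) (nondegOn_perpIn hB hU hv.1 (h10 hv.2.1)) hv.2.2
    have h := card_anisotropic_mul (U := U) hB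
      (fun v => v ∈ U ∧ B v v = 1 ∧ ¬ B.AltOn (perpIn B U v))
      (fun W => ¬ B.AltOn W ∧ Module.finrank (ZMod 2) W = s + 1 + 1 ∧ Ψ (U ⊓ B.orthogonal W))
      (fun v W => ¬ B.AltOn (perpIn B W v))
      (fun v W => ¬ B.AltOn W ∧ Module.finrank (ZMod 2) W = s + 1 ∧
        Ψ (perpIn B U v ⊓ B.orthogonal W))
      (fun v hv => ⟨hv.1, h10 hv.2.1⟩) (fun v W hv hWU hW hvW => ?_) _ l
      (fun v hv => Nat.cast_injective (R := ℚ) ((hIH v hv).trans (hIH v₀ hv₀).symm))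
      (fun W hWU hW hG => ?_)
    · rw [show s + 1 + 1 + j = s + 1 + j + 1 by ring,
        dotOrderTwo_succ (by omega) hx, dotOrderTwo_succ (by omega) hl]
      have h' := congrArg (Nat.cast (R := ℚ)) h
      rw [Nat.cast_mul, Nat.cast_mul, hIH v₀ hv₀] at h'
      rw [← mul_assoc _ (l : ℚ), ← h']
      field_simp
    · have h1 := finrank_perpIn hB hvW (h10 hv.2.1)
      rw [inf_orthogonal_eq_perpIn hB (h10 hv.2.1) hvW]
      constructor
      · rintro ⟨⟨-, h2, h3⟩, h4⟩
        exact ⟨h4, by omega, h3⟩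
      · rintro ⟨h4, h2, h3⟩
        exact ⟨⟨not_altOn_of_mem hvW hv.2.1, by omega, h3⟩, h4⟩
    · have h1 := card_odd_vectors_not_altOn hB hW hG.1 hG.2.1
      rw [← hl, Nat.add_right_cancel_iff] at h1
      rw [← h1]
      exact Nat.card_congr (Equiv.subtypeEquivRight fun v => ⟨fun h => ⟨h.2.1, h.1.2.1, h.2.2⟩,
        fun h => ⟨⟨hWU h.1, h.2.1, fun hc => h.2.2 fun x hx => hc x ⟨hWU hx.1, hx.2⟩⟩,
          h.1, h.2.2⟩⟩)

theorem card_nonalternating_nonalternating (s j : ℕ)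
    (hm : Module.finrank (ZMod 2) U = s + 1 + (j + 1)) (hU : B.NondegOn U) (hA : ¬ B.AltOn U) :
    Nat.card {W : Submodule (ZMod 2) V // W ≤ U ∧ B.NondegOn W ∧ ¬ B.AltOn W ∧
      Module.finrank (ZMod 2) W = s + 1 ∧ ¬ B.AltOn (U ⊓ B.orthogonal W)} *
        dotOrderTwo (s + 1) * dotOrderTwo (j + 1) = dotOrderTwo (s + 1 + (j + 1)) :=
  card_nonalternating hB (fun X => ¬ B.AltOn X) (j + 1) _ (fun U hf hU hA =>
    (dotOrderTwo_succ (by omega) (card_odd_vectors_not_altOn hB hU hA hf)).symm) s hm hU hA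

/-- In dimension 2b + 1 exactly one vector of norm 1 has alternating complement, and the order there
is that of the symplectic group of rank b; this is the one-dimensional case required by the general
count. -/
theorem card_nonalternating_alternating (s b : ℕ)
    (hm : Module.finrank (ZMod 2) U = s + 1 + 2 * b) (hU : B.NondegOn U) (hA : ¬ B.AltOn U) :
    Nat.card {W : Submodule (ZMod 2) V // W ≤ U ∧ B.NondegOn W ∧ ¬ B.AltOn W ∧
      Module.finrank (ZMod 2) W = s + 1 ∧ B.AltOn (U ⊓ B.orthogonal W)} *
        dotOrderTwo (s + 1) * symplecticOrderTwo b = dotOrderTwo (s + 1 + 2 * b) :=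
  card_nonalternating hB (fun X => B.AltOn X) (2 * b) _ (fun U hf hU hA => by
    rw [card_odd_vectors_altOn hB hU, hf, if_pos ⟨b, rfl⟩, dotOrderTwo_odd, Nat.cast_one,
      one_mul]) s hm hU hA

end BinaryForms


/-! ### The dot product and the binary count -/

section DotProduct

open LinearMap (BilinForm)

/-- The dot product as a bilinear form. -/
def dotForm (p n : ℕ) : BilinForm (ZMod p) (Fin n → ZMod p) :=
  dotProductBilin (ZMod p) (ZMod p)

theorem dotForm_apply {p n : ℕ} (x y : Fin n → ZMod p) : dotForm p n x y = x ⬝ᵥ y := rfl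

theorem dotForm_isSymm (p n : ℕ) : (dotForm p n).IsSymm :=
  ⟨fun x y => dotProduct_comm x y⟩

variable (p n : ℕ) [Fact p.Prime]

theorem dotForm_nondegOn_top : (dotForm p n).NondegOn ⊤ := fun x _ h =>
  dotProduct_eq_zero x fun y => h y trivial

theorem numLCD_eq_card (s : ℕ) : numLCD p n s =
    Nat.card {W : Submodule (ZMod p) (Fin n → ZMod p) //
      (dotForm p n).NondegOn W ∧ Module.finrank (ZMod p) W = s} :=
  Nat.card_congr (Equiv.subtypeEquivRight fun W => by
    rw [isEuclideanLCD_iff, and_comm]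
    rfl)

theorem numLCD_zero : numLCD p n 0 = 1 := by
  rw [numLCD_eq_card, Nat.card_eq_one_iff_exists]
  exact ⟨⟨⊥, nondegOn_bot, finrank_bot _ _⟩, fun W =>
    Subtype.ext (Submodule.finrank_eq_zero.1 W.2.2)⟩

theorem numLCD_self : numLCD p n n = 1 := by
  rw [numLCD_eq_card, Nat.card_eq_one_iff_exists]
  refine ⟨⟨⊤, dotForm_nondegOn_top p n, by rw [finrank_top, Module.finrank_fin_fun]⟩, fun W =>
    Subtype.ext (Submodule.eq_top_of_finrank_eq ?_)⟩
  rw [W.2.2, Module.finrank_fin_fun]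

end DotProduct

/-! ### Types of nondegenerate subspaces of 𝔽₂^n -/

section BinaryCount

theorem not_altOn_top {n : ℕ} (hn : n ≠ 0) : ¬ (dotForm 2 n).AltOn ⊤ := fun h => by
  have := h (Pi.single ⟨0, Nat.pos_of_ne_zero hn⟩ 1) trivial
  rw [dotForm_apply, single_dotProduct, Pi.single_eq_same] at this
  exact absurd this (by decide)

/-- The number of nondegenerate subspaces of `𝔽₂^n` that are not alternating and whose
complement is alternating. -/
noncomputable def numMixed (n s : ℕ) : ℕ :=
  Nat.card {W : Submodule (ZMod 2) (Fin n → ZMod 2) // W ≤ ⊤ ∧ (dotForm 2 n).NondegOn W ∧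
    ¬ (dotForm 2 n).AltOn W ∧ Module.finrank (ZMod 2) W = s ∧
      (dotForm 2 n).AltOn (⊤ ⊓ (dotForm 2 n).orthogonal W)}

/-- The number of nondegenerate subspaces of `𝔽₂^n` that are not alternating and whose
complement is not alternating. -/
noncomputable def numPlain (n s : ℕ) : ℕ :=
  Nat.card {W : Submodule (ZMod 2) (Fin n → ZMod 2) // W ≤ ⊤ ∧ (dotForm 2 n).NondegOn W ∧
    ¬ (dotForm 2 n).AltOn W ∧ Module.finrank (ZMod 2) W = s ∧
      ¬ (dotForm 2 n).AltOn (⊤ ⊓ (dotForm 2 n).orthogonal W)}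

theorem numPlain_eq (s j : ℕ) : (numPlain (s + 1 + (j + 1)) (s + 1) : ℚ) =
    dotOrderTwo (s + 1 + (j + 1)) / (dotOrderTwo (s + 1) * dotOrderTwo (j + 1)) := by
  rw [eq_div_iff (mul_pos (dotOrderTwo_pos _) (dotOrderTwo_pos _)).ne', ← mul_assoc]
  exact card_nonalternating_nonalternating (dotForm_isSymm 2 _) s j
    (by rw [finrank_top, Module.finrank_fin_fun]) (dotForm_nondegOn_top 2 _)
    (not_altOn_top (by omega))

theorem numMixed_eq (s b : ℕ) : (numMixed (s + 1 + 2 * b) (s + 1) : ℚ) =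
    dotOrderTwo (s + 1 + 2 * b) / (dotOrderTwo (s + 1) * symplecticOrderTwo b) := by
  rw [eq_div_iff (mul_pos (dotOrderTwo_pos _) (symplecticOrderTwo_pos _)).ne', ← mul_assoc]
  exact card_nonalternating_alternating (dotForm_isSymm 2 _) s b
    (by rw [finrank_top, Module.finrank_fin_fun]) (dotForm_nondegOn_top 2 _)
    (not_altOn_top (by omega))

theorem finrank_complement {p n : ℕ} [Fact p.Prime] {W : Submodule (ZMod p) (Fin n → ZMod p)}
    (hW : (dotForm p n).NondegOn W) : Module.finrank (ZMod p) W +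
      Module.finrank (ZMod p) (⊤ ⊓ (dotForm p n).orthogonal W :
        Submodule (ZMod p) (Fin n → ZMod p)) = n := by
  rw [hW.finrank_add (dotForm_isSymm p n) le_top, finrank_top, Module.finrank_fin_fun]

theorem numMixed_odd (s j : ℕ) (hj : Odd j) : numMixed (s + j) s = 0 := by
  refine Nat.card_eq_zero.2 (Or.inl ⟨fun W => ?_⟩)
  have hB := dotForm_isSymm 2 (s + j)
  have h1 := even_finrank_of_altOn hB
    ((dotForm_nondegOn_top 2 (s + j)).inf_orthogonal hB W.2.2.1 le_top) W.2.2.2.2.2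
  have h2 := finrank_complement W.2.2.1
  rw [W.2.2.2.2.1] at h2
  rw [show Module.finrank (ZMod 2) _ = j by omega] at h1
  exact Nat.not_odd_iff_even.2 h1 hj

/-- A subspace and its complement cannot both be alternating, since then the dot product on the
whole space would be. Alternating subspaces of dimension s are counted through their complements,
which are non-alternating of dimension j with alternating complement. -/
theorem numLCD_two_eq (s j : ℕ) (hs : s ≠ 0) :
    numLCD 2 (s + j) s = numPlain (s + j) s + numMixed (s + j) s + numMixed (j + s) j := by
  have hB := dotForm_isSymm 2 (s + j)
  have hT := dotForm_nondegOn_top 2 (s + j)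
  have h0 : numMixed (j + s) j = Nat.card {W : Submodule (ZMod 2) (Fin (s + j) → ZMod 2) //
      (dotForm 2 (s + j)).NondegOn W ∧ Module.finrank (ZMod 2) W = s ∧
        (dotForm 2 (s + j)).AltOn W ∧
        ¬ (dotForm 2 (s + j)).AltOn (⊤ ⊓ (dotForm 2 (s + j)).orthogonal W)} := by
    rw [add_comm j s]
    refine Nat.card_congr
      { toFun := fun W => ⟨⊤ ⊓ (dotForm 2 (s + j)).orthogonal W.1, ?_⟩
        invFun := fun W => ⟨⊤ ⊓ (dotForm 2 (s + j)).orthogonal W.1, ?_⟩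
        left_inv := fun W => Subtype.ext (hT.inf_orthogonal_inf_orthogonal hB W.2.2.1 le_top)
        right_inv := fun W => Subtype.ext (hT.inf_orthogonal_inf_orthogonal hB W.2.1 le_top) }
    · have h2 := finrank_complement W.2.2.1
      have h3 := W.2.2.2.2.1
      refine ⟨hT.inf_orthogonal hB W.2.2.1 le_top, by omega, W.2.2.2.2.2, ?_⟩
      rw [hT.inf_orthogonal_inf_orthogonal hB W.2.2.1 le_top]
      exact W.2.2.2.1
    · have h2 := finrank_complement W.2.1
      have h3 := W.2.2.1
      refine ⟨le_top, hT.inf_orthogonal hB W.2.1 le_top, W.2.2.2.2, by omega, ?_⟩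
      rw [hT.inf_orthogonal_inf_orthogonal hB W.2.1 le_top]
      exact W.2.2.2.1
  have hnot : ∀ W : Submodule (ZMod 2) (Fin (s + j) → ZMod 2), (dotForm 2 (s + j)).NondegOn W →
      (dotForm 2 (s + j)).AltOn W →
        ¬ (dotForm 2 (s + j)).AltOn (⊤ ⊓ (dotForm 2 (s + j)).orthogonal W) := by
    intro W hW h1 h2
    refine not_altOn_top (show s + j ≠ 0 by omega) fun x hx => ?_
    obtain ⟨w, hw, y, hy, rfl⟩ := hW.exists_add hB le_top hx
    have h3 : dotForm 2 (s + j) w y = 0 := hy.2 w hw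
    have h4 : dotForm 2 (s + j) y w = 0 := (hB.eq y w).trans h3
    simp only [map_add, LinearMap.add_apply, h1 w hw, h2 y hy, h3, h4, add_zero]
  classical
  rw [h0, numLCD_eq_card, numPlain, numMixed, ← Nat.card_sum, ← Nat.card_sum]
  refine Nat.card_congr
    { toFun := fun W => if h : (dotForm 2 (s + j)).AltOn W.1 then
          Sum.inr ⟨W.1, W.2.1, W.2.2, h, hnot _ W.2.1 h⟩
        else if h' : (dotForm 2 (s + j)).AltOn (⊤ ⊓ (dotForm 2 (s + j)).orthogonal W.1) then
          Sum.inl (Sum.inr ⟨W.1, le_top, W.2.1, h, W.2.2, h'⟩)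
        else Sum.inl (Sum.inl ⟨W.1, le_top, W.2.1, h, W.2.2, h'⟩)
      invFun := Sum.elim (Sum.elim (fun W => ⟨W.1, W.2.2.1, W.2.2.2.2.1⟩)
        (fun W => ⟨W.1, W.2.2.1, W.2.2.2.2.1⟩)) (fun W => ⟨W.1, W.2.1, W.2.2.1⟩)
      left_inv := fun W => ?_
      right_inv := ?_ }
  · dsimp only
    split_ifs <;> rfl
  · rintro ((W | W) | W)
    · exact (dif_neg W.2.2.2.1).trans (dif_neg W.2.2.2.2.2)
    · exact (dif_neg W.2.2.2.1).trans (dif_pos W.2.2.2.2.2)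
    · exact dif_pos W.2.2.2.1

theorem numLCD_two (s j : ℕ) :
    (numLCD 2 (s + 1 + (j + 1)) (s + 1) : ℚ) = lcdFormulaTwo (s + 1 + (j + 1)) (s + 1) := by
  rw [numLCD_two_eq _ _ (show s + 1 ≠ 0 by omega), Nat.cast_add, Nat.cast_add, numPlain_eq]
  rcases Nat.even_or_odd' s with ⟨b, rfl | rfl⟩ <;> rcases Nat.even_or_odd' j with ⟨c, rfl | rfl⟩
  · rw [numMixed_odd _ _ ⟨c, rfl⟩, numMixed_odd _ _ ⟨b, rfl⟩, lcdFormulaTwo_even_odd]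
    simp
  · rw [numMixed_odd (2 * c + 1 + 1) _ ⟨b, rfl⟩, show 2 * c + 1 + 1 = 2 * (c + 1) by ring,
      numMixed_eq, show 2 * (c + 1) = 2 * c + 2 by ring, lcdFormulaTwo_odd_odd, Nat.cast_zero,
      add_zero]
  · rw [numMixed_odd (2 * b + 1 + 1) _ ⟨c, rfl⟩, show 2 * b + 1 + 1 = 2 * (b + 1) by ring,
      numMixed_eq, show 2 * (b + 1) = 2 * b + 2 by ring, lcdFormulaTwo_odd_even, Nat.cast_zero,
      add_zero, add_comm (2 * c + 1) (2 * b + 2), mul_comm (dotOrderTwo (2 * c + 1))]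
  · have h1 := numMixed_eq (2 * b + 1) (c + 1)
    have h2 := numMixed_eq (2 * c + 1) (b + 1)
    rw [show 2 * (c + 1) = 2 * c + 1 + 1 by ring] at h1
    rw [show 2 * (b + 1) = 2 * b + 1 + 1 by ring] at h2
    rw [h1, h2, lcdFormulaTwo_even_even, add_comm (2 * c + 1 + 1) (2 * b + 1 + 1),
      mul_comm (symplecticOrderTwo (b + 1))]

end BinaryCount


/-! ### Quadratic exponential sums -/

section QuadraticSums

open LinearMap (BilinForm)

variable (p : ℕ) [Fact p.Prime]

/-- The quadratic character of `ℤ/p` with complex values. -/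
noncomputable def quadCharC : MulChar (ZMod p) ℂ :=
  (quadraticChar (ZMod p)).ringHomComp (Int.castRingHom ℂ)

/-- The quadratic Gauss sum. -/
noncomputable def quadGauss : ℂ := gaussSum (quadCharC p) ZMod.stdAddChar

variable {p}

theorem quadCharC_apply (a : ZMod p) : quadCharC p a = (quadraticChar (ZMod p) a : ℂ) := rfl

theorem quadCharC_sq {a : ZMod p} (ha : a ≠ 0) : quadCharC p a ^ 2 = 1 := by
  rw [quadCharC_apply]
  exact_mod_cast quadraticChar_sq_one ha

theorem quadCharC_ne_one (hp : p ≠ 2) : quadCharC p ≠ 1 :=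
  (MulChar.ringHomComp_ne_one_iff (RingHom.injective_int _)).2
    (quadraticChar_ne_one (by rwa [ZMod.ringChar_zmod_n]))

theorem quadGauss_sq (hp : p ≠ 2) :
    quadGauss p ^ 2 = (quadraticChar (ZMod p) (-1) : ℂ) * p := by
  have hq : (quadCharC p).IsQuadratic := (quadraticChar_isQuadratic (ZMod p)).comp _
  rw [quadGauss, gaussSum_sq (χ := quadCharC p) (quadCharC_ne_one hp) hq (ZMod.isPrimitive_stdAddChar p), ZMod.card]
  rfl

theorem quadGauss_ne_zero (hp : p ≠ 2) : quadGauss p ≠ 0 := by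
  intro h
  have h1 := quadGauss_sq hp
  rw [h, zero_pow two_ne_zero] at h1
  have h2 := quadCharC_sq (p := p) (neg_ne_zero.2 one_ne_zero)
  rw [quadCharC_apply] at h2
  rcases mul_eq_zero.1 h1.symm with h3 | h3
  · rw [h3] at h2
    norm_num at h2
  · exact (Fact.out : p.Prime).ne_zero (by exact_mod_cast h3)

theorem sum_quadCharC_mul_stdAddChar {a : ZMod p} (ha : a ≠ 0) :
    ∑ x : ZMod p, quadCharC p x * ZMod.stdAddChar (a * x) = quadCharC p a * quadGauss p := by
  have h := gaussSum_mulShift (quadCharC p) ZMod.stdAddChar (Units.mk0 a ha)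
  have h2 := quadCharC_sq ha
  rw [quadGauss, ← h, ← mul_assoc, Units.val_mk0, ← sq, h2, one_mul]
  rfl

/-- Each y has 1 + χ(y) square roots, where χ is the quadratic character. The constant part sums a
nontrivial additive character to zero, and the rest is a Gauss sum. -/
theorem sum_stdAddChar_mul_sq (hp : p ≠ 2) {a : ZMod p} (ha : a ≠ 0) :
    ∑ x : ZMod p, (ZMod.stdAddChar (a * x ^ 2) : ℂ) = quadCharC p a * quadGauss p := by
  have h1 : ∀ y : ZMod p, ∑ x : ZMod p with x ^ 2 = y, (ZMod.stdAddChar (a * x ^ 2) : ℂ) =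
      quadCharC p y * ZMod.stdAddChar (a * y) + ZMod.stdAddChar (y * a) := fun y => by
    rw [Finset.sum_congr rfl fun x hx => by rw [(Finset.mem_filter.1 hx).2], Finset.sum_const,
      nsmul_eq_mul, mul_comm y a, ← add_one_mul, quadCharC_apply]
    congr 1
    have := quadraticChar_card_sqrts (F := ZMod p) (by rwa [ZMod.ringChar_zmod_n]) y
    rw [← Int.cast_one, ← Int.cast_add, ← this, Int.cast_natCast]
    congr 2
    ext x
    simp
  rw [← Finset.sum_fiberwise Finset.univ (fun x : ZMod p => x ^ 2), Finset.sum_congr rfl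
    fun y _ => h1 y, Finset.sum_add_distrib, sum_quadCharC_mul_stdAddChar ha,
    AddChar.sum_mulShift a (ZMod.isPrimitive_stdAddChar p), if_neg ha, Nat.cast_zero, add_zero]

variable {V : Type*} [AddCommGroup V] [Module (ZMod p) V]

/-- The exponential sum `∑_(v ∈ U) ψ(t B(v, v))`. -/
noncomputable def quadSum (B : BilinForm (ZMod p) V) (U : Submodule (ZMod p) V) (t : ZMod p) :
    ℂ :=
  ∑ᶠ v : U, ZMod.stdAddChar (t * B v v)

variable {B : BilinForm (ZMod p) V} {U W : Submodule (ZMod p) V}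

theorem quadSum_bot (t : ZMod p) : quadSum B ⊥ t = 1 := by
  rw [quadSum, finsum_eq_single _ 0 (fun x hx => (hx (Subsingleton.elim _ _)).elim)]
  simp

/-- The restriction of `B` to `U` has sign `σ`: its discriminant is a square if and only if
`σ = 1`. -/
def HasSign (B : BilinForm (ZMod p) V) (U : Submodule (ZMod p) V) (σ : ℤ) : Prop :=
  ∀ t : ZMod p, t ≠ 0 →
    quadSum B U t = σ * (quadCharC p t * quadGauss p) ^ Module.finrank (ZMod p) U

theorem hasSign_bot : HasSign B ⊥ 1 := fun t _ => by
  rw [quadSum_bot, finrank_bot, pow_zero]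
  simp

theorem HasSign.unique (hp : p ≠ 2) {σ τ : ℤ} (h : HasSign B U σ) (h' : HasSign B U τ) :
    σ = τ := by
  have h1 := (h 1 one_ne_zero).symm.trans (h' 1 one_ne_zero)
  have h2 : (quadCharC p 1 * quadGauss p) ^ Module.finrank (ZMod p) U ≠ 0 := by
    rw [map_one, one_mul]
    exact pow_ne_zero _ (quadGauss_ne_zero hp)
  exact_mod_cast mul_right_cancel₀ h2 h1

variable [Finite V] (hB : B.IsSymm)
include hB

/-- The exponential sum is multiplicative over the orthogonal splitting of U into the line of v and
its complement; the line contributes a one-variable quadratic Gauss sum. -/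
theorem quadSum_eq_mul (hp : p ≠ 2) {v : V} (hv : v ∈ U) (hvv : B v v ≠ 0) {t : ZMod p}
    (ht : t ≠ 0) : quadSum B U t =
      quadCharC p t * quadCharC p (B v v) * quadGauss p * quadSum B (perpIn B U v) t := by
  let f : ZMod p × perpIn B U v → U := fun x =>
    ⟨x.1 • v + x.2.1, U.add_mem (U.smul_mem _ hv) x.2.2.1⟩
  have h0 : ∀ y : perpIn B U v, B v y = 0 := fun y => mem_orthogonal_span_singleton.1 y.2.2
  have hf : Function.Bijective f := by
    constructor
    · intro x y hxy
      have h1 : x.1 • v + x.2.1 = y.1 • v + y.2.1 := congrArg Subtype.val hxy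
      have h2 := congrArg (B v) h1
      simp only [map_add, map_smul, h0, add_zero, smul_eq_mul] at h2
      have h3 := mul_right_cancel₀ hvv h2
      rw [h3] at h1
      exact Prod.ext h3 (Subtype.ext (add_left_cancel h1))
    · rintro ⟨x, hx⟩
      rw [← span_sup_perpIn hB hv hvv] at hx
      obtain ⟨z, hz, y, hy, rfl⟩ := Submodule.mem_sup.1 hx
      obtain ⟨a, rfl⟩ := Submodule.mem_span_singleton.1 hz
      exact ⟨(a, ⟨y, hy⟩), rfl⟩
  have := Fintype.ofFinite U
  have := Fintype.ofFinite (perpIn B U v)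
  rw [quadSum, quadSum, finsum_eq_sum_of_fintype, finsum_eq_sum_of_fintype, ← map_mul,
    ← sum_stdAddChar_mul_sq hp (mul_ne_zero ht hvv), Finset.sum_mul_sum, ← Finset.sum_product',
    Finset.univ_product_univ]
  refine (Fintype.sum_bijective f hf _ _ fun x => ?_).symm
  rw [← AddChar.map_add_eq_mul]
  congr 1
  have h1 : B x.2.1 v = 0 := (hB.eq _ _).trans (h0 x.2)
  simp only [f, map_add, map_smul, LinearMap.add_apply, LinearMap.smul_apply, smul_eq_mul, h0, h1]
  ring

/-- Splitting off v divides the sign by χ(B(v, v)), which equals multiplying by it because χ² = 1 on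
nonzero elements. The remaining factor, χ(t) times the Gauss sum, is nonzero and cancels. -/
theorem HasSign.perpIn (hp : p ≠ 2) {σ : ℤ} (h : HasSign B U σ) {v : V} (hv : v ∈ U)
    (hvv : B v v ≠ 0) : HasSign B (perpIn B U v) (σ * quadraticChar (ZMod p) (B v v)) := by
  intro t ht
  have h1 := h t ht
  rw [quadSum_eq_mul hB hp hv hvv ht, ← finrank_perpIn hB hv hvv, pow_succ] at h1
  have h2 := quadCharC_sq ht
  have h3 := quadCharC_sq hvv
  have h4 := quadGauss_ne_zero hp
  have h5 : quadCharC p t ≠ 0 := fun h => by simp [h] at h2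
  rw [Int.cast_mul, ← quadCharC_apply]
  refine mul_left_cancel₀ (mul_ne_zero h5 h4) ?_
  linear_combination quadCharC p (B v v) * h1 -
    quadCharC p t * quadGauss p * quadSum B (_root_.perpIn B U v) t * h3

theorem HasSign.of_perpIn (hp : p ≠ 2) {σ : ℤ} {v : V} (hv : v ∈ U)
    (hvv : B v v ≠ 0) (h : HasSign B (_root_.perpIn B U v) σ) :
    HasSign B U (σ * quadraticChar (ZMod p) (B v v)) := by
  intro t ht
  rw [quadSum_eq_mul hB hp hv hvv ht, h t ht, ← finrank_perpIn hB hv hvv, pow_succ, Int.cast_mul,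
    ← quadCharC_apply]
  ring

omit [Finite V] in
-- Polarisation: if all norms on U vanish then 2 B(x, y) = 0 on U, and 2 is invertible for odd p.
theorem exists_anisotropic (hp : p ≠ 2) (hU : B.NondegOn U) (h : U ≠ ⊥) :
    ∃ v ∈ U, B v v ≠ 0 := by
  obtain ⟨x, hx, hx0⟩ := (Submodule.ne_bot_iff U).1 h
  by_contra! hc
  refine hx0 (hU x hx fun y hy => ?_)
  have h1 := hc _ (U.add_mem hx hy)
  have h2 : B y x = B x y := hB.eq y x
  simp only [map_add, LinearMap.add_apply, hc x hx, hc y hy, h2] at h1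
  have h3 : (2 : ZMod p) * B x y = 0 := by linear_combination h1
  refine (mul_eq_zero.1 h3).resolve_left fun h4 => hp ?_
  have h5 : ((2 : ℕ) : ZMod p) = 0 := by exact_mod_cast h4
  rw [ZMod.natCast_eq_zero_iff] at h5
  exact (Nat.prime_dvd_prime_iff_eq Fact.out Nat.prime_two).1 h5

theorem exists_hasSign (hp : p ≠ 2) (hU : B.NondegOn U) :
    ∃ σ : ℤ, (σ = 1 ∨ σ = -1) ∧ HasSign B U σ := by
  induction h : Module.finrank (ZMod p) U generalizing U with
  | zero => exact ⟨1, Or.inl rfl, Submodule.finrank_eq_zero.1 h ▸ hasSign_bot⟩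
  | succ m ih =>
    obtain ⟨v, hv, hvv⟩ := exists_anisotropic hB hp hU (by rintro rfl; simp at h)
    have h1 := finrank_perpIn hB hv hvv
    obtain ⟨σ, hσ, hs⟩ := ih (nondegOn_perpIn hB hU hv hvv) (by omega)
    refine ⟨_, ?_, hs.of_perpIn hB hp hv hvv⟩
    rcases hσ with rfl | rfl <;> rcases quadraticChar_dichotomy hvv with h | h <;> simp [h]

omit hB in
/-- Character sum for the number of vectors of norm `c`. -/
theorem card_norm_mul (c : ZMod p) : (Nat.card {v // v ∈ U ∧ B v v = c} : ℂ) * p =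
    ∑ t : ZMod p, ZMod.stdAddChar (t * -c) * quadSum B U t := by
  classical
  have := Fintype.ofFinite U
  have h1 : ∀ t : ZMod p, ZMod.stdAddChar (t * -c) * quadSum B U t =
      ∑ v : U, (ZMod.stdAddChar (t * (B v v - c)) : ℂ) := fun t => by
    rw [quadSum, finsum_eq_sum_of_fintype, Finset.mul_sum]
    refine Finset.sum_congr rfl fun v _ => ?_
    rw [← AddChar.map_add_eq_mul]
    congr 1
    ring
  rw [Finset.sum_congr rfl fun t _ => h1 t, Finset.sum_comm, Finset.sum_congr rfl fun v _ =>
    AddChar.sum_mulShift _ (ZMod.isPrimitive_stdAddChar p)]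
  simp only [ZMod.card, Nat.cast_ite, Nat.cast_zero, sub_eq_zero]
  rw [← Finset.sum_filter, Finset.sum_const, nsmul_eq_mul]
  congr 2
  rw [← Fintype.card_subtype, ← Nat.card_eq_fintype_card]
  exact Nat.card_congr
    { toFun := fun v => ⟨⟨v.1, v.2.1⟩, v.2.2⟩
      invFun := fun v => ⟨v.1.1, v.1.2, v.2⟩
      left_inv := fun _ => rfl
      right_inv := fun _ => rfl }

omit hB in
theorem HasSign.card_norm_mul {σ : ℤ} (h : HasSign B U σ) (h0 : Module.finrank (ZMod p) U ≠ 0)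
    (c : ZMod p) : (Nat.card {v // v ∈ U ∧ B v v = c} : ℂ) * p =
      (p : ℂ) ^ Module.finrank (ZMod p) U + σ * quadGauss p ^ Module.finrank (ZMod p) U *
        ∑ t : ZMod p, quadCharC p t ^ Module.finrank (ZMod p) U * ZMod.stdAddChar (t * -c) := by
  have := Fintype.ofFinite U
  -- The formula for t ≠ 0 evaluates to zero at t = 0, because χ(0) = 0 and the dimension is
  -- positive; the true value there, the size of U, is added as a correction.
  have h1 : ∀ t : ZMod p, quadSum B U t =
      σ * (quadCharC p t * quadGauss p) ^ Module.finrank (ZMod p) U +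
        if t = 0 then (p : ℂ) ^ Module.finrank (ZMod p) U else 0 := fun t => by
    split_ifs with ht
    · rw [ht, MulChar.map_zero, zero_mul, zero_pow h0, quadSum, finsum_eq_sum_of_fintype]
      simp only [zero_mul, AddChar.map_zero_eq_one, Finset.sum_const, nsmul_eq_mul, mul_one,
        mul_zero, zero_add, Finset.card_univ]
      rw [← Nat.card_eq_fintype_card, Module.natCard_eq_pow_finrank (K := ZMod p), Nat.card_zmod]
      push_cast
      rfl
    · rw [add_zero, h t ht]
  rw [_root_.card_norm_mul]
  simp only [h1, mul_add, Finset.sum_add_distrib, mul_ite, mul_zero, Finset.sum_ite_eq',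
    Finset.mem_univ, if_true, zero_mul, AddChar.map_zero_eq_one, one_mul, Finset.mul_sum]
  rw [add_comm]
  congr 1
  refine Finset.sum_congr rfl fun t _ => ?_
  ring

omit hB in
-- An odd power of χ is χ, so the sum over t is again a Gauss sum, equal to χ(-c) times the basic
-- one. The total power of the Gauss sum becomes even and is evaluated by its square; one factor
-- χ(-1) cancels against χ(-c).
theorem HasSign.card_norm_odd (hp : p ≠ 2) {σ : ℤ} (h : HasSign B U σ) {a : ℕ}
    (ha : Module.finrank (ZMod p) U = 2 * a + 1) {c : ZMod p} (hc : c ≠ 0) :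
    (Nat.card {v // v ∈ U ∧ B v v = c} : ℤ) = p ^ (2 * a) +
      σ * quadraticChar (ZMod p) c * quadraticChar (ZMod p) (-1) ^ a * p ^ a := by
  have h1 := h.card_norm_mul (by omega) c
  have h2 : ∀ t : ZMod p, quadCharC p t ^ (2 * a + 1) = quadCharC p t := fun t => by
    rcases eq_or_ne t 0 with rfl | ht
    · rw [MulChar.map_zero, zero_pow (by omega)]
    · rw [pow_succ, pow_mul, quadCharC_sq ht, one_pow, one_mul]
  have h3 := sum_quadCharC_mul_stdAddChar (neg_ne_zero.2 hc)
  have h4 := quadCharC_sq (p := p) (neg_ne_zero.2 one_ne_zero)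
  have h5 := quadGauss_sq hp
  have hp0 : (p : ℂ) ≠ 0 := Nat.cast_ne_zero.2 (Fact.out : p.Prime).ne_zero
  simp only [ha, h2, fun t : ZMod p => mul_comm t (-c), h3] at h1
  rw [neg_eq_neg_one_mul c, map_mul] at h1
  rw [← quadCharC_apply] at h5
  have h6 : (Nat.card {v // v ∈ U ∧ B v v = c} : ℂ) = p ^ (2 * a) +
      σ * quadCharC p c * quadCharC p (-1) ^ a * p ^ a := by
    refine mul_right_cancel₀ hp0 ?_
    rw [h1, pow_succ (quadGauss p), pow_mul (quadGauss p), h5, mul_pow]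
    linear_combination σ * quadCharC p (-1) ^ a * p ^ a * quadCharC p (-1) * quadCharC p c * h5 +
      σ * quadCharC p (-1) ^ a * p ^ a * quadCharC p c * p * h4
  simp only [quadCharC_apply] at h6
  exact_mod_cast h6

omit hB in
-- An even positive power of χ is the indicator of t ≠ 0, so the sum over t is a full additive
-- character sum minus its term at zero, that is -1.
theorem HasSign.card_norm_even (hp : p ≠ 2) {σ : ℤ} (h : HasSign B U σ) {a : ℕ}
    (ha : Module.finrank (ZMod p) U = 2 * a + 2) {c : ZMod p} (hc : c ≠ 0) :
    (Nat.card {v // v ∈ U ∧ B v v = c} : ℤ) = p ^ (2 * a + 1) -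
      σ * quadraticChar (ZMod p) (-1) ^ (a + 1) * p ^ a := by
  have h1 := h.card_norm_mul (by omega) c
  have h2 : ∀ t : ZMod p, quadCharC p t ^ (2 * a + 2) * ZMod.stdAddChar (t * -c) =
      ZMod.stdAddChar (t * -c) - if t = 0 then 1 else 0 := fun t => by
    split_ifs with ht
    · rw [ht, MulChar.map_zero, zero_pow (by omega), zero_mul, zero_mul, AddChar.map_zero_eq_one,
        sub_self]
    · rw [show 2 * a + 2 = 2 * (a + 1) by ring, pow_mul, quadCharC_sq ht, one_pow, one_mul,
        sub_zero]
  have h3 : ∑ t : ZMod p, (ZMod.stdAddChar (t * -c) : ℂ) = 0 := by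
    rw [AddChar.sum_mulShift _ (ZMod.isPrimitive_stdAddChar p), if_neg (neg_ne_zero.2 hc),
      Nat.cast_zero]
  have h5 := quadGauss_sq hp
  have hp0 : (p : ℂ) ≠ 0 := Nat.cast_ne_zero.2 (Fact.out : p.Prime).ne_zero
  simp only [ha, h2, Finset.sum_sub_distrib, h3, Finset.sum_ite_eq', Finset.mem_univ,
    if_true] at h1
  rw [← quadCharC_apply] at h5
  have h6 : (Nat.card {v // v ∈ U ∧ B v v = c} : ℂ) = p ^ (2 * a + 1) -
      σ * quadCharC p (-1) ^ (a + 1) * p ^ a := by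
    refine mul_right_cancel₀ hp0 ?_
    rw [h1, show 2 * a + 2 = 2 * (a + 1) by ring, pow_mul (quadGauss p), h5, mul_pow]
    ring
  simp only [quadCharC_apply] at h6
  exact_mod_cast h6

omit hB [Finite V] in
-- The exponential sum of a sum of n squares is the nth power of the one-variable sum.
theorem hasSign_dotForm_top (hp : p ≠ 2) (n : ℕ) : HasSign (dotForm p n) ⊤ 1 := by
  intro t ht
  have := Fintype.ofFinite (⊤ : Submodule (ZMod p) (Fin n → ZMod p))
  rw [finrank_top, Module.finrank_fin_fun, ← sum_stdAddChar_mul_sq hp ht, Int.cast_one, one_mul,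
    Fintype.sum_pow, quadSum, finsum_eq_sum_of_fintype]
  refine Fintype.sum_equiv Submodule.topEquiv.toEquiv _ _ fun v => ?_
  have h : ∀ (s : Finset (Fin n)) (f : Fin n → ZMod p),
      (ZMod.stdAddChar (∑ i ∈ s, f i) : ℂ) = ∏ i ∈ s, ZMod.stdAddChar (f i) := fun s f =>
    map_prod (ZMod.stdAddChar (N := p)).toMonoidHom (fun i => Multiplicative.ofAdd (f i)) s
  rw [← h, ← Finset.mul_sum, dotForm_apply, dotProduct]
  simp only [sq]
  rfl

end QuadraticSums


/-! ### The count for odd primes -/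

section OddCount

open LinearMap (BilinForm)

variable {p : ℕ} [Fact p.Prime] {V : Type*} [AddCommGroup V] [Module (ZMod p) V] [Finite V]
  {B : BilinForm (ZMod p) V} {U : Submodule (ZMod p) V}

theorem sign_sq {d : ℤ} (hd : d = 1 ∨ d = -1) : d * d = 1 := by
  rcases hd with rfl | rfl <;> rfl

/-- Orbit-stabiliser in numerical form: vectors of norm c play the role of an orbit, with stabiliser
the isometry group of a complement of dimension j and sign dε. For j = 0 there are vectors of norm c
only when ε agrees with d, hence the extra hypothesis. -/
theorem orthogonalOrder_succ (hp : p ≠ 2) {d ε : ℤ} (hd : d = 1 ∨ d = -1) (hε : ε = 1 ∨ ε = -1)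
    (hs : HasSign B U d) {j : ℕ} (hj : Module.finrank (ZMod p) U = j + 1) (h0 : j = 0 → d = ε)
    {c : ZMod p} (hc : c ≠ 0) (hcε : quadraticChar (ZMod p) c = ε) :
    (Nat.card {v // v ∈ U ∧ B v v = c} : ℚ) *
        orthogonalOrder p (quadraticChar (ZMod p) (-1) : ℤ) j (d * ε : ℤ) =
      orthogonalOrder p (quadraticChar (ZMod p) (-1) : ℤ) (j + 1) d := by
  have hθ : ((quadraticChar (ZMod p) (-1) : ℤ) : ℚ) ^ 2 = 1 := by
    exact_mod_cast quadraticChar_sq_one (F := ZMod p) (neg_ne_zero.2 one_ne_zero)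
  have hd2 : (d : ℚ) * d = 1 := by exact_mod_cast sign_sq hd
  have hε2 : (ε : ℚ) * ε = 1 := by exact_mod_cast sign_sq hε
  obtain ⟨a, rfl | rfl⟩ := Nat.even_or_odd' j
  · have hN := congrArg (Int.cast (R := ℚ)) (hs.card_norm_odd hp hj hc)
    rw [hcε] at hN
    push_cast at hN
    rw [hN, orthogonalOrder_odd]
    set θ : ℚ := ((quadraticChar (ZMod p) (-1) : ℤ) : ℚ)
    rcases a with _ | a
    · rw [← h0 rfl]
      simp only [gaussFactorial, orthogonalOrder, Nat.mul_zero, if_true, Finset.range_zero,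
        Finset.prod_empty, pow_zero, zero_pow two_ne_zero, hd2]
      norm_num
    · rw [show 2 * (a + 1) = 2 * a + 2 by ring, orthogonalOrder_even, gaussFactorial_succ]
      have hθa : (θ ^ (a + 1)) ^ 2 = 1 := by rw [← pow_mul, mul_comm, pow_mul, hθ, one_pow]
      push_cast
      rw [show (p : ℚ) ^ (2 * a + 2) = p ^ (a + 1) * p ^ (a + 1) by ring,
        show ((p : ℚ) ^ 2) ^ (a + 1) = p ^ (a + 1) * p ^ (a + 1) by ring,
        show (p : ℚ) ^ ((a + 1) ^ 2) = p ^ ((a + 1) * a) * p ^ (a + 1) by ring]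
      have h1 : (d * ε * θ ^ (a + 1)) ^ 2 = (1 : ℚ) := by
        rw [mul_pow, mul_pow, hθa, sq, sq, hd2, hε2]; norm_num
      linear_combination (-2 * (p : ℚ) ^ ((a + 1) * a) * p ^ (a + 1) *
        gaussFactorial (p ^ 2) a) * h1
  · have hN := congrArg (Int.cast (R := ℚ)) (hs.card_norm_even hp hj hc)
    push_cast at hN
    rw [hN, orthogonalOrder_odd, show 2 * a + 1 + 1 = 2 * a + 2 by ring, orthogonalOrder_even]
    rw [show (p : ℚ) ^ ((a + 1) * a) = p ^ (a ^ 2) * p ^ a by ring]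
    ring

/-- Induction on s using vectors v of norm c with χ(c) = δ. Splitting v off W makes its sign δ² = 1,
and off U makes it dδ, so the product of ambient and subspace signs, which is the sign of the
complement, is preserved. The two boundary hypotheses say that a zero space has sign 1. -/
theorem card_nondegOn_hasSign (hB : B.IsSymm) (hp : p ≠ 2) {d δ : ℤ} (hd : d = 1 ∨ d = -1)
    (hδ : δ = 1 ∨ δ = -1) (hU : B.NondegOn U) (hs : HasSign B U d) {s k : ℕ}
    (hm : Module.finrank (ZMod p) U = s + k) (hs0 : s = 0 → δ = 1) (hk0 : k = 0 → δ = d) :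
    (Nat.card {W : Submodule (ZMod p) V // W ≤ U ∧ B.NondegOn W ∧
      Module.finrank (ZMod p) W = s ∧ HasSign B W δ} : ℚ) *
        orthogonalOrder p (quadraticChar (ZMod p) (-1) : ℤ) s δ *
        orthogonalOrder p (quadraticChar (ZMod p) (-1) : ℤ) k (d * δ : ℤ) =
      orthogonalOrder p (quadraticChar (ZMod p) (-1) : ℤ) (s + k) d := by
  induction s generalizing U d δ with
  | zero =>
    have h1 : Nat.card {W : Submodule (ZMod p) V // W ≤ U ∧ B.NondegOn W ∧
        Module.finrank (ZMod p) W = 0 ∧ HasSign B W δ} = 1 := by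
      rw [Nat.card_eq_one_iff_exists, hs0 rfl]
      exact ⟨⟨⊥, bot_le, nondegOn_bot, finrank_bot _ _, hasSign_bot⟩, fun W =>
        Subtype.ext (Submodule.finrank_eq_zero.1 W.2.2.2.1)⟩
    rw [h1, hs0 rfl, Nat.zero_add, mul_one, orthogonalOrder, if_pos rfl, Nat.cast_one, one_mul,
      one_mul]
  | succ s ih =>
    have hp1 : 1 < p := (Fact.out : p.Prime).one_lt
    have hθ : ((quadraticChar (ZMod p) (-1) : ℤ) : ℚ) ^ 2 = 1 := by
      exact_mod_cast quadraticChar_sq_one (F := ZMod p) (neg_ne_zero.2 one_ne_zero)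
    have hsgn : ∀ {x : ℤ}, x = 1 ∨ x = -1 → (x : ℚ) ^ 2 = 1 := fun h => by
      rw [sq]; exact_mod_cast sign_sq h
    have hdδ : d * δ = 1 ∨ d * δ = -1 := by
      rcases hd with rfl | rfl <;> rcases hδ with rfl | rfl <;> simp
    obtain ⟨c, hcδ⟩ : ∃ c : ZMod p, quadraticChar (ZMod p) c = δ := by
      rcases hδ with rfl | rfl
      · exact ⟨1, map_one _⟩
      · exact quadraticChar_exists_neg_one (by rwa [ZMod.ringChar_zmod_n])
    have hc : c ≠ 0 := by
      rintro rfl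
      rw [MulChar.map_zero] at hcδ
      rcases hδ with h | h <;> rw [h] at hcδ <;> simp at hcδ
    have hN := orthogonalOrder_succ hp hd hδ hs (j := s + k) (by omega)
      (fun h => (hk0 (by omega)).symm) hc hcδ
    have hord := orthogonalOrder_ne_zero hp1 hθ (hsgn hd) (s + k + 1)
    have hN0 : (Nat.card {v // v ∈ U ∧ B v v = c} : ℚ) ≠ 0 := fun h => by
      rw [h, zero_mul] at hN
      exact hord hN.symm
    have hIH : ∀ v, v ∈ U ∧ B v v = c → (Nat.card {W : Submodule (ZMod p) V //
        W ≤ perpIn B U v ∧ B.NondegOn W ∧ Module.finrank (ZMod p) W = s ∧ HasSign B W 1} : ℚ) *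
        orthogonalOrder p (quadraticChar (ZMod p) (-1) : ℤ) s 1 *
        orthogonalOrder p (quadraticChar (ZMod p) (-1) : ℤ) k (d * δ : ℤ) =
        orthogonalOrder p (quadraticChar (ZMod p) (-1) : ℤ) (s + k) (d * δ : ℤ) := by
      rintro v ⟨hv, hvc⟩
      have hvv : B v v ≠ 0 := by rwa [hvc]
      have h1 := hs.perpIn hB hp hv hvv
      rw [hvc, hcδ] at h1
      have h2 := finrank_perpIn hB hv hvv
      have h3 := ih hdδ (Or.inl rfl) (nondegOn_perpIn hB hU hv hvv) h1 (by omega) (fun _ => rfl)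
        (fun h => by rw [hk0 h, sign_sq hd])
      rwa [mul_one, Int.cast_one] at h3
    obtain ⟨⟨v₀, hv₀⟩⟩ : Nonempty {v // v ∈ U ∧ B v v = c} :=
      (Nat.card_ne_zero.1 (by exact_mod_cast hN0)).1
    have hl : ∀ W, W ≤ U → B.NondegOn W → Module.finrank (ZMod p) W = s + 1 ∧ HasSign B W δ →
        (Nat.card {v // v ∈ W ∧ B v v = c} : ℚ) *
          orthogonalOrder p (quadraticChar (ZMod p) (-1) : ℤ) s 1 =
          orthogonalOrder p (quadraticChar (ZMod p) (-1) : ℤ) (s + 1) δ := by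
      intro W _ _ hG
      have h1 := orthogonalOrder_succ hp hδ hδ hG.2 hG.1 (fun _ => rfl) hc hcδ
      rwa [sign_sq hδ, Int.cast_one] at h1
    have ho1 := orthogonalOrder_ne_zero hp1 hθ (one_pow 2) s
    have ho2 := orthogonalOrder_ne_zero hp1 hθ (hsgn hdδ) k
    have ho3 := orthogonalOrder_ne_zero hp1 hθ (hsgn hdδ) (s + k)
    have hcount : ∀ l : ℕ, (∀ W, W ≤ U → B.NondegOn W →
        Module.finrank (ZMod p) W = s + 1 ∧ HasSign B W δ →
        Nat.card {v // v ∈ W ∧ B v v = c} = l) →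
        Nat.card {v // v ∈ U ∧ B v v = c} * Nat.card {W : Submodule (ZMod p) V //
          W ≤ perpIn B U v₀ ∧ B.NondegOn W ∧ Module.finrank (ZMod p) W = s ∧ HasSign B W 1} =
        Nat.card {W : Submodule (ZMod p) V // W ≤ U ∧ B.NondegOn W ∧
          Module.finrank (ZMod p) W = s + 1 ∧ HasSign B W δ} * l := by
      intro l hl'
      refine card_anisotropic_mul (U := U) hB (fun v => v ∈ U ∧ B v v = c)
        (fun W => Module.finrank (ZMod p) W = s + 1 ∧ HasSign B W δ) (fun _ _ => True)
        (fun _ W => Module.finrank (ZMod p) W = s ∧ HasSign B W 1)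
        (fun v hv => ⟨hv.1, by rwa [hv.2]⟩) (fun v W hv hWU hW hvW => ?_) _ l
        (fun v hv => Nat.cast_injective (R := ℚ) (mul_right_cancel₀ ho1 (mul_right_cancel₀ ho2
          ((hIH v hv).trans (hIH v₀ hv₀).symm)))) (fun W hWU hW hG => ?_)
      · have hvv : B v v ≠ 0 := by rwa [hv.2]
        have h1 := finrank_perpIn hB hvW hvv
        constructor
        · rintro ⟨⟨h2, h3⟩, -⟩
          have h4 := h3.perpIn hB hp hvW hvv
          rw [hv.2, hcδ, sign_sq hδ] at h4
          exact ⟨by omega, h4⟩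
        · rintro ⟨h2, h3⟩
          have h4 := h3.of_perpIn hB hp hvW hvv
          rw [hv.2, hcδ, one_mul] at h4
          exact ⟨⟨by omega, h4⟩, trivial⟩
      · rw [← hl' W hWU hW hG]
        exact Nat.card_congr (Equiv.subtypeEquivRight fun v => ⟨fun h => ⟨h.2.1, h.1.2⟩,
          fun h => ⟨⟨hWU h.1, h.2⟩, h.1, trivial⟩⟩)
    have hL' := hIH v₀ hv₀
    have hL0 : Nat.card {W : Submodule (ZMod p) V //
        W ≤ perpIn B U v₀ ∧ B.NondegOn W ∧ Module.finrank (ZMod p) W = s ∧ HasSign B W 1} ≠ 0 :=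
      fun h => by
        rw [h, Nat.cast_zero, zero_mul, zero_mul] at hL'
        exact ho3 hL'.symm
    -- The number of vectors of norm c in W is known only through a rational identity, so one W is
    -- needed to name it as a natural number. If there were none, the double count with multiplicity
    -- 0 would make a product of nonzero counts vanish.
    obtain ⟨W₀, hW₀U, hW₀, hG₀⟩ : ∃ W, W ≤ U ∧ B.NondegOn W ∧
        Module.finrank (ZMod p) W = s + 1 ∧ HasSign B W δ := by
      by_contra hne
      have h1 := hcount 0 fun W h1 h2 h3 => (hne ⟨W, h1, h2, h3⟩).elim
      rw [mul_zero] at h1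
      exact mul_ne_zero (by exact_mod_cast hN0) hL0 h1
    have hcard := hcount _ fun W h1 h2 h3 => Nat.cast_injective (R := ℚ) (mul_right_cancel₀ ho1
      ((hl W h1 h2 h3).trans (hl W₀ hW₀U hW₀ hG₀).symm))
    have hq := congrArg (Nat.cast (R := ℚ)) hcard
    rw [Nat.cast_mul, Nat.cast_mul] at hq
    rw [← hl W₀ hW₀U hW₀ hG₀, ← mul_assoc, ← hq, mul_assoc _ _ (orthogonalOrder _ _ s 1),
      mul_assoc, hL', hN, show s + k + 1 = s + 1 + k by ring]

/-- Every nondegenerate subspace has exactly one sign. The dot product on the whole space has sign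
1, so subspace and complement share their sign; the two summands are the two possibilities. -/
theorem numLCD_eq_orthogonalOrder (hp : p ≠ 2) (s k : ℕ) :
    (numLCD p (s + 1 + (k + 1)) (s + 1) : ℚ) =
      orthogonalOrder p (quadraticChar (ZMod p) (-1) : ℤ) (s + 1 + (k + 1)) 1 /
        (orthogonalOrder p (quadraticChar (ZMod p) (-1) : ℤ) (s + 1) 1 *
          orthogonalOrder p (quadraticChar (ZMod p) (-1) : ℤ) (k + 1) 1) +
      orthogonalOrder p (quadraticChar (ZMod p) (-1) : ℤ) (s + 1 + (k + 1)) 1 /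
        (orthogonalOrder p (quadraticChar (ZMod p) (-1) : ℤ) (s + 1) (-1) *
          orthogonalOrder p (quadraticChar (ZMod p) (-1) : ℤ) (k + 1) (-1)) := by
  set n := s + 1 + (k + 1) with hn
  have hB := dotForm_isSymm p n
  have hp1 : 1 < p := (Fact.out : p.Prime).one_lt
  have hθ : ((quadraticChar (ZMod p) (-1) : ℤ) : ℚ) ^ 2 = 1 := by
    exact_mod_cast quadraticChar_sq_one (F := ZMod p) (neg_ne_zero.2 one_ne_zero)
  have hne : ∀ {σ : ℚ}, σ ^ 2 = 1 → ∀ m,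
      orthogonalOrder p (quadraticChar (ZMod p) (-1) : ℤ) m σ ≠ 0 := fun h m =>
    orthogonalOrder_ne_zero hp1 hθ h m
  have key : ∀ δ : ℤ, δ = 1 ∨ δ = -1 → (Nat.card {W : Submodule (ZMod p) (Fin n → ZMod p) //
      W ≤ ⊤ ∧ (dotForm p n).NondegOn W ∧ Module.finrank (ZMod p) W = s + 1 ∧
        HasSign (dotForm p n) W δ} : ℚ) =
      orthogonalOrder p (quadraticChar (ZMod p) (-1) : ℤ) n 1 /
        (orthogonalOrder p (quadraticChar (ZMod p) (-1) : ℤ) (s + 1) δ *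
          orthogonalOrder p (quadraticChar (ZMod p) (-1) : ℤ) (k + 1) δ) := fun δ hδ => by
    have h1 := card_nondegOn_hasSign hB hp (Or.inl rfl) hδ (dotForm_nondegOn_top p n)
      (hasSign_dotForm_top hp n) (s := s + 1) (k := k + 1)
      (by rw [finrank_top, Module.finrank_fin_fun]) (by omega) (by omega)
    have h2 : (δ : ℚ) ^ 2 = 1 := by rw [sq]; exact_mod_cast sign_sq hδ
    rw [one_mul, Int.cast_one] at h1
    rw [eq_div_iff (mul_ne_zero (hne h2 _) (hne h2 _)), ← mul_assoc]
    exact h1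
  have k1 := key 1 (Or.inl rfl)
  have k2 := key (-1) (Or.inr rfl)
  rw [Int.cast_one] at k1
  rw [Int.cast_neg, Int.cast_one] at k2
  rw [← k1, ← k2, ← Nat.cast_add, ← Nat.card_sum, numLCD_eq_card]
  have hdis : ∀ W, HasSign (dotForm p n) W (-1) → ¬ HasSign (dotForm p n) W 1 := fun W h h' => by
    have := h.unique hp h'
    norm_num at this
  have hex : ∀ W, (dotForm p n).NondegOn W → ¬ HasSign (dotForm p n) W 1 →
      HasSign (dotForm p n) W (-1) := fun W hW h => by
    obtain ⟨σ, rfl | rfl, hσ⟩ := exists_hasSign hB hp hW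
    · exact (h hσ).elim
    · exact hσ
  classical
  congr 1
  refine Nat.card_congr
    { toFun := fun W => if h : HasSign (dotForm p n) W.1 1 then
          Sum.inl ⟨W.1, le_top, W.2.1, W.2.2, h⟩
        else Sum.inr ⟨W.1, le_top, W.2.1, W.2.2, hex _ W.2.1 h⟩
      invFun := Sum.elim (fun W => ⟨W.1, W.2.2.1, W.2.2.2.1⟩) (fun W => ⟨W.1, W.2.2.1, W.2.2.2.1⟩)
      left_inv := fun W => ?_
      right_inv := ?_ }
  · dsimp only
    split_ifs <;> rfl
  · rintro (W | W)
    · exact dif_pos W.2.2.2.2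
    · exact dif_neg (hdis _ W.2.2.2.2)

theorem quadraticChar_neg_one_eq (hp : p ≠ 2) :
    ((quadraticChar (ZMod p) (-1) : ℤ) : ℚ) = if p % 4 = 1 then 1 else -1 := by
  have h := (Fact.out : p.Prime).eq_two_or_odd.resolve_left hp
  rw [quadraticChar_neg_one (by rwa [ZMod.ringChar_zmod_n]), ZMod.card,
    ZMod.χ₄_nat_eq_if_mod_four, if_neg (by omega)]
  split_ifs <;> simp

theorem numLCD_odd (hp : p ≠ 2) (s k : ℕ) : (numLCD p (s + 1 + (k + 1)) (s + 1) : ℚ) =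
    lcdFormulaOdd p (s + 1 + (k + 1)) (s + 1) := by
  have hp1 : 1 < p := (Fact.out : p.Prime).one_lt
  have hθ : ((quadraticChar (ZMod p) (-1) : ℤ) : ℚ) ^ 2 = 1 := by
    exact_mod_cast quadraticChar_sq_one (F := ZMod p) (neg_ne_zero.2 one_ne_zero)
  rw [numLCD_eq_orthogonalOrder hp]
  rcases Nat.even_or_odd' s with ⟨b, rfl | rfl⟩ <;> rcases Nat.even_or_odd' k with ⟨c, rfl | rfl⟩
  · exact (lcdFormulaOdd_even_odd hp1 b c (quadraticChar_neg_one_eq hp)).symm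
  · exact (lcdFormulaOdd_odd_odd hp1 b c hθ).symm
  · exact (lcdFormulaOdd_odd_even hp1 c b hθ).symm
  · exact (lcdFormulaOdd_even_even hp1 b c hθ).symm

end OddCount

/-! ### Assembling the closed forms and the number of codes -/

theorem numLCD_eq_lcdFormula {p n s : ℕ} [Fact p.Prime] (hs : s ≤ n) :
    (numLCD p n s : ℚ) = lcdFormula p n s := by
  rw [lcdFormula]
  split_ifs with h hp
  · rcases h with rfl | rfl
    · rw [numLCD_zero, Nat.cast_one]
    · rw [numLCD_self, Nat.cast_one]
  · subst hp
    obtain ⟨a, rfl⟩ : ∃ a, s = a + 1 := ⟨s - 1, by omega⟩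
    obtain ⟨b, rfl⟩ : ∃ b, n = a + 1 + (b + 1) := ⟨n - (a + 1) - 1, by omega⟩
    exact numLCD_two a b
  · obtain ⟨a, rfl⟩ : ∃ a, s = a + 1 := ⟨s - 1, by omega⟩
    obtain ⟨b, rfl⟩ : ∃ b, n = a + 1 + (b + 1) := ⟨n - (a + 1) - 1, by omega⟩
    exact numLCD_odd hp a b

theorem corollary5p1 {p e r k t N : ℕ} [Fact p.Prime] (hN : 0 < N)
    (E : EisensteinData p e r k t) (ξ : ℂ) (hξ : IsPrimitiveRoot ξ (p ^ e)) :
    Nat.card {D : AddSubgroup (Fin N → E.ChainRing) // E.IsACD ξ D} =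
        ∑ i ∈ Finset.range (N * r * t + 1), ∑ j ∈ Finset.range (N * r * (k - t) + 1),
          numLCD p (N * r * t) i * numLCD p (N * r * (k - t)) j *
            p ^ ((N * r * t - i) * (e - 1) * (i + j) +
              (N * r * (k - t) - j) * ((e - 1) * i + (e - 2) * j)) ∧
      (∀ i ≤ N * r * t, (numLCD p (N * r * t) i : ℚ) = lcdFormula p (N * r * t) i) ∧
      (∀ j ≤ N * r * (k - t),
        (numLCD p (N * r * (k - t)) j : ℚ) = lcdFormula p (N * r * (k - t)) j) := by
  refine ⟨?_, fun i hi => numLCD_eq_lcdFormula hi, fun j hj => numLCD_eq_lcdFormula hj⟩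
  have he := E.two_le_e
  -- The exponent of the second block is c = e - 1, nonzero because e ≥ 2; so its reduction modulo p
  -- makes sense and e - 2 is not truncated.
  obtain ⟨c, rfl⟩ : ∃ c, e = c + 1 := ⟨e - 1, by omega⟩
  rw [Nat.add_sub_cancel, show c + 1 - 2 = c - 1 by omega]
  exact E.card_isACD hξ (by omega)
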